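/- Let $k\ge 1$ be an integer, let $C_{2k+1}$ be the cycle with vertices $1,\dots,2k+1$ in cyclic order, and let $$\alpha_k=\left(\frac{2k+1}{2}\right)^{\frac1{2k+1}}\left(\frac{2k+1}{2k}\right)^{\frac{2k}{2k+1}}.$$ (a) There is a randomized algorithm (a random-access machine program with fair coin flips and logarithmic cost) that, given a simple undirected graph $G$ on $n$ vertices by its adjacency matrix, decides whether there is a homomorphism from $G$ to $C_{2k+1}$. For all outcomes of its coin flips it halts in time $\alpha_k^{\,n}\,n^{O(1)}$ and uses space polynomial in $n$. More precisely, there is a constant $c$ such that for every $n\ge 0$ the time is at most $c\,\alpha_k^{\,n}(n+1)^{c}$ and the space is at most $c\,(n+1)^{c}$; both the program and $c$ may depend on $k$. If there is a homomorphism, the algorithm answers YES with probability at least $2/3$; if there is none, it never answers YES. Moreover, let $\mathcal S_k=\{S_k,S_k^A,S_k^B\}$, where $S_k=\{2,\dots,2k+1\}$, $S_k^A$ is the set of odd vertices, and $S_k^B$ is the set of even vertices together with the vertex $1$. For $U,W\in\mathcal S_k$ let $R_{UW}=\{(u,w)\in U\times W: uw\in E(C_{2k+1})\}$. For a graph $G$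 and lists $L:V(G)\to\mathcal S_k$ let $I_{G,L}$ be the valued constraint satisfaction instance with one variable $x_v\in\{1,\dots,2k+1\}$ for every $v\in V(G)$ and, for every edge $uv$ of $G$, one term $\phi_{uv}(x_u,x_v)$ equal to $0$ on $R_{L(u)L(v)}$ and to $\infty$ elsewhere. (b) There is a majority operation $f$ on $\{1,\dots,2k+1\}$, that is, $f(b,a,a)=f(a,b,a)=f(a,a,b)=a$ for all $a,b$, that is a polymorphism of all relations $R_{UW}$ with $U,W\in\mathcal S_k$. (c) For every finite graph $G$ and all lists $L:V(G)\to\mathcal S_k$, the optimum of the Sherali–Adams linear programming relaxation of $I_{G,L}$ at level $(2,3)$ equals the optimum of $I_{G,L}$ (both are $\infty$ if infeasible), and it is $0$ if and only if there is a homomorphism $g$ from $G$ to $C_{2k+1}$ with $g(v)\in L(v)$ for all $v\in V(G)$. Here the level-$(2,3)$ relaxation has, for every term of the instance and for every zero term added on a tuple of one, two or three variables, a probability distribution on the assignments of the variables of that term; the distribution gives weight $0$ to assignments of infinite cost, and whenever the variable set $Y$ of one term has at most two elements and is contained in that of another, the distribution of the second has the distribution of the first as its marginal on $Y$. The objective is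 to minimize the sum of the expected costs of the terms. (d) If $G$ has $n$ vertices and there is a homomorphism from $G$ to $C_{2k+1}$, and if the lists $L(v)$ are drawn independently from $\mathcal S_k$, with probability $\frac{2k-1}{2k+1}$ for $S_k$ and $\frac1{2k+1}$ for each of $S_k^A$ and $S_k^B$, then with probability at least $\alpha_k^{-n}$ the level-$(2,3)$ relaxation of $I_{G,L}$ has optimum $0$. -/

import Mathlib

open scoped ENNReal

noncomputable section

/-! ### A randomized random-access machine with logarithmic cost

Programs are structured (sequencing, branching, while loops).  The memory consists of arrays
named by natural numbers; every array is an infinite sequence of cells holding natural numbers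
of arbitrary size, and all but finitely many cells hold `0`.  A program mentions only finitely
many arrays.  Every operation is charged the bit lengths of the numbers it handles, and
randomness comes from independent fair coin flips. -/

namespace RAM

/-- The contents of the memory: the number in cell `i` of array `a` is `σ (a, i)`. -/
abbrev Store := ℕ × ℕ →₀ ℕ

/-- Number of bits in use: each nonzero cell counts for its address, its content and one. -/
def Store.space (σ : Store) : ℕ :=
  σ.sum fun c v => 1 + Nat.size c.2 + Nat.size v

/-- Arithmetic expressions; `read a i` is the content of cell `i` of array `a`,
subtraction is truncated and division is integer division. -/
inductive Expr where
  | const (c : ℕ)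
  | read (a : ℕ) (i : Expr)
  | add (e₁ e₂ : Expr)
  | sub (e₁ e₂ : Expr)
  | mul (e₁ e₂ : Expr)
  | div (e₁ e₂ : Expr)

/-- The value of an expression. -/
def Expr.eval (σ : Store) : Expr → ℕ
  | .const c => c
  | .read a i => σ (a, i.eval σ)
  | .add e₁ e₂ => e₁.eval σ + e₂.eval σ
  | .sub e₁ e₂ => e₁.eval σ - e₂.eval σ
  | .mul e₁ e₂ => e₁.eval σ * e₂.eval σ
  | .div e₁ e₂ => e₁.eval σ / e₂.eval σ

/-- The cost of evaluating an expression: one plus the bit length of the value, summed over all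
subexpressions. -/
def Expr.cost (σ : Store) : Expr → ℕ
  | .const c => 1 + Nat.size c
  | .read a i => i.cost σ + (1 + Nat.size (σ (a, i.eval σ)))
  | .add e₁ e₂ => e₁.cost σ + e₂.cost σ + (1 + Nat.size (e₁.eval σ + e₂.eval σ))
  | .sub e₁ e₂ => e₁.cost σ + e₂.cost σ + (1 + Nat.size (e₁.eval σ - e₂.eval σ))
  | .mul e₁ e₂ => e₁.cost σ + e₂.cost σ + (1 + Nat.size (e₁.eval σ * e₂.eval σ))
  | .div e₁ e₂ => e₁.cost σ + e₂.cost σ + (1 + Nat.size (e₁.eval σ / e₂.eval σ))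

/-- Programs. `write a i e` stores the value of `e` in cell `i` of array `a`; `flip a` stores the
outcome of a fair coin flip (`0` or `1`) in cell `0` of array `a`; the tests in `cond` and `loop`
(a while loop) succeed when the expression is nonzero. -/
inductive Prog where
  | skip
  | write (a : ℕ) (i e : Expr)
  | flip (a : ℕ)
  | seq (p q : Prog)
  | cond (e : Expr) (p q : Prog)
  | loop (e : Expr) (p : Prog)

/-- `Exec S p σ w t τ`: started in memory `σ`, the program `p` halts in memory `τ` after time `t`,
the outcomes of its coin flips being exactly the bits of `w` in this order, and at every step the
memory in use together with the scratch space for that step is at most `S`. -/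
inductive Exec (S : ℕ) : Prog → Store → List Bool → ℕ → Store → Prop
  | skip (σ : Store) (hS : σ.space + 1 ≤ S) : Exec S .skip σ [] 1 σ
  | write (a : ℕ) (i e : Expr) (σ : Store) (hS : σ.space + (i.cost σ + e.cost σ + 1) ≤ S) :
      Exec S (.write a i e) σ [] (i.cost σ + e.cost σ + 1)
        (σ.update (a, i.eval σ) (e.eval σ))
  | flip (a : ℕ) (b : Bool) (σ : Store) (hS : σ.space + 2 ≤ S) :
      Exec S (.flip a) σ [b] 2 (σ.update (a, 0) b.toNat)
  | seq (p q : Prog) (σ σ' τ : Store) (w w' : List Bool) (t t' : ℕ)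
      (hp : Exec S p σ w t σ') (hq : Exec S q σ' w' t' τ) :
      Exec S (.seq p q) σ (w ++ w') (t + t') τ
  | cond_true (e : Expr) (p q : Prog) (σ τ : Store) (w : List Bool) (t : ℕ)
      (he : e.eval σ ≠ 0) (hS : σ.space + (e.cost σ + 1) ≤ S) (hp : Exec S p σ w t τ) :
      Exec S (.cond e p q) σ w (e.cost σ + 1 + t) τ
  | cond_false (e : Expr) (p q : Prog) (σ τ : Store) (w : List Bool) (t : ℕ)
      (he : e.eval σ = 0) (hS : σ.space + (e.cost σ + 1) ≤ S) (hq : Exec S q σ w t τ) :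
      Exec S (.cond e p q) σ w (e.cost σ + 1 + t) τ
  | loop_done (e : Expr) (p : Prog) (σ : Store)
      (he : e.eval σ = 0) (hS : σ.space + (e.cost σ + 1) ≤ S) :
      Exec S (.loop e p) σ [] (e.cost σ + 1) σ
  | loop_step (e : Expr) (p : Prog) (σ σ' τ : Store) (w w' : List Bool) (t t' : ℕ)
      (he : e.eval σ ≠ 0) (hS : σ.space + (e.cost σ + 1) ≤ S)
      (hp : Exec S p σ w t σ') (hl : Exec S (.loop e p) σ' w' t' τ) :
      Exec S (.loop e p) σ (w ++ w') (e.cost σ + 1 + t + t') τ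

/-- On every infinite sequence of coin flips, `p` started in `σ` halts in time at most `T`,
using space at most `S`. -/
def HaltsWithin (p : Prog) (σ : Store) (T : ℝ) (S : ℕ) : Prop :=
  ∀ ω : ℕ → Bool, ∃ (m t : ℕ) (τ : Store),
    Exec S p σ ((List.range m).map ω) t τ ∧ (t : ℝ) ≤ T

/-- With coin flips `w`, the program halts and answers YES (cell `0` of array `2` holds `1`);
any other final content of this cell is the answer NO. -/
def Accepts (p : Prog) (σ : Store) (w : List Bool) : Prop :=
  ∃ (S t : ℕ) (τ : Store), Exec S p σ w t τ ∧ τ (2, 0) = 1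

/-- The probability that the program answers YES. A halting run with `m` coin flips has
probability `2 ^ (-m)`. -/
def acceptProb (p : Prog) (σ : Store) : ℝ≥0∞ :=
  ∑' w : {w : List Bool // Accepts p σ w}, (2⁻¹ : ℝ≥0∞) ^ w.1.length

open Classical in
/-- The initial memory on input graph `G`: cell `0` of array `0` holds the number `n` of vertices
and array `1` holds the adjacency matrix, row by row. -/
def graphInput {n : ℕ} (G : SimpleGraph (Fin n)) : Store :=
  Finsupp.single (0, 0) n +
    ∑ i : Fin n, ∑ j : Fin n,
      if G.Adj i j then Finsupp.single (1, (i : ℕ) * n + (j : ℕ)) 1 else 0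

end RAM

/-! ### Valued constraint satisfaction and its Sherali–Adams relaxations -/

/-- A term `φ(x₁, …, x_r)` of an objective function: a cost function with values in `ℚ ∪ {∞}`
applied to a tuple of variables. -/
structure CostTerm (X D : Type) where
  arity : ℕ
  scope : Fin arity → X
  cost : (Fin arity → D) → WithTop ℚ

/-- A VCSP instance with variable set `X` and domain `D`: a finite sum of terms. -/
structure VCSP (X D : Type) where
  ι : Type
  fintype_ι : Fintype ι
  term : ι → CostTerm X D

attribute [instance] VCSP.fintype_ι

open Classical in
/-- The inclusion of `ℚ ∪ {∞}` in the extended reals. -/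
def costToEReal (c : WithTop ℚ) : EReal :=
  if c = ⊤ then ⊤ else (((c.untopD 0 : ℚ) : ℝ) : EReal)

namespace CostTerm

variable {X D : Type}

open Classical in
/-- The set of variables that occur in the scope of a term. -/
def vars (T : CostTerm X D) : Finset X := Finset.univ.image T.scope

theorem scope_mem_vars (T : CostTerm X D) (r : Fin T.arity) : T.scope r ∈ T.vars := by
  classical
  exact Finset.mem_image_of_mem _ (Finset.mem_univ r)

/-- The cost that the term gives to an assignment `t` of its variables. -/
def costAt (T : CostTerm X D) (t : {x // x ∈ T.vars} → D) : WithTop ℚ :=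
  T.cost fun r => t ⟨T.scope r, T.scope_mem_vars r⟩

end CostTerm

namespace VCSP

variable {X D : Type}

/-- The cost of an assignment. -/
def cost (I : VCSP X D) (α : X → D) : WithTop ℚ :=
  ∑ i, (I.term i).cost fun r => α ((I.term i).scope r)

/-- The minimum cost of an assignment (`⊤` if there is no feasible one). -/
def opt (I : VCSP X D) : EReal := ⨅ α : X → D, costToEReal (I.cost α)

/-- The instance with all zero terms `φ₀(𝐱)` added, `𝐱` being a tuple of variables of length
between `1` and `l`. -/
def pad [Fintype X] (l : ℕ) (I : VCSP X D) : VCSP X D where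
  ι := I.ι ⊕ (Σ j : Fin l, (Fin ((j : ℕ) + 1) → X))
  fintype_ι := inferInstance
  term := Sum.elim I.term fun x => { arity := (x.1 : ℕ) + 1, scope := x.2, cost := fun _ => 0 }

/-- Values `λ_i(t)` for the variables of the linear program: one for every term `i` and every
assignment `t` of the variables of that term. -/
abbrev LPPoint (J : VCSP X D) : Type :=
  (i : J.ι) → ({x // x ∈ (J.term i).vars} → D) → ℝ

open Classical in
/-- The constraints of the Sherali–Adams program at level `k`, for an instance `J` to which the
zero terms have already been added. -/
structure SAFeasible [Fintype D] (k : ℕ) (J : VCSP X D) (lam : J.LPPoint) : Prop where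
  sum_eq_one : ∀ i, ∑ t, lam i t = 1
  marginal : ∀ (i j : J.ι) (h : (J.term j).vars ⊆ (J.term i).vars),
    (J.term j).vars.card ≤ k → ∀ s : {x // x ∈ (J.term j).vars} → D,
      ∑ t with (fun x : {x // x ∈ (J.term j).vars} => t ⟨x.1, h x.2⟩) = s, lam i t = lam j s
  eq_zero : ∀ i t, (J.term i).costAt t = ⊤ → lam i t = 0
  nonneg : ∀ i t, 0 ≤ lam i t

open Classical in
/-- The objective of the Sherali–Adams program; assignments of infinite cost are left out of the
sum. -/
def saObjective [Fintype D] (J : VCSP X D) (lam : J.LPPoint) : ℝ :=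
  ∑ i, ∑ t, if (J.term i).costAt t = ⊤ then 0
    else lam i t * ((((J.term i).costAt t).untopD 0 : ℚ) : ℝ)

/-- The optimum of the Sherali–Adams program at level `(k, l)` (`⊤` if it is infeasible). -/
def saOpt [Fintype X] [Fintype D] (k l : ℕ) (I : VCSP X D) : EReal :=
  ⨅ (lam : (I.pad l).LPPoint) (_ : SAFeasible k (I.pad l) lam),
    ((saObjective (I.pad l) lam : ℝ) : EReal)

end VCSP

/-- Majority operations. -/
def IsMajority {D : Type} (f : D → D → D → D) : Prop :=
  ∀ a b, f b a a = a ∧ f a b a = a ∧ f a a b = a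

/-- Ternary polymorphisms of a relation of arity `r`. -/
def IsPolymorphism {D : Type} {r : ℕ} (f : D → D → D → D) (R : Set (Fin r → D)) : Prop :=
  ∀ t₁ ∈ R, ∀ t₂ ∈ R, ∀ t₃ ∈ R, (fun i => f (t₁ i) (t₂ i) (t₃ i)) ∈ R

/-! ### Odd cycles -/

namespace OddCycle

/-- The cycle `C_{2k+1}`; the element `i` of `Fin (2 * k + 1)` is the vertex with number `i + 1`
along the cycle. -/
abbrev cycle (k : ℕ) : SimpleGraph (Fin (2 * k + 1)) := SimpleGraph.cycleGraph (2 * k + 1)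

/-- The base of the exponential running time. -/
def alpha (k : ℕ) : ℝ :=
  ((2 * k + 1 : ℝ) / 2) ^ ((1 : ℝ) / (2 * k + 1)) *
    ((2 * k + 1 : ℝ) / (2 * k)) ^ ((2 * k : ℝ) / (2 * k + 1))

/-- The three sets: all vertices other than the vertex number `1`; the vertices with odd number;
the vertices with even number together with the vertex number `1`. -/
def listSet (k : ℕ) : Fin 3 → Set (Fin (2 * k + 1)) :=
  ![{i | 1 < (i : ℕ) + 1},
    {i | Odd ((i : ℕ) + 1)},
    {i | Even ((i : ℕ) + 1) ∨ (i : ℕ) + 1 = 1}]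

/-- The probabilities with which the three sets are drawn. -/
def listProb (k : ℕ) : Fin 3 → ℝ :=
  ![(2 * k - 1 : ℝ) / (2 * k + 1), 1 / (2 * k + 1), 1 / (2 * k + 1)]

/-- The relation of all pairs `(u, v)` with `u ∈ U`, `v ∈ W` and `uv` an edge of the cycle. -/
def edgeRel (k : ℕ) (U W : Set (Fin (2 * k + 1))) : Set (Fin 2 → Fin (2 * k + 1)) :=
  {t | t 0 ∈ U ∧ t 1 ∈ W ∧ (cycle k).Adj (t 0) (t 1)}

open Classical in
/-- The list homomorphism problem with lists `L` as a VCSP instance: one variable for every vertex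
of `G` and, for every edge `uv`, a term with values `0` and `∞` that allows exactly the pairs in
`edgeRel k (L u) (L v)`. -/
def listHomVCSP (k : ℕ) {n : ℕ} (G : SimpleGraph (Fin n))
    (L : Fin n → Set (Fin (2 * k + 1))) : VCSP (Fin n) (Fin (2 * k + 1)) where
  ι := {e : Fin n × Fin n // e.1 < e.2 ∧ G.Adj e.1 e.2}
  fintype_ι := inferInstance
  term e :=
    { arity := 2
      scope := ![e.1.1, e.1.2]
      cost := fun t => if t ∈ edgeRel k (L e.1.1) (L e.1.2) then 0 else ⊤ }

open Classical in
/-- The probability that the Sherali–Adams program at level `(2, 3)` has optimum `0` when the list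
of every vertex of `G` is drawn independently from the three sets, according to `listProb`. -/
def sampleSuccess (k : ℕ) {n : ℕ} (G : SimpleGraph (Fin n)) : ℝ :=
  ∑ c : Fin n → Fin 3,
    if (listHomVCSP k G fun v => listSet k (c v)).saOpt 2 3 = 0
    then ∏ v, listProb k (c v) else 0

end OddCycle

end

/-!
Number the vertices of the cycle `0, …, 2k`. Replacing `x` by `2k + 1 - x` for the arguments of
minority parity, and then taking the median, is a majority operation that preserves the relations
between the three lists. Under a majority operation, a path-consistent system of constraints with
nonempty domains has a solution, as partial solutions extend one variable at a time; and the
supports of the local distributions at level `(2, 3)` are path consistent, so the linear program is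
tight.

A random list contains the vertex `0` with probability `2 / (2k + 1)` and any other vertex with
probability `2k / (2k + 1)`. After a rotation of the cycle, a given homomorphism takes the value
`0` at most `n / (2k + 1)` times, and then all its values lie in the lists with probability at least
`α_k ^ (-n)`. The algorithm draws lists `O(α_k ^ n)` times and tests path consistency each time.
The draws reduce a random number of `O(n)` bits modulo `2k + 1`, whose bias costs only a constant
factor over a whole trial; and `α_k ^ n` is replaced by an integer power of `α_k ^ (2k + 1)`, which
is rational.
-/

noncomputable section

/-! ### Path consistency and majority operations -/

/-- A system of binary relations between the values of the variables in `V` is path consistent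
(strongly, including the diagonal) if every allowed pair of values of two variables extends to
every third variable. -/
structure PathConsistent {V D : Type*} (R : V → V → D → D → Prop) : Prop where
  diag : ∀ u a b, R u u a b → a = b
  extend : ∀ u v a b, R u v a b → ∀ w, ∃ c, R u w a c ∧ R v w b c

/-- The ternary operation `f`, applied componentwise, preserves the binary relation `r`; this is
`IsPolymorphism` for relations in curried form. -/
def Preserves {D : Type*} (f : D → D → D → D) (r : D → D → Prop) : Prop :=
  ∀ ⦃a₁ a₂ a₃ b₁ b₂ b₃⦄, r a₁ b₁ → r a₂ b₂ → r a₃ b₃ → r (f a₁ a₂ a₃) (f b₁ b₂ b₃)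

/-- The smallest relation that contains `r` and is preserved by `f`. -/
inductive TernaryClosure {D : Type*} (f : D → D → D → D) (r : D → D → Prop) : D → D → Prop
  | base {a b : D} (h : r a b) : TernaryClosure f r a b
  | op {a₁ a₂ a₃ b₁ b₂ b₃ : D} (h₁ : TernaryClosure f r a₁ b₁) (h₂ : TernaryClosure f r a₂ b₂)
      (h₃ : TernaryClosure f r a₃ b₃) : TernaryClosure f r (f a₁ a₂ a₃) (f b₁ b₂ b₃)

theorem preserves_ternaryClosure {D : Type*} (f : D → D → D → D) (r : D → D → Prop) :
    Preserves f (TernaryClosure f r) := fun _ _ _ _ _ _ => .op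

theorem TernaryClosure.of_preserves {D : Type*} {f : D → D → D → D} {r s : D → D → Prop}
    (hs : Preserves f s) (hrs : ∀ a b, r a b → s a b) {a b : D} (h : TernaryClosure f r a b) :
    s a b := by
  induction h with
  | base h => exact hrs _ _ h
  | op _ _ _ h₁ h₂ h₃ => exact hs h₁ h₂ h₃

theorem exists_subset_pair_of_card_le_two {V : Type*} [DecidableEq V] {T : Finset V}
    (hT : T.Nonempty) (h2 : T.card ≤ 2) : ∃ u ∈ T, ∃ v ∈ T, T ⊆ {u, v} := by
  obtain h1 | h2 : T.card = 1 ∨ T.card = 2 := by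
    have := hT.card_pos
    omega
  · obtain ⟨u, rfl⟩ := Finset.card_eq_one.1 h1
    exact ⟨u, by simp, u, by simp, by simp⟩
  · obtain ⟨u, v, -, rfl⟩ := Finset.card_eq_two.1 h2
    exact ⟨u, by simp, v, by simp, subset_rfl⟩

namespace PathConsistent

section

variable {V D : Type*} {R : V → V → D → D → Prop}

theorem symm (hR : PathConsistent R) {u v : V} {a b : D} (h : R u v a b) : R v u b a := by
  obtain ⟨c, h₁, h₂⟩ := hR.extend u v a b h u
  obtain rfl := hR.diag _ _ _ h₁
  exact h₂

theorem self_right (hR : PathConsistent R) {u v : V} {a b : D} (h : R u v a b) : R v v b b := by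
  obtain ⟨c, -, h₂⟩ := hR.extend u v a b h v
  obtain rfl := hR.diag _ _ _ h₂
  exact h₂

theorem exists_left (hR : PathConsistent R) {w : V} {c : D} (h : R w w c c) (u : V) :
    ∃ a, R u w a c :=
  let ⟨a, ha, _⟩ := hR.extend w w c c h u
  ⟨a, hR.symm ha⟩

theorem ternaryClosure (hR : PathConsistent R) (f : D → D → D → D) :
    PathConsistent fun u v => TernaryClosure f (R u v) where
  diag u a b h := by
    induction h with
    | base h => exact hR.diag _ _ _ h
    | op _ _ _ e₁ e₂ e₃ => rw [e₁, e₂, e₃]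
  extend u v a b h w := by
    induction h with
    | base h =>
      obtain ⟨c, h₁, h₂⟩ := hR.extend _ _ _ _ h w
      exact ⟨c, .base h₁, .base h₂⟩
    | op _ _ _ e₁ e₂ e₃ =>
      obtain ⟨c₁, h₁, h₁'⟩ := e₁
      obtain ⟨c₂, h₂, h₂'⟩ := e₂
      obtain ⟨c₃, h₃, h₃'⟩ := e₃
      exact ⟨f c₁ c₂ c₃, .op h₁ h₂ h₃, .op h₁' h₂' h₃'⟩

theorem exists_extension_of_card_le_two (hR : PathConsistent R) {w : V} (hw : ∃ c, R w w c c)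
    {T : Finset V} (h2 : T.card ≤ 2) {g : V → D} (hg : ∀ u ∈ T, ∀ v ∈ T, R u v (g u) (g v)) :
    ∃ c, R w w c c ∧ ∀ u ∈ T, R u w (g u) c := by
  classical
  rcases T.eq_empty_or_nonempty with rfl | hT
  · simpa using hw
  · obtain ⟨u, hu, v, hv, hT⟩ := exists_subset_pair_of_card_le_two hT h2
    obtain ⟨c, h₁, h₂⟩ := hR.extend u v _ _ (hg u hu v hv) w
    refine ⟨c, hR.self_right h₁, fun x hx => ?_⟩
    obtain rfl | rfl : x = u ∨ x = v := by simpa using hT hx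
    exacts [h₁, h₂]

end

variable {V : Type*} {D : Type} {R : V → V → D → D → Prop} {f : D → D → D → D}

theorem rel_majority (hR : PathConsistent R) (hf : IsMajority f)
    (hRf : ∀ u v, Preserves f (R u v)) {u w : V} {a c₁ c₂ c₃ : D} (h₁ : R w w c₁ c₁)
    (h₂ : R w w c₂ c₂) (h₃ : R w w c₃ c₃)
    (h : (R u w a c₂ ∧ R u w a c₃) ∨ (R u w a c₁ ∧ R u w a c₃) ∨ (R u w a c₁ ∧ R u w a c₂)) :
    R u w a (f c₁ c₂ c₃) := by
  rcases h with ⟨e₂, e₃⟩ | ⟨e₁, e₃⟩ | ⟨e₁, e₂⟩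
  · obtain ⟨b, hb⟩ := hR.exists_left h₁ u
    simpa only [(hf a b).1] using hRf u w hb e₂ e₃
  · obtain ⟨b, hb⟩ := hR.exists_left h₂ u
    simpa only [(hf a b).2.1] using hRf u w e₁ hb e₃
  · obtain ⟨b, hb⟩ := hR.exists_left h₃ u
    simpa only [(hf a b).2.2] using hRf u w e₁ e₂ hb

/-- With at least three variables assigned, extensions of the assignments that forget one of three
of them combine under the majority operation. -/
theorem exists_extension (hR : PathConsistent R) (hf : IsMajority f)
    (hRf : ∀ u v, Preserves f (R u v)) {w : V} (hw : ∃ c, R w w c c) (T : Finset V) {g : V → D}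
    (hg : ∀ u ∈ T, ∀ v ∈ T, R u v (g u) (g v)) :
    ∃ c, R w w c c ∧ ∀ u ∈ T, R u w (g u) c := by
  classical
  induction T using Finset.strongInduction with
  | H T ih =>
    obtain h2 | h2 := le_or_gt T.card 2
    · exact hR.exists_extension_of_card_le_two hw h2 hg
    obtain ⟨x, y, z, hx, hy, hz, hxy, hxz, hyz⟩ := Finset.two_lt_card_iff.1 h2
    have forget : ∀ s ∈ T, ∃ c, R w w c c ∧ ∀ u ∈ T, u ≠ s → R u w (g u) c := by
      intro s hs
      obtain ⟨c, hc, hc'⟩ := ih (T.erase s) (Finset.erase_ssubset hs) fun u hu v hv =>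
        hg u (Finset.mem_of_mem_erase hu) v (Finset.mem_of_mem_erase hv)
      exact ⟨c, hc, fun u hu hus => hc' u (Finset.mem_erase.2 ⟨hus, hu⟩)⟩
    obtain ⟨c₁, h₁, h₁'⟩ := forget x hx
    obtain ⟨c₂, h₂, h₂'⟩ := forget y hy
    obtain ⟨c₃, h₃, h₃'⟩ := forget z hz
    refine ⟨f c₁ c₂ c₃, hRf w w h₁ h₂ h₃, fun u hu => hR.rel_majority hf hRf h₁ h₂ h₃ ?_⟩
    by_cases hux : u = x
    · exact .inl ⟨h₂' u hu (hux ▸ hxy), h₃' u hu (hux ▸ hxz)⟩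
    by_cases huy : u = y
    · exact .inr (.inl ⟨h₁' u hu hux, h₃' u hu (huy ▸ hyz)⟩)
    · exact .inr (.inr ⟨h₁' u hu hux, h₂' u hu huy⟩)

theorem exists_partial_solution (hR : PathConsistent R) (hne : ∀ v, ∃ a, R v v a a)
    (hf : IsMajority f) (hRf : ∀ u v, Preserves f (R u v)) (T : Finset V) :
    ∃ g : V → D, ∀ u ∈ T, ∀ v ∈ T, R u v (g u) (g v) := by
  classical
  induction T using Finset.induction_on with
  | empty => exact ⟨fun v => (hne v).choose, by simp⟩
  | insert w T hw ih =>
    obtain ⟨g, hg⟩ := ih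
    obtain ⟨c, hc, hc'⟩ := hR.exists_extension hf hRf (hne w) T hg
    have hgT : ∀ u ∈ T, Function.update g w c u = g u := fun u hu =>
      Function.update_of_ne (ne_of_mem_of_not_mem hu hw) _ _
    refine ⟨Function.update g w c, fun u hu v hv => ?_⟩
    rcases Finset.mem_insert.1 hu with rfl | hu' <;> rcases Finset.mem_insert.1 hv with rfl | hv'
    · simpa only [Function.update_self] using hc
    · rw [hgT v hv', Function.update_self]
      exact hR.symm (hc' v hv')
    · rw [hgT u hu', Function.update_self]
      exact hc' u hu'
    · rw [hgT u hu', hgT v hv']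
      exact hg u hu' v hv'

/-- The closure of the path-consistent refinement `R` under `f` is path consistent and still refines
`C`. -/
theorem exists_solution [Finite V] (hR : PathConsistent R) (hne : ∀ v, ∃ a, R v v a a)
    (hf : IsMajority f) {C : V → V → D → D → Prop} (hRC : ∀ u v a b, R u v a b → C u v a b)
    (hC : ∀ u v, Preserves f (C u v)) : ∃ g : V → D, ∀ u v, C u v (g u) (g v) := by
  have := Fintype.ofFinite V
  obtain ⟨g, hg⟩ := (hR.ternaryClosure f).exists_partial_solution
    (fun v => (hne v).imp fun _ => .base) hf (fun _ _ => preserves_ternaryClosure f _) Finset.univ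
  exact ⟨g, fun u v => (hg u (Finset.mem_univ u) v (Finset.mem_univ v)).of_preserves (hC u v)
    (hRC u v)⟩

end PathConsistent

/-! ### Median and reflected majority -/

section Median

variable {α : Type*} [LinearOrder α]

/-- The median of three elements of a linear order. -/
def median (x y z : α) : α := max (min x y) (min (max x y) z)

theorem median_mem (x y z : α) : median x y z = x ∨ median x y z = y ∨ median x y z = z := by
  grind [median]

theorem median_left (x y : α) : median y x x = x := by grind [median]

theorem median_mid (x y : α) : median x y x = x := by grind [median]

theorem median_right (x y : α) : median x x y = x := by grind [median]

theorem median_mono {x y z x' y' z' : α} (hx : x ≤ x') (hy : y ≤ y') (hz : z ≤ z') :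
    median x y z ≤ median x' y' z' := by
  unfold median
  gcongr

theorem map_median {β : Type*} [LinearOrder β] {g : α → β} (hg : Monotone g) (x y z : α) :
    g (median x y z) = median (g x) (g y) (g z) := by
  simp only [median, hg.map_max, hg.map_min]

end Median

theorem IsMajority.eq_of_two {D : Type} {f : D → D → D → D} (hf : IsMajority f) {x y z a : D}
    (h : (x = a ∧ y = a) ∨ (x = a ∧ z = a) ∨ (y = a ∧ z = a)) : f x y z = a := by
  rcases h with ⟨rfl, rfl⟩ | ⟨rfl, rfl⟩ | ⟨rfl, rfl⟩
  exacts [(hf _ _).2.2, (hf _ _).2.1, (hf _ _).1]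

namespace OddCycle

variable {k : ℕ}

/-- Adjacency of the vertices of `cycle k`, in terms of their values `0, …, 2 * k`. -/
def NatAdj (k x y : ℕ) : Prop :=
  x + 1 = y ∨ y + 1 = x ∨ (x = 0 ∧ y = 2 * k) ∨ (x = 2 * k ∧ y = 0)

theorem NatAdj.symm {x y : ℕ} (h : NatAdj k x y) : NatAdj k y x := by
  unfold NatAdj at *
  omega

theorem val_sub_eq_one_iff (hk : 1 ≤ k) (a b : Fin (2 * k + 1)) :
    (a - b).val = 1 ↔ (b : ℕ) + 1 = a ∨ ((b : ℕ) = 2 * k ∧ (a : ℕ) = 0) := by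
  have ha := a.2
  have hb := b.2
  rw [Fin.val_sub]
  rcases le_or_gt (b : ℕ) a with h | h
  · rw [show 2 * k + 1 - (b : ℕ) + a = (a - b) + (2 * k + 1) by omega, Nat.add_mod_right,
      Nat.mod_eq_of_lt (by omega)]
    omega
  · rw [Nat.mod_eq_of_lt (by omega)]
    omega

theorem cycle_adj_iff (hk : 1 ≤ k) (a b : Fin (2 * k + 1)) :
    (cycle k).Adj a b ↔ NatAdj k a b := by
  rw [SimpleGraph.cycleGraph_adj', val_sub_eq_one_iff hk, val_sub_eq_one_iff hk, NatAdj]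
  omega

/-- Membership in `listSet`, in terms of the values `0, …, 2 * k`. -/
def NatList : Fin 3 → ℕ → Prop :=
  ![fun x => x ≠ 0, fun x => x % 2 = 0, fun x => x % 2 = 1 ∨ x = 0]

theorem mem_listSet_iff (c : Fin 3) (a : Fin (2 * k + 1)) : a ∈ listSet k c ↔ NatList c a := by
  fin_cases c
  · change 1 < (a : ℕ) + 1 ↔ (a : ℕ) ≠ 0
    omega
  · change Odd ((a : ℕ) + 1) ↔ (a : ℕ) % 2 = 0
    rw [Nat.odd_iff]
    omega
  · change (Even ((a : ℕ) + 1) ∨ (a : ℕ) + 1 = 1) ↔ ((a : ℕ) % 2 = 1 ∨ (a : ℕ) = 0)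
    rw [Nat.even_iff]
    omega

/-- The majority parity of three numbers. -/
def majParity (x y z : ℕ) : ℕ := (x % 2 + y % 2 + z % 2) / 2

/-- The number `x` if it has parity `p`, and its mirror image otherwise. -/
def reflect (k p x : ℕ) : ℕ := if x % 2 = p then x else 2 * k + 1 - x

/-- The majority operation of the odd cycle: numbers of minority parity are reflected, and then the
median is taken. -/
def majNat (k x y z : ℕ) : ℕ :=
  median (reflect k (majParity x y z) x) (reflect k (majParity x y z) y)
    (reflect k (majParity x y z) z)

section Reflect

variable {p q x y z : ℕ}

theorem reflect_mod_self (k x : ℕ) : reflect k (x % 2) x = x := if_pos rfl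

theorem reflect_mod (hp : p < 2) (hx : x ≤ 2 * k) : reflect k p x % 2 = p := by
  unfold reflect
  split_ifs <;> omega

theorem reflect_ne_zero (hx0 : x ≠ 0) (hx : x ≤ 2 * k) : reflect k p x ≠ 0 := by
  unfold reflect
  split_ifs <;> omega

/-- A path edge changes the parity, so that either both ends are reflected or none is; of the edge
between `0` and `2 * k`, exactly one end is. -/
theorem reflect_le_reflect_add_one (hpq : p + q = 1) (hx : x ≤ 2 * k) (hy : y ≤ 2 * k)
    (h : NatAdj k x y) : reflect k p x ≤ reflect k q y + 1 := by
  unfold NatAdj at h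
  unfold reflect
  split_ifs <;> omega

theorem majNat_mem (k x y z : ℕ) : ∃ w, (w = x ∨ w = y ∨ w = z) ∧
    majNat k x y z = reflect k (majParity x y z) w := by
  rcases median_mem (reflect k (majParity x y z) x) (reflect k (majParity x y z) y)
    (reflect k (majParity x y z) z) with h | h | h
  exacts [⟨x, by simp, h⟩, ⟨y, by simp, h⟩, ⟨z, by simp, h⟩]

theorem majParity_lt_two (x y z : ℕ) : majParity x y z < 2 := by
  unfold majParity
  omega

theorem majNat_mod (hx : x ≤ 2 * k) (hy : y ≤ 2 * k) (hz : z ≤ 2 * k) :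
    majNat k x y z % 2 = majParity x y z := by
  obtain ⟨w, hw, h⟩ := majNat_mem k x y z
  exact h ▸ reflect_mod (majParity_lt_two x y z) (by omega)

theorem majNat_ne_zero (hx : x ≤ 2 * k) (hy : y ≤ 2 * k) (hz : z ≤ 2 * k) (hx0 : x ≠ 0)
    (hy0 : y ≠ 0) (hz0 : z ≠ 0) : majNat k x y z ≠ 0 := by
  obtain ⟨w, hw, h⟩ := majNat_mem k x y z
  exact h ▸ reflect_ne_zero (by omega) (by omega)

/-- The mirror image `2 * k + 1` of `0` lies beyond the cycle, but the two numbers of majority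
parity do not, and the median is at most their maximum. -/
theorem majNat_lt (hx : x ≤ 2 * k) (hy : y ≤ 2 * k) (hz : z ≤ 2 * k) :
    majNat k x y z < 2 * k + 1 := by
  unfold majNat median reflect majParity
  split_ifs <;> omega

end Reflect

theorem isMajority_majNat (k : ℕ) : IsMajority (majNat k) := by
  intro x y
  have h₁ : majParity y x x = x % 2 := by unfold majParity; omega
  have h₂ : majParity x y x = x % 2 := by unfold majParity; omega
  have h₃ : majParity x x y = x % 2 := by unfold majParity; omega
  simp only [majNat, h₁, h₂, h₃, reflect_mod_self, median_left, median_mid, median_right, and_self]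

/-- An edge of the cycle with ends in the lists `c` and `c'`, in terms of the values
`0, …, 2 * k` of its ends. -/
structure NatEdge (k : ℕ) (c c' : Fin 3) (x y : ℕ) : Prop where
  left_le : x ≤ 2 * k
  right_le : y ≤ 2 * k
  left_mem : NatList c x
  right_mem : NatList c' y
  adj : NatAdj k x y

section NatEdge

variable {c c' : Fin 3} {x₁ x₂ x₃ y₁ y₂ y₃ : ℕ}

theorem NatEdge.symm {x y : ℕ} (h : NatEdge k c c' x y) : NatEdge k c' c y x :=
  ⟨h.right_le, h.left_le, h.right_mem, h.left_mem, h.adj.symm⟩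

theorem NatEdge.majNat_le_succ (h₁ : NatEdge k c c' x₁ y₁) (h₂ : NatEdge k c c' x₂ y₂)
    (h₃ : NatEdge k c c' x₃ y₃) (h : majParity x₁ x₂ x₃ + majParity y₁ y₂ y₃ = 1) :
    majNat k x₁ x₂ x₃ ≤ majNat k y₁ y₂ y₃ + 1 := by
  unfold majNat
  rw [map_median (g := (· + 1)) fun _ _ => Nat.succ_le_succ]
  exact median_mono (reflect_le_reflect_add_one h h₁.left_le h₁.right_le h₁.adj)
    (reflect_le_reflect_add_one h h₂.left_le h₂.right_le h₂.adj)
    (reflect_le_reflect_add_one h h₃.left_le h₃.right_le h₃.adj)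

theorem NatEdge.majNat_of_majParity (h₁ : NatEdge k c c' x₁ y₁) (h₂ : NatEdge k c c' x₂ y₂)
    (h₃ : NatEdge k c c' x₃ y₃) (h : majParity x₁ x₂ x₃ + majParity y₁ y₂ y₃ = 1) :
    NatAdj k (majNat k x₁ x₂ x₃) (majNat k y₁ y₂ y₃) := by
  have hle := h₁.majNat_le_succ h₂ h₃ h
  have hge := h₁.symm.majNat_le_succ h₂.symm h₃.symm (by omega)
  have hx := majNat_mod h₁.left_le h₂.left_le h₃.left_le
  have hy := majNat_mod h₁.right_le h₂.right_le h₃.right_le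
  unfold NatAdj
  omega

theorem NatEdge.majNat_of_two_eq (h₁ : NatEdge k c c' x₁ y₁) (h₂ : NatEdge k c c' x₂ y₂)
    (h : (x₁ = x₂ ∧ y₁ = y₂) ∨ (x₁ = x₃ ∧ y₁ = y₃) ∨ (x₂ = x₃ ∧ y₂ = y₃)) :
    NatAdj k (majNat k x₁ x₂ x₃) (majNat k y₁ y₂ y₃) := by
  have hm := isMajority_majNat k
  rcases h with ⟨rfl, rfl⟩ | ⟨rfl, rfl⟩ | ⟨rfl, rfl⟩
  · rw [(hm _ _).2.2, (hm _ _).2.2]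
    exact h₁.adj
  · rw [(hm _ _).2.1, (hm _ _).2.1]
    exact h₁.adj
  · rw [(hm _ _).1, (hm _ _).1]
    exact h₂.adj

/-- If at most one of the edges is exceptional, it is outvoted; otherwise two of them coincide. -/
theorem NatEdge.majNat_of_parity_or_eq (h₁ : NatEdge k c c' x₁ y₁) (h₂ : NatEdge k c c' x₂ y₂)
    (h₃ : NatEdge k c c' x₃ y₃) {p a b : ℕ} (hp : p ≤ 1)
    (h : ∀ x y, NatEdge k c c' x y → (x % 2 = p ∧ y % 2 = 1 - p) ∨ (x = a ∧ y = b)) :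
    NatAdj k (majNat k x₁ x₂ x₃) (majNat k y₁ y₂ y₃) := by
  by_cases heq : (x₁ = x₂ ∧ y₁ = y₂) ∨ (x₁ = x₃ ∧ y₁ = y₃) ∨ (x₂ = x₃ ∧ y₂ = y₃)
  · exact h₁.majNat_of_two_eq h₂ heq
  · have hp : majParity x₁ x₂ x₃ = p ∧ majParity y₁ y₂ y₃ = 1 - p := by
      unfold majParity
      rcases h _ _ h₁ with e₁ | e₁ <;> rcases h _ _ h₂ with e₂ | e₂ <;>
        rcases h _ _ h₃ with e₃ | e₃ <;> omega
    exact h₁.majNat_of_majParity h₂ h₃ (by omega)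

theorem NatEdge.majNat_zero_zero (h₁ : NatEdge k 0 0 x₁ y₁) (h₂ : NatEdge k 0 0 x₂ y₂)
    (h₃ : NatEdge k 0 0 x₃ y₃) : NatAdj k (majNat k x₁ x₂ x₃) (majNat k y₁ y₂ y₃) := by
  have parity : ∀ {x y}, NatEdge k 0 0 x y → x % 2 + y % 2 = 1 := by
    rintro x y ⟨_, _, _, _, _⟩
    simp only [NatList, NatAdj, Matrix.cons_val] at *
    omega
  have e₁ := parity h₁
  have e₂ := parity h₂
  have e₃ := parity h₃
  exact h₁.majNat_of_majParity h₂ h₃ (by unfold majParity; omega)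

theorem NatEdge.majNat_one_zero (h₁ : NatEdge k 1 0 x₁ y₁) (h₂ : NatEdge k 1 0 x₂ y₂)
    (h₃ : NatEdge k 1 0 x₃ y₃) : NatAdj k (majNat k x₁ x₂ x₃) (majNat k y₁ y₂ y₃) := by
  refine h₁.majNat_of_parity_or_eq h₂ h₃ (p := 0) (a := 0) (b := 2 * k) (by omega) ?_
  rintro x y ⟨_, _, _, _, _⟩
  simp only [NatList, NatAdj, Matrix.cons_val] at *
  omega

theorem NatEdge.majNat_one_two (h₁ : NatEdge k 1 2 x₁ y₁) (h₂ : NatEdge k 1 2 x₂ y₂)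
    (h₃ : NatEdge k 1 2 x₃ y₃) : NatAdj k (majNat k x₁ x₂ x₃) (majNat k y₁ y₂ y₃) := by
  refine h₁.majNat_of_parity_or_eq h₂ h₃ (p := 0) (a := 2 * k) (b := 0) (by omega) ?_
  rintro x y ⟨_, _, _, _, _⟩
  simp only [NatList, NatAdj, Matrix.cons_val] at *
  omega

theorem NatEdge.majNat_two_two (hk : 1 ≤ k) (h₁ : NatEdge k 2 2 x₁ y₁)
    (h₂ : NatEdge k 2 2 x₂ y₂) (h₃ : NatEdge k 2 2 x₃ y₃) :
    NatAdj k (majNat k x₁ x₂ x₃) (majNat k y₁ y₂ y₃) := by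
  refine h₁.majNat_of_parity_or_eq h₂ h₃ (p := 1) (a := 0) (b := 1) (by omega) ?_
  rintro x y ⟨_, _, _, _, _⟩
  simp only [NatList, NatAdj, Matrix.cons_val] at *
  omega

theorem NatEdge.majNat_one_one (h₁ : NatEdge k 1 1 x₁ y₁) (h₂ : NatEdge k 1 1 x₂ y₂)
    (h₃ : NatEdge k 1 1 x₃ y₃) : NatAdj k (majNat k x₁ x₂ x₃) (majNat k y₁ y₂ y₃) := by
  have wrap : ∀ {x y}, NatEdge k 1 1 x y → (x = 0 ∧ y = 2 * k) ∨ (x = 2 * k ∧ y = 0) := by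
    rintro x y ⟨_, _, _, _, _⟩
    simp only [NatList, NatAdj, Matrix.cons_val] at *
    omega
  have two_eq : (x₁ = x₂ ∧ y₁ = y₂) ∨ (x₁ = x₃ ∧ y₁ = y₃) ∨ (x₂ = x₃ ∧ y₂ = y₃) := by
    rcases wrap h₁ with e₁ | e₁ <;> rcases wrap h₂ with e₂ | e₂ <;>
      rcases wrap h₃ with e₃ | e₃ <;> omega
  exact h₁.majNat_of_two_eq h₂ two_eq

/-- Two of the numbers are `1` and `2 * k`, hence reflected to `2 * k` when the parity is even, and
nothing else exceeds `2 * k`. -/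
theorem majNat_eq_two_mul_of_one_mem (b₁ : y₁ ≤ 2 * k) (b₂ : y₂ ≤ 2 * k) (b₃ : y₃ ≤ 2 * k)
    (hp : majParity y₁ y₂ y₃ = 0)
    (h : ({1, 2 * k} : Finset ℕ) ⊆ {y₁, y₂, y₃}) : majNat k y₁ y₂ y₃ = 2 * k := by
  have h1 := h (show 1 ∈ _ by simp)
  have h2 := h (show 2 * k ∈ _ by simp)
  simp only [Finset.mem_insert, Finset.mem_singleton] at h1 h2
  unfold majNat median reflect
  rw [hp]
  split_ifs <;> omega

/-- The vertex `0` is adjacent to both `1` and `2 * k`, so two of the edges may leave it without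
coinciding. -/
theorem NatEdge.majNat_two_zero (h₁ : NatEdge k 2 0 x₁ y₁) (h₂ : NatEdge k 2 0 x₂ y₂)
    (h₃ : NatEdge k 2 0 x₃ y₃) : NatAdj k (majNat k x₁ x₂ x₃) (majNat k y₁ y₂ y₃) := by
  have edge : ∀ {x y}, NatEdge k 2 0 x y →
      (x = 0 ∧ (y = 1 ∨ y = 2 * k)) ∨ (x % 2 = 1 ∧ y % 2 = 0) := by
    rintro x y ⟨_, _, _, _, _⟩
    simp only [NatList, NatAdj, Matrix.cons_val] at *
    omega
  by_cases h : (x₁ = x₂ ∧ y₁ = y₂) ∨ (x₁ = x₃ ∧ y₁ = y₃) ∨ (x₂ = x₃ ∧ y₂ = y₃)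
  · exact h₁.majNat_of_two_eq h₂ h
  by_cases hx : (x₁ = 0 ∧ x₂ = 0) ∨ (x₁ = 0 ∧ x₃ = 0) ∨ (x₂ = 0 ∧ x₃ = 0)
  · have hy : majParity y₁ y₂ y₃ = 0 ∧ (1 = y₁ ∨ 1 = y₂ ∨ 1 = y₃) ∧
        (2 * k = y₁ ∨ 2 * k = y₂ ∨ 2 * k = y₃) := by
      unfold majParity
      rcases edge h₁ with e₁ | e₁ <;> rcases edge h₂ with e₂ | e₂ <;>
        rcases edge h₃ with e₃ | e₃ <;> omega
    rw [(isMajority_majNat k).eq_of_two hx, majNat_eq_two_mul_of_one_mem h₁.right_le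
      h₂.right_le h₃.right_le hy.1 (by simpa [Finset.insert_subset_iff] using hy.2)]
    exact .inr (.inr (.inl ⟨rfl, rfl⟩))
  · have hp : majParity x₁ x₂ x₃ = 1 ∧ majParity y₁ y₂ y₃ = 0 := by
      unfold majParity
      rcases edge h₁ with e₁ | e₁ <;> rcases edge h₂ with e₂ | e₂ <;>
        rcases edge h₃ with e₃ | e₃ <;> omega
    exact h₁.majNat_of_majParity h₂ h₃ (by omega)

theorem NatEdge.majNat (hk : 1 ≤ k) (h₁ : NatEdge k c c' x₁ y₁)
    (h₂ : NatEdge k c c' x₂ y₂) (h₃ : NatEdge k c c' x₃ y₃) :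
    NatAdj k (majNat k x₁ x₂ x₃) (majNat k y₁ y₂ y₃) := by
  fin_cases c <;> fin_cases c'
  · exact h₁.majNat_zero_zero h₂ h₃
  · exact (h₁.symm.majNat_one_zero h₂.symm h₃.symm).symm
  · exact (h₁.symm.majNat_two_zero h₂.symm h₃.symm).symm
  · exact h₁.majNat_one_zero h₂ h₃
  · exact h₁.majNat_one_one h₂ h₃
  · exact h₁.majNat_one_two h₂ h₃
  · exact h₁.majNat_two_zero h₂ h₃
  · exact (h₁.symm.majNat_one_two h₂.symm h₃.symm).symm
  · exact h₁.majNat_two_two hk h₂ h₃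

end NatEdge

theorem natList_majNat {x y z : ℕ} {c : Fin 3} (hx : x ≤ 2 * k) (hy : y ≤ 2 * k)
    (hz : z ≤ 2 * k) (h₁ : NatList c x) (h₂ : NatList c y) (h₃ : NatList c z) :
    NatList c (majNat k x y z) := by
  have hmod := majNat_mod hx hy hz
  fin_cases c <;> simp only [NatList, Fin.mk_one, Fin.zero_eta, Fin.reduceFinMk,
    Matrix.cons_val] at *
  · exact majNat_ne_zero hx hy hz h₁ h₂ h₃
  · rw [hmod]
    unfold majParity
    omega
  · by_cases h : (x = 0 ∧ y = 0) ∨ (x = 0 ∧ z = 0) ∨ (y = 0 ∧ z = 0)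
    · exact .inr ((isMajority_majNat k).eq_of_two h)
    · refine .inl (hmod.trans ?_)
      unfold majParity
      omega

/-- The majority operation of part (b), on the vertices of the cycle. -/
def majority (k : ℕ) (x y z : Fin (2 * k + 1)) : Fin (2 * k + 1) :=
  ⟨majNat k x y z, majNat_lt x.is_le y.is_le z.is_le⟩

theorem isMajority_majority (k : ℕ) : IsMajority (majority k) := fun a b =>
  ⟨Fin.ext (isMajority_majNat k a b).1, Fin.ext (isMajority_majNat k a b).2.1,
    Fin.ext (isMajority_majNat k a b).2.2⟩

theorem majority_mem_listSet {c : Fin 3} {x y z : Fin (2 * k + 1)} (hx : x ∈ listSet k c)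
    (hy : y ∈ listSet k c) (hz : z ∈ listSet k c) : majority k x y z ∈ listSet k c := by
  rw [mem_listSet_iff] at *
  exact natList_majNat x.is_le y.is_le z.is_le hx hy hz

theorem natEdge_of_mem_edgeRel (hk : 1 ≤ k) {a b : Fin 3} {t : Fin 2 → Fin (2 * k + 1)}
    (ht : t ∈ edgeRel k (listSet k a) (listSet k b)) : NatEdge k a b (t 0) (t 1) :=
  ⟨(t 0).is_le, (t 1).is_le, (mem_listSet_iff _ _).1 ht.1, (mem_listSet_iff _ _).1 ht.2.1,
    (cycle_adj_iff hk _ _).1 ht.2.2⟩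

theorem isPolymorphism_majority (hk : 1 ≤ k) (a b : Fin 3) :
    IsPolymorphism (majority k) (edgeRel k (listSet k a) (listSet k b)) :=
  fun _ h₁ _ h₂ _ h₃ =>
    ⟨majority_mem_listSet h₁.1 h₂.1 h₃.1, majority_mem_listSet h₁.2.1 h₂.2.1 h₃.2.1,
      (cycle_adj_iff hk _ _).2 ((natEdge_of_mem_edgeRel hk h₁).majNat hk
        (natEdge_of_mem_edgeRel hk h₂) (natEdge_of_mem_edgeRel hk h₃))⟩

end OddCycle

/-! ### Tightness of the linear program -/

namespace VCSP

variable {X D : Type}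

/-- A valued instance that encodes a constraint satisfaction problem: all costs are `0` or `∞`. -/
def IsCrisp (I : VCSP X D) : Prop := ∀ i t, (I.term i).cost t = 0 ∨ (I.term i).cost t = ⊤

/-- Instances in which every term depends on at most two variables. -/
def IsBinary (I : VCSP X D) : Prop :=
  ∀ i, ∃ u v, ∀ r, (I.term i).scope r = u ∨ (I.term i).scope r = v

/-- The assignment `α` satisfies all the constraints of `I`: no term has infinite cost. -/
def Satisfies (I : VCSP X D) (α : X → D) : Prop :=
  ∀ i, (I.term i).cost (fun r => α ((I.term i).scope r)) ≠ ⊤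

open Classical in
/-- The linear programming point of an assignment. -/
def pointOf (J : VCSP X D) (α : X → D) : J.LPPoint :=
  fun _ t => if t = (fun x => α x.1) then 1 else 0

theorem Satisfies.saFeasible_pointOf [Fintype D] {J : VCSP X D} {α : X → D}
    (hα : J.Satisfies α) (k : ℕ) : SAFeasible k J (J.pointOf α) where
  sum_eq_one i := by simp [pointOf]
  marginal i j h _ s := by
    classical
    simp only [pointOf, Finset.sum_ite_eq', Finset.mem_filter, Finset.mem_univ, true_and]
    exact if_congr eq_comm rfl rfl
  eq_zero i t ht := by
    refine if_neg ?_
    rintro rfl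
    exact hα i ht
  nonneg i t := by
    unfold pointOf
    split_ifs <;> norm_num

theorem IsCrisp.pad [Fintype X] {I : VCSP X D} (hI : I.IsCrisp) (l : ℕ) : (I.pad l).IsCrisp
  | .inl i => hI i
  | .inr _ => fun _ => .inl rfl

theorem Satisfies.pad [Fintype X] {I : VCSP X D} {α : X → D} (hα : I.Satisfies α) (l : ℕ) :
    (I.pad l).Satisfies α
  | .inl i => hα i
  | .inr _ => WithTop.zero_ne_top

theorem mem_vars_iff {T : CostTerm X D} {x : X} : x ∈ T.vars ↔ ∃ r, T.scope r = x := by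
  classical
  simp [CostTerm.vars]

theorem card_vars_le (T : CostTerm X D) : T.vars.card ≤ T.arity := by
  classical
  exact Finset.card_image_le.trans (by simp)

section SAFeasible

variable [Fintype D] {k : ℕ} {J : VCSP X D} {lam : J.LPPoint}

theorem SAFeasible.restrict_ne_zero (h : SAFeasible k J lam) {i j : J.ι}
    (hij : (J.term j).vars ⊆ (J.term i).vars) (hk : (J.term j).vars.card ≤ k)
    {t : {x // x ∈ (J.term i).vars} → D} (ht : lam i t ≠ 0) :
    lam j (fun x => t ⟨x.1, hij x.2⟩) ≠ 0 := by
  classical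
  rw [← h.marginal i j hij hk]
  refine ne_of_gt (Finset.sum_pos' (fun t _ => h.nonneg i t) ⟨t, ?_, ?_⟩)
  · simp
  · exact lt_of_le_of_ne (h.nonneg i t) ht.symm

theorem SAFeasible.exists_extension (h : SAFeasible k J lam) {i j : J.ι}
    (hij : (J.term j).vars ⊆ (J.term i).vars) (hk : (J.term j).vars.card ≤ k)
    {s : {x // x ∈ (J.term j).vars} → D} (hs : lam j s ≠ 0) :
    ∃ t, lam i t ≠ 0 ∧ (fun x : {x // x ∈ (J.term j).vars} => t ⟨x.1, hij x.2⟩) = s := by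
  classical
  rw [← h.marginal i j hij hk] at hs
  obtain ⟨t, ht, ht'⟩ := Finset.exists_ne_zero_of_sum_ne_zero hs
  exact ⟨t, ht', (Finset.mem_filter.1 ht).2⟩

end SAFeasible

open Classical in
/-- The binary constraint that the terms depending only on `u` and `v` impose on the values of
these variables. -/
def pairConstraint (I : VCSP X D) (u v : X) (a b : D) : Prop :=
  ∀ i, (∀ r, (I.term i).scope r = u ∨ (I.term i).scope r = v) →
    (I.term i).cost (fun r => if (I.term i).scope r = u then a else b) ≠ ⊤

theorem preserves_pairConstraint {I : VCSP X D} {f : D → D → D → D}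
    (hf : ∀ i, IsPolymorphism f {t | (I.term i).cost t ≠ ⊤}) (u v : X) :
    Preserves f (I.pairConstraint u v) := by
  classical
  intro a₁ a₂ a₃ b₁ b₂ b₃ h₁ h₂ h₃ i hi
  refine (congrArg (I.term i).cost (funext fun r => ?_)).trans_ne
    (hf i _ (h₁ i hi) _ (h₂ i hi) _ (h₃ i hi))
  split_ifs <;> rfl

section Support

variable [Fintype X] {I : VCSP X D}

theorem mem_vars_pad_pair {u v x : X} :
    x ∈ ((I.pad 3).term (.inr ⟨1, ![u, v]⟩)).vars ↔ x = u ∨ x = v := by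
  rw [mem_vars_iff]
  change (∃ r : Fin 2, ![u, v] r = x) ↔ _
  simp [Fin.exists_fin_succ, eq_comm]

theorem mem_vars_pad_triple {u v w x : X} :
    x ∈ ((I.pad 3).term (.inr ⟨2, ![u, v, w]⟩)).vars ↔ x = u ∨ x = v ∨ x = w := by
  rw [mem_vars_iff]
  change (∃ r : Fin 3, ![u, v, w] r = x) ↔ _
  simp [Fin.exists_fin_succ, eq_comm]

/-- The pairs of values that receive positive weight at the variables `u` and `v` in a solution of
the relaxation. -/
def supportRel (lam : (I.pad 3).LPPoint) (u v : X) (a b : D) : Prop :=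
  ∃ t, lam (.inr ⟨1, ![u, v]⟩) t ≠ 0 ∧
    t ⟨u, mem_vars_pad_pair.2 (.inl rfl)⟩ = a ∧ t ⟨v, mem_vars_pad_pair.2 (.inr rfl)⟩ = b

variable [Fintype D] {lam : (I.pad 3).LPPoint}

theorem SAFeasible.pathConsistent (h : SAFeasible 2 (I.pad 3) lam) :
    PathConsistent (supportRel lam) where
  diag u a b := by
    rintro ⟨t, -, rfl, rfl⟩
    rfl
  extend u v a b := by
    rintro ⟨s, hs, rfl, rfl⟩ w
    have sub : ∀ {y z}, (y = u ∨ y = v ∨ y = w) → (z = u ∨ z = v ∨ z = w) →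
        ((I.pad 3).term (.inr ⟨1, ![y, z]⟩)).vars ⊆
          ((I.pad 3).term (.inr ⟨2, ![u, v, w]⟩)).vars := by
      intro y z hy hz x hx
      rw [mem_vars_pad_pair] at hx
      rw [mem_vars_pad_triple]
      rcases hx with rfl | rfl <;> assumption
    obtain ⟨t, ht, rfl⟩ := h.exists_extension (sub (.inl rfl) (.inr (.inl rfl)))
      (card_vars_le _) hs
    refine ⟨t ⟨w, mem_vars_pad_triple.2 (.inr (.inr rfl))⟩, ?_, ?_⟩
    · exact ⟨_, h.restrict_ne_zero (sub (.inl rfl) (.inr (.inr rfl))) (card_vars_le _) ht,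
        rfl, rfl⟩
    · exact ⟨_, h.restrict_ne_zero (sub (.inr (.inl rfl)) (.inr (.inr rfl))) (card_vars_le _) ht,
        rfl, rfl⟩

theorem SAFeasible.exists_supportRel {k : ℕ} (h : SAFeasible k (I.pad 3) lam) (v : X) :
    ∃ a, supportRel lam v v a a := by
  have := h.sum_eq_one (.inr ⟨1, ![v, v]⟩)
  obtain ⟨t, -, ht⟩ := Finset.exists_ne_zero_of_sum_ne_zero (this.trans_ne one_ne_zero)
  exact ⟨_, t, ht, rfl, rfl⟩

theorem SAFeasible.pairConstraint_of_supportRel (h : SAFeasible 2 (I.pad 3) lam) {u v : X}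
    {a b : D} (hab : supportRel lam u v a b) : I.pairConstraint u v a b := by
  classical
  rintro i hi htop
  obtain ⟨s, hs, rfl, rfl⟩ := hab
  have hsub : (I.term i).vars ⊆ {u, v} := by
    intro x hx
    obtain ⟨r, rfl⟩ := mem_vars_iff.1 hx
    simpa using hi r
  have hpair : ((I.pad 3).term (.inl i)).vars ⊆ ((I.pad 3).term (.inr ⟨1, ![u, v]⟩)).vars :=
    fun x hx => mem_vars_pad_pair.2 (by simpa using hsub hx)
  refine h.restrict_ne_zero hpair ((Finset.card_le_card hsub).trans Finset.card_le_two) hs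
    (h.eq_zero _ _ ?_)
  rw [← htop]
  refine congrArg (I.term i).cost (funext fun r => ?_)
  split_ifs with hr
  · exact congrArg s (Subtype.ext hr)
  · exact congrArg s (Subtype.ext ((hi r).resolve_left hr))

theorem SAFeasible.exists_satisfies (hI : I.IsBinary) {f : D → D → D → D} (hf : IsMajority f)
    (hfI : ∀ i, IsPolymorphism f {t | (I.term i).cost t ≠ ⊤}) (h : SAFeasible 2 (I.pad 3) lam) :
    ∃ α, I.Satisfies α := by
  obtain ⟨α, hα⟩ := h.pathConsistent.exists_solution h.exists_supportRel hf
    (fun u v a b => h.pairConstraint_of_supportRel) (fun u v => preserves_pairConstraint hfI u v)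
  refine ⟨α, fun i => ?_⟩
  obtain ⟨u, v, huv⟩ := hI i
  convert hα u v i huv using 3 with r
  split_ifs with hr
  · rw [hr]
  · rw [(huv r).resolve_left hr]

end Support

theorem costToEReal_top : costToEReal ⊤ = ⊤ := if_pos rfl

theorem costToEReal_zero : costToEReal 0 = 0 := by
  simp [costToEReal]

open Classical in
theorem IsCrisp.cost_eq {I : VCSP X D} (hI : I.IsCrisp) (α : X → D) :
    I.cost α = if I.Satisfies α then 0 else ⊤ := by
  split_ifs with h
  · exact Finset.sum_eq_zero fun i _ => (hI i _).resolve_right (h i)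
  · obtain ⟨i, hi⟩ := Classical.not_forall_not.1 h
    exact WithTop.sum_eq_top.2 ⟨i, Finset.mem_univ i, hi⟩

open Classical in
theorem IsCrisp.opt_eq {I : VCSP X D} (hI : I.IsCrisp) :
    I.opt = if ∃ α, I.Satisfies α then 0 else ⊤ := by
  have hcost : ∀ α, costToEReal (I.cost α) = if I.Satisfies α then 0 else ⊤ := fun α => by
    rw [hI.cost_eq, apply_ite costToEReal, costToEReal_zero, costToEReal_top]
  simp only [opt, hcost]
  split_ifs with h
  · obtain ⟨α, hα⟩ := h
    refine le_antisymm (iInf_le_of_le α (if_pos hα).le) (le_iInf fun β => ?_)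
    split_ifs <;> simp
  · exact iInf_eq_top.2 fun α => if_neg fun hα => h ⟨α, hα⟩

theorem IsCrisp.saObjective_eq_zero [Fintype D] {J : VCSP X D} (hJ : J.IsCrisp) (lam : J.LPPoint) :
    saObjective J lam = 0 := by
  refine Finset.sum_eq_zero fun i _ => Finset.sum_eq_zero fun t _ => ?_
  have h : (J.term i).costAt t = 0 ∨ (J.term i).costAt t = ⊤ := hJ i _
  rcases h with h | h <;> simp [h]

open Classical in
theorem IsCrisp.saOpt_eq [Fintype X] [Fintype D] {I : VCSP X D} (hI : I.IsCrisp) (k l : ℕ) :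
    I.saOpt k l = if ∃ lam, SAFeasible k (I.pad l) lam then 0 else ⊤ := by
  simp only [saOpt, (hI.pad l).saObjective_eq_zero]
  split_ifs with h
  · obtain ⟨lam, hlam⟩ := h
    exact le_antisymm (iInf₂_le lam hlam) (le_iInf₂ fun _ _ => le_rfl)
  · exact iInf₂_eq_top.2 fun lam hlam => absurd ⟨lam, hlam⟩ h

theorem IsCrisp.saOpt_eq_opt [Fintype X] [Fintype D] {I : VCSP X D} (hI : I.IsCrisp)
    (hI2 : I.IsBinary) {f : D → D → D → D} (hf : IsMajority f)
    (hfI : ∀ i, IsPolymorphism f {t | (I.term i).cost t ≠ ⊤}) : I.saOpt 2 3 = I.opt := by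
  have feasible_iff : (∃ lam, SAFeasible 2 (I.pad 3) lam) ↔ ∃ α, I.Satisfies α :=
    ⟨fun ⟨_, hlam⟩ => hlam.exists_satisfies hI2 hf hfI,
      fun ⟨_, hα⟩ => ⟨_, (hα.pad 3).saFeasible_pointOf 2⟩⟩
  rw [hI.saOpt_eq, hI.opt_eq]
  by_cases h : ∃ α, I.Satisfies α
  · rw [if_pos h, if_pos (feasible_iff.2 h)]
  · rw [if_neg h, if_neg (mt feasible_iff.1 h)]

end VCSP

namespace OddCycle

open VCSP

variable {k n : ℕ} {G : SimpleGraph (Fin n)} {c : Fin n → Fin 3}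

/-- There is a homomorphism from `G` to the cycle that maps every vertex `v` into the list number
`c v`. -/
def HasListHom (k : ℕ) {n : ℕ} (G : SimpleGraph (Fin n)) (c : Fin n → Fin 3) : Prop :=
  ∃ g : G →g cycle k, ∀ v, g v ∈ listSet k (c v)

theorem isCrisp_listHomVCSP (k : ℕ) (G : SimpleGraph (Fin n)) (L : Fin n → Set (Fin (2 * k + 1))) :
    (listHomVCSP k G L).IsCrisp := by
  classical
  exact fun _ _ => ite_eq_or_eq _ _ _

theorem isBinary_listHomVCSP (k : ℕ) (G : SimpleGraph (Fin n))
    (L : Fin n → Set (Fin (2 * k + 1))) : (listHomVCSP k G L).IsBinary := fun e =>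
  ⟨e.1.1, e.1.2, Fin.forall_fin_two.2 ⟨.inl rfl, .inr rfl⟩⟩

theorem listHomVCSP_cost_ne_top_iff {L : Fin n → Set (Fin (2 * k + 1))}
    (e : (listHomVCSP k G L).ι) (t : Fin 2 → Fin (2 * k + 1)) :
    ((listHomVCSP k G L).term e).cost t ≠ ⊤ ↔ t ∈ edgeRel k (L e.1.1) (L e.1.2) := by
  simp [listHomVCSP]

theorem satisfies_listHomVCSP_iff {L : Fin n → Set (Fin (2 * k + 1))}
    {α : Fin n → Fin (2 * k + 1)} : (listHomVCSP k G L).Satisfies α ↔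
      ∀ u v, G.Adj u v → α u ∈ L u ∧ (cycle k).Adj (α u) (α v) := by
  constructor
  · intro h u v huv
    rcases lt_or_gt_of_ne huv.ne with hlt | hlt
    · have := (listHomVCSP_cost_ne_top_iff _ _).1 (h ⟨(u, v), hlt, huv⟩)
      exact ⟨this.1, this.2.2⟩
    · have := (listHomVCSP_cost_ne_top_iff _ _).1 (h ⟨(v, u), hlt, huv.symm⟩)
      exact ⟨this.2.1, this.2.2.symm⟩
  · intro h e
    exact (listHomVCSP_cost_ne_top_iff _ _).2
      ⟨(h _ _ e.2.2).1, (h _ _ e.2.2.symm).1, (h _ _ e.2.2).2⟩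

theorem listSet_nonempty (hk : 1 ≤ k) (c : Fin 3) : (listSet k c).Nonempty := by
  fin_cases c
  · exact ⟨⟨1, by omega⟩, by simp [mem_listSet_iff, NatList]⟩
  · exact ⟨⟨0, by omega⟩, by simp [mem_listSet_iff, NatList]⟩
  · exact ⟨⟨0, by omega⟩, by simp [mem_listSet_iff, NatList]⟩

theorem exists_satisfies_iff_hasListHom (hk : 1 ≤ k) :
    (∃ α, (listHomVCSP k G fun v => listSet k (c v)).Satisfies α) ↔ HasListHom k G c := by
  classical
  simp only [satisfies_listHomVCSP_iff]
  constructor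
  · rintro ⟨α, hα⟩
    choose e he using fun v => listSet_nonempty hk (c v)
    -- the instance does not constrain the values of isolated vertices
    let g := fun v => if α v ∈ listSet k (c v) then α v else e v
    have hg : ∀ u v, G.Adj u v → g u = α u := fun u v huv => if_pos (hα u v huv).1
    refine ⟨⟨g, fun {u v} huv => ?_⟩, fun v => ?_⟩
    · rw [hg u v huv, hg v u huv.symm]
      exact (hα u v huv).2
    · change (if _ then _ else _) ∈ _
      split_ifs with h
      · exact h
      · exact he v
  · rintro ⟨g, hg⟩
    exact ⟨g, fun u v huv => ⟨hg u, g.map_adj huv⟩⟩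

theorem saOpt_eq_opt (hk : 1 ≤ k) (G : SimpleGraph (Fin n)) (c : Fin n → Fin 3) :
    (listHomVCSP k G fun v => listSet k (c v)).saOpt 2 3 =
      (listHomVCSP k G fun v => listSet k (c v)).opt := by
  refine (isCrisp_listHomVCSP k G _).saOpt_eq_opt (isBinary_listHomVCSP k G _)
    (isMajority_majority k) fun e => ?_
  have allowed_eq : {t | ((listHomVCSP k G fun v => listSet k (c v)).term e).cost t ≠ ⊤} =
      edgeRel k (listSet k (c e.1.1)) (listSet k (c e.1.2)) :=
    Set.ext fun t => listHomVCSP_cost_ne_top_iff e t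
  rw [allowed_eq]
  exact isPolymorphism_majority hk (c e.1.1) (c e.1.2)

theorem saOpt_eq_zero_iff (hk : 1 ≤ k) (G : SimpleGraph (Fin n)) (c : Fin n → Fin 3) :
    (listHomVCSP k G fun v => listSet k (c v)).saOpt 2 3 = 0 ↔ HasListHom k G c := by
  classical
  rw [saOpt_eq_opt hk, (isCrisp_listHomVCSP k G _).opt_eq, exists_satisfies_iff_hasListHom hk]
  split_ifs with h <;> simp [h]

/-- The binary constraints of the list homomorphism problem. -/
def Allowed (k : ℕ) {n : ℕ} (G : SimpleGraph (Fin n)) (c : Fin n → Fin 3) (u v : Fin n)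
    (a b : Fin (2 * k + 1)) : Prop :=
  a ∈ listSet k (c u) ∧ b ∈ listSet k (c v) ∧ (G.Adj u v → (cycle k).Adj a b)

theorem preserves_allowed (hk : 1 ≤ k) (u v : Fin n) :
    Preserves (majority k) (Allowed k G c u v) := fun a₁ a₂ a₃ b₁ b₂ b₃ h₁ h₂ h₃ =>
  ⟨majority_mem_listSet h₁.1 h₂.1 h₃.1, majority_mem_listSet h₁.2.1 h₂.2.1 h₃.2.1, fun huv =>
    (isPolymorphism_majority hk (c u) (c v) ![a₁, b₁] ⟨h₁.1, h₁.2.1, h₁.2.2 huv⟩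
      ![a₂, b₂] ⟨h₂.1, h₂.2.1, h₂.2.2 huv⟩ ![a₃, b₃] ⟨h₃.1, h₃.2.1, h₃.2.2 huv⟩).2.2⟩

theorem hasListHom_of_pathConsistent (hk : 1 ≤ k)
    {R : Fin n → Fin n → Fin (2 * k + 1) → Fin (2 * k + 1) → Prop} (hR : PathConsistent R)
    (hne : ∀ v, ∃ a, R v v a a) (hRC : ∀ u v a b, R u v a b → Allowed k G c u v a b) :
    HasListHom k G c := by
  obtain ⟨g, hg⟩ := hR.exists_solution hne (isMajority_majority k) hRC (preserves_allowed hk)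
  exact ⟨⟨g, fun {u v} huv => (hg u v).2.2 huv⟩, fun v => (hg v v).1⟩

end OddCycle

/-! ### The success probability of a sample -/

namespace OddCycle

variable {k n : ℕ}

theorem alpha_pow_eq (hk : 1 ≤ k) :
    alpha k ^ (2 * k + 1) = ((2 * k + 1 : ℝ) / 2) * ((2 * k + 1 : ℝ) / (2 * k)) ^ (2 * k) := by
  have : (0 : ℝ) < k := by exact_mod_cast hk
  have hd : (2 * k + 1 : ℝ) ≠ 0 := by positivity
  unfold alpha
  rw [mul_pow, ← Real.rpow_natCast, ← Real.rpow_mul (by positivity), ← Real.rpow_natCast,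
    ← Real.rpow_mul (by positivity)]
  push_cast
  rw [div_mul_cancel₀ _ hd, div_mul_cancel₀ _ hd, Real.rpow_one]
  congr 1
  rw [← Real.rpow_natCast]
  push_cast
  rfl

theorem one_le_alpha (hk : 1 ≤ k) : 1 ≤ alpha k := by
  have hk' : (1 : ℝ) ≤ k := by exact_mod_cast hk
  unfold alpha
  refine one_le_mul_of_one_le_of_one_le (Real.one_le_rpow ?_ (by positivity))
    (Real.one_le_rpow ?_ (by positivity))
  · rw [one_le_div (by norm_num)]
    linarith
  · rw [one_le_div (by linarith)]
    linarith

theorem alpha_pos (hk : 1 ≤ k) : 0 < alpha k := one_pos.trans_le (one_le_alpha hk)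

/-- The probability that the vertex `a` of the cycle belongs to a random list. -/
def valueProb (k : ℕ) (a : Fin (2 * k + 1)) : ℝ :=
  if a = 0 then 2 / (2 * k + 1) else 2 * k / (2 * k + 1)

theorem valueProb_nonneg (k : ℕ) (a : Fin (2 * k + 1)) : 0 ≤ valueProb k a := by
  unfold valueProb
  split_ifs <;> positivity

theorem prod_valueProb {V : Type*} [Fintype V] (g : V → Fin (2 * k + 1)) {m : ℕ}
    (hm : (Finset.univ.filter fun v => g v = 0).card = m) :
    ∏ v, valueProb k (g v) =
      (2 / (2 * k + 1) : ℝ) ^ m * (2 * k / (2 * k + 1) : ℝ) ^ (Fintype.card V - m) := by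
  classical
  simp only [valueProb]
  rw [Finset.prod_ite, Finset.prod_const, Finset.prod_const, hm,
    Finset.filter_not, Finset.card_sdiff_of_subset (Finset.filter_subset _ _), hm,
    Finset.card_univ]

theorem inv_alpha_pow_le (hk : 1 ≤ k) {m : ℕ} (hm : (2 * k + 1) * m ≤ n) :
    (alpha k ^ n)⁻¹ ≤ (2 / (2 * k + 1) : ℝ) ^ m * (2 * k / (2 * k + 1) : ℝ) ^ (n - m) := by
  have hk' : (1 : ℝ) ≤ k := by exact_mod_cast hk
  have : (0 : ℝ) < k := by linarith
  have hmn : m + (n - m) = n := Nat.add_sub_of_le ((Nat.le_mul_of_pos_left m (by omega)).trans hm)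
  set B : ℝ := (2 * k + 1 : ℝ) / (2 * k) with hB
  have : 0 < B := by positivity
  have hA : (2 * k + 1 : ℝ) / 2 = k * B := by
    rw [hB]
    field_simp
  have hinv : (2 / (2 * k + 1) : ℝ) ^ m * (2 * k / (2 * k + 1) : ℝ) ^ (n - m) =
      ((k : ℝ) ^ m * B ^ n)⁻¹ := by
    rw [← inv_div, ← inv_div (2 * k + 1 : ℝ) (2 * k), hA, ← hB, inv_pow, inv_pow, ← mul_inv,
      mul_pow, mul_assoc, ← pow_add, hmn]
  rw [hinv]
  refine inv_anti₀ (by positivity) (le_of_pow_le_pow_left₀ (n := 2 * k + 1) (by omega)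
    (pow_nonneg (alpha_pos hk).le _) ?_)
  calc ((k : ℝ) ^ m * B ^ n) ^ (2 * k + 1)
      = (k : ℝ) ^ ((2 * k + 1) * m) * B ^ (n * (2 * k + 1)) := by
        rw [mul_pow, ← pow_mul, ← pow_mul, mul_comm m]
    _ ≤ (k : ℝ) ^ n * B ^ (n * (2 * k + 1)) :=
        mul_le_mul_of_nonneg_right (pow_le_pow_right₀ hk' hm) (by positivity)
    _ = (alpha k ^ n) ^ (2 * k + 1) := by
        rw [pow_right_comm, alpha_pow_eq hk, ← hB, hA, mul_assoc, ← pow_succ', mul_pow, ← pow_mul,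
          mul_comm n]

/-- The homomorphism `h` followed by the rotation of the cycle that moves the vertex `j` to `0`. -/
def rotate {V : Type*} {G : SimpleGraph V} (h : G →g cycle k) (j : Fin (2 * k + 1)) :
    G →g cycle k where
  toFun v := h v - j
  map_rel' {u v} huv := by
    have := h.map_adj huv
    rw [SimpleGraph.cycleGraph_adj'] at this ⊢
    rwa [sub_sub_sub_cancel_right, sub_sub_sub_cancel_right]

/-- Some vertex of the cycle is the image of at most `n / (2 * k + 1)` vertices; rotate it to the
vertex `0`, which is the one that belongs to few lists. -/
theorem exists_hom_valueProb (hk : 1 ≤ k) {G : SimpleGraph (Fin n)}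
    (hG : Nonempty (G →g cycle k)) :
    ∃ h : G →g cycle k, (alpha k ^ n)⁻¹ ≤ ∏ v, valueProb k (h v) := by
  obtain ⟨h⟩ := hG
  obtain ⟨j, hj⟩ := Fintype.exists_card_fiber_le_of_card_le_nsmul (M := ℚ) h
    (b := n / (2 * k + 1)) (by
      simp only [Fintype.card_fin, nsmul_eq_mul]
      push_cast
      rw [mul_div_cancel₀ _ (by positivity)])
  rw [le_div_iff₀' (by positivity)] at hj
  refine ⟨rotate h j, (inv_alpha_pow_le hk (by exact_mod_cast hj)).trans_eq ?_⟩
  rw [prod_valueProb (rotate h j) rfl, Fintype.card_fin]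
  simp only [rotate, RelHom.coeFn_mk, sub_eq_zero]

theorem sum_listProb_mem (a : Fin (2 * k + 1)) [∀ i, Decidable (a ∈ listSet k i)] :
    ∑ i : Fin 3, (if a ∈ listSet k i then listProb k i else 0) = valueProb k a := by
  have hd : (2 * k + 1 : ℝ) ≠ 0 := by positivity
  have h0 : a ∈ listSet k 0 ↔ (a : ℕ) ≠ 0 := mem_listSet_iff 0 a
  have h1 : a ∈ listSet k 1 ↔ (a : ℕ) % 2 = 0 := mem_listSet_iff 1 a
  have h2 : a ∈ listSet k 2 ↔ (a : ℕ) % 2 = 1 ∨ (a : ℕ) = 0 := mem_listSet_iff 2 a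
  simp only [Fin.sum_univ_three, valueProb, listProb, Matrix.cons_val, ← Fin.val_eq_zero_iff]
  rcases Nat.eq_zero_or_pos (a : ℕ) with h | h
  · rw [if_neg (by tauto), if_pos (by rw [h1]; omega), if_pos (h2.2 (.inr h)), if_pos h]
    ring
  · rw [if_pos (by rw [h0]; omega), if_neg (c := (a : ℕ) = 0) h.ne']
    rcases Nat.mod_two_eq_zero_or_one (a : ℕ) with h' | h'
    · rw [if_pos (h1.2 h'), if_neg (by rw [h2]; omega)]
      field_simp
      ring
    · rw [if_neg (by rw [h1]; omega), if_pos (h2.2 (.inl h'))]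
      field_simp
      ring

theorem prod_valueProb_eq_sum {V : Type*} [Fintype V] [DecidableEq V]
    [∀ a i, Decidable (a ∈ listSet k i)] (g : V → Fin (2 * k + 1)) :
    ∏ v, valueProb k (g v) =
      ∑ c : V → Fin 3, ∏ v, if g v ∈ listSet k (c v) then listProb k (c v) else 0 := by
  rw [← Fintype.piFinset_univ, ← Finset.prod_univ_sum
    (f := fun v i => if g v ∈ listSet k i then listProb k i else 0)]
  exact Finset.prod_congr rfl fun v _ => (sum_listProb_mem _).symm

theorem listProb_nonneg (hk : 1 ≤ k) (i : Fin 3) : 0 ≤ listProb k i := by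
  have hk' : (1 : ℝ) ≤ k := by exact_mod_cast hk
  have : (0 : ℝ) ≤ 2 * k - 1 := by linarith
  fin_cases i <;> change (0 : ℝ) ≤ _ / _ <;> positivity

theorem inv_alpha_pow_le_sampleSuccess (hk : 1 ≤ k) {G : SimpleGraph (Fin n)}
    (hG : Nonempty (G →g cycle k)) : (alpha k ^ n)⁻¹ ≤ sampleSuccess k G := by
  classical
  obtain ⟨h, hh⟩ := exists_hom_valueProb hk hG
  refine hh.trans ?_
  rw [prod_valueProb_eq_sum, sampleSuccess]
  refine Finset.sum_le_sum fun c _ => ?_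
  by_cases hc : ∀ v, h v ∈ listSet k (c v)
  · rw [if_pos ((saOpt_eq_zero_iff hk G c).2 ⟨h, hc⟩)]
    exact (Finset.prod_congr rfl fun v _ => if_pos (hc v)).le
  · push Not at hc
    obtain ⟨v, hv⟩ := hc
    rw [Finset.prod_eq_zero (Finset.mem_univ v) (if_neg hv)]
    split_ifs
    · exact Finset.prod_nonneg fun v _ => listProb_nonneg hk _
    · exact le_rfl

end OddCycle

/-! ### Executions of random-access machine programs -/

namespace RAM

theorem Exec.deterministic {S S' : ℕ} {p : Prog} {σ τ τ' : Store} {w w' u u' : List Bool}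
    {t t' : ℕ} (h : Exec S p σ w t τ) (h' : Exec S' p σ w' t' τ') (hw : w ++ u = w' ++ u') :
    w = w' ∧ τ = τ' := by
  induction h generalizing w' u u' t' τ' with
  | skip | write =>
    cases h'
    exact ⟨rfl, rfl⟩
  | flip =>
    cases h'
    obtain ⟨rfl, -⟩ := List.cons_eq_cons.1 hw
    exact ⟨rfl, rfl⟩
  | seq _ _ _ _ _ _ _ _ _ _ _ ihp ihq =>
    cases h' with
    | seq _ _ _ _ _ _ _ _ _ hp hq =>
      rw [List.append_assoc, List.append_assoc] at hw
      obtain ⟨rfl, rfl⟩ := ihp hp hw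
      obtain ⟨rfl, rfl⟩ := ihq hq (List.append_cancel_left hw)
      exact ⟨rfl, rfl⟩
  | cond_true _ _ _ _ _ _ _ he _ _ ih =>
    cases h' with
    | cond_true _ _ _ _ _ _ _ _ _ hp => exact ih hp hw
    | cond_false _ _ _ _ _ _ _ he' => exact absurd he' he
  | cond_false _ _ _ _ _ _ _ he _ _ ih =>
    cases h' with
    | cond_true _ _ _ _ _ _ _ he' => exact absurd he he'
    | cond_false _ _ _ _ _ _ _ _ _ hq => exact ih hq hw
  | loop_done _ _ _ he =>
    cases h' with
    | loop_done => exact ⟨rfl, rfl⟩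
    | loop_step _ _ _ _ _ _ _ _ _ he' => exact absurd he he'
  | loop_step _ _ _ _ _ _ _ _ _ he _ _ _ ihp ihl =>
    cases h' with
    | loop_done _ _ _ he' => exact absurd he' he
    | loop_step _ _ _ _ _ _ _ _ _ _ _ hp hl =>
      rw [List.append_assoc, List.append_assoc] at hw
      obtain ⟨rfl, rfl⟩ := ihp hp hw
      obtain ⟨rfl, rfl⟩ := ihl hl (List.append_cancel_left hw)
      exact ⟨rfl, rfl⟩

theorem Exec.mono {S S' : ℕ} (hS : S ≤ S') {p : Prog} {σ τ : Store} {w : List Bool} {t : ℕ}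
    (h : Exec S p σ w t τ) : Exec S' p σ w t τ := by
  induction h with
  | skip σ h => exact .skip σ (h.trans hS)
  | write a i e σ h => exact .write a i e σ (h.trans hS)
  | flip a b σ h => exact .flip a b σ (h.trans hS)
  | seq _ _ _ _ _ _ _ _ _ _ _ ihp ihq => exact .seq _ _ _ _ _ _ _ _ _ ihp ihq
  | cond_true _ _ _ _ _ _ _ he h _ ih => exact .cond_true _ _ _ _ _ _ _ he (h.trans hS) ih
  | cond_false _ _ _ _ _ _ _ he h _ ih => exact .cond_false _ _ _ _ _ _ _ he (h.trans hS) ih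
  | loop_done _ _ _ he h => exact .loop_done _ _ _ he (h.trans hS)
  | loop_step _ _ _ _ _ _ _ _ _ he h _ _ ihp ihl =>
    exact .loop_step _ _ _ _ _ _ _ _ _ he (h.trans hS) ihp ihl

theorem size_add_le (a b : ℕ) : Nat.size (a + b) ≤ Nat.size a + Nat.size b + 1 := by
  rw [Nat.size_le, pow_succ, mul_two]
  exact add_lt_add
    ((Nat.lt_size_self a).trans_le (Nat.pow_le_pow_right two_pos (Nat.le_add_right _ _)))
    ((Nat.lt_size_self b).trans_le (Nat.pow_le_pow_right two_pos (Nat.le_add_left _ _)))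

theorem size_mul_le (a b : ℕ) : Nat.size (a * b) ≤ Nat.size a + Nat.size b := by
  rw [Nat.size_le, pow_add]
  exact Nat.mul_lt_mul'' (Nat.lt_size_self a) (Nat.lt_size_self b)

theorem size_le_self (a : ℕ) : Nat.size a ≤ a := Nat.size_le.2 Nat.lt_two_pow_self

namespace Expr

/-- The factor by which the bit length of the numbers in the memory has to be multiplied to bound
the cost of an expression; see `cost_le`. -/
def weight : Expr → ℕ
  | .const c => 1 + Nat.size c
  | .read _ i => i.weight + 2
  | .add e₁ e₂ | .sub e₁ e₂ | .mul e₁ e₂ | .div e₁ e₂ => 2 * (e₁.weight + e₂.weight) + 2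

theorem size_eval_le_cost (σ : Store) (e : Expr) : Nat.size (e.eval σ) ≤ e.cost σ := by
  cases e <;> simp only [eval, cost] <;> omega

theorem cost_le {σ : Store} {B : ℕ} (hB : 1 ≤ B) (h : ∀ c, Nat.size (σ c) ≤ B) (e : Expr) :
    e.cost σ ≤ e.weight * B := by
  have binary (e₁ e₂ : Expr) (x : ℕ) (h₁ : e₁.cost σ ≤ e₁.weight * B)
      (h₂ : e₂.cost σ ≤ e₂.weight * B)
      (hx : Nat.size x ≤ Nat.size (e₁.eval σ) + Nat.size (e₂.eval σ) + 1) :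
      e₁.cost σ + e₂.cost σ + (1 + Nat.size x) ≤ (2 * (e₁.weight + e₂.weight) + 2) * B := by
    have s₁ := size_eval_le_cost σ e₁
    have s₂ := size_eval_le_cost σ e₂
    calc e₁.cost σ + e₂.cost σ + (1 + Nat.size x)
        ≤ 2 * (e₁.weight * B + e₂.weight * B) + 2 * 1 := by omega
      _ ≤ 2 * (e₁.weight * B + e₂.weight * B) + 2 * B := by omega
      _ = _ := by ring
  induction e with
  | const c => exact Nat.le_mul_of_pos_right _ hB
  | read a i ih =>
    have := h (a, i.eval σ)
    simp only [cost, weight]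
    rw [add_mul]
    omega
  | add e₁ e₂ h₁ h₂ => exact binary _ _ _ h₁ h₂ (size_add_le _ _)
  | sub e₁ e₂ h₁ h₂ =>
    exact binary _ _ _ h₁ h₂ ((Nat.size_le_size (Nat.sub_le _ _)).trans (by omega))
  | mul e₁ e₂ h₁ h₂ => exact binary _ _ _ h₁ h₂ ((size_mul_le _ _).trans (by omega))
  | div e₁ e₂ h₁ h₂ =>
    exact binary _ _ _ h₁ h₂ ((Nat.size_le_size (Nat.div_le_self _ _)).trans (by omega))

end Expr

/-- The factor by which the bit length of the numbers in the memory has to be multiplied to bound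
the cost of a single step of a program. -/
def Prog.weight : Prog → ℕ
  | .skip => 1
  | .write _ i e => i.weight + e.weight + 1
  | .flip _ => 2
  | .seq p q => p.weight + q.weight
  | .cond e p q => e.weight + 1 + p.weight + q.weight
  | .loop e p => e.weight + 1 + p.weight

/-- The memory uses only the arrays `0, …, 9` and addresses below `A`, and all numbers have bit
length at most `B`. -/
structure Bounded (A B : ℕ) (σ : Store) : Prop where
  address : ∀ a i, σ (a, i) ≠ 0 → a < 10 ∧ i < A
  size : ∀ c, Nat.size (σ c) ≤ B

theorem Bounded.update {A B : ℕ} {σ : Store} (h : Bounded A B σ) {a i v : ℕ} (ha : a < 10)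
    (hi : i < A) (hv : Nat.size v ≤ B) : Bounded A B (σ.update (a, i) v) where
  address a' i' h' := by
    by_cases e : (a', i') = (a, i)
    · cases e
      exact ⟨ha, hi⟩
    · rw [Finsupp.coe_update, Function.update_of_ne e] at h'
      exact h.address _ _ h'
  size c := by
    by_cases e : c = (a, i)
    · rw [Finsupp.coe_update, e, Function.update_self]
      exact hv
    · rw [Finsupp.coe_update, Function.update_of_ne e]
      exact h.size _

/-- A bound for the space used by a memory that is bounded by `A` and `B`. -/
def spaceBound (A B : ℕ) : ℕ := 10 * A * (1 + A + B)

theorem Bounded.space_le {A B : ℕ} {σ : Store} (h : Bounded A B σ) : σ.space ≤ spaceBound A B := by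
  unfold Store.space Finsupp.sum
  have hsub : σ.support ⊆ Finset.range 10 ×ˢ Finset.range A := by
    intro c hc
    have := h.address c.1 c.2 (Finsupp.mem_support_iff.1 hc)
    simpa using this
  calc ∑ c ∈ σ.support, (1 + Nat.size c.2 + Nat.size (σ c))
      ≤ ∑ c ∈ σ.support, (1 + A + B) := by
        refine Finset.sum_le_sum fun c hc => ?_
        have h1 := h.address c.1 c.2 (Finsupp.mem_support_iff.1 hc)
        have h2 := h.size c
        have h3 := size_le_self c.2
        omega
    _ = σ.support.card * (1 + A + B) := by rw [Finset.sum_const, smul_eq_mul]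
    _ ≤ _ := by
        refine Nat.mul_le_mul_right _ ((Finset.card_le_card hsub).trans ?_)
        simp

/-- `Runs A B W p σ w s τ`: the program runs from `σ` to `τ` with coin flips `w` in `s` steps of
cost at most `W * B` each, within the space allowed by the bounds. -/
def Runs (A B W : ℕ) (p : Prog) (σ : Store) (w : List Bool) (s : ℕ) (τ : Store) : Prop :=
  ∃ t ≤ s * (W * B), Exec (spaceBound A B + W * B) p σ w t τ

namespace Runs

variable {A B W : ℕ}

theorem write {a x v : ℕ} {i e : Expr} {σ : Store} (hB : 1 ≤ B) (h : Bounded A B σ)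
    (hW : (Prog.write a i e).weight ≤ W) (hi : i.eval σ = x) (he : e.eval σ = v) :
    Runs A B W (.write a i e) σ [] 1 (σ.update (a, x) v) := by
  subst hi he
  have : i.cost σ + e.cost σ + 1 ≤ W * B :=
    calc i.cost σ + e.cost σ + 1 ≤ i.weight * B + e.weight * B + 1 * B := by
          have := i.cost_le hB h.size
          have := e.cost_le hB h.size
          omega
      _ = (Prog.write a i e).weight * B := by unfold Prog.weight; ring
      _ ≤ W * B := Nat.mul_le_mul_right _ hW
  have := h.space_le
  exact ⟨_, by omega, Exec.write a i e σ (by omega)⟩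

theorem flip {a : ℕ} {σ : Store} (b : Bool) (hB : 1 ≤ B) (h : Bounded A B σ)
    (hW : (Prog.flip a).weight ≤ W) :
    Runs A B W (.flip a) σ [b] 1 (σ.update (a, 0) b.toNat) := by
  have : 2 ≤ W * B := Nat.le_mul_of_pos_right 2 hB |>.trans (Nat.mul_le_mul_right _ hW)
  have := h.space_le
  exact ⟨_, by omega, Exec.flip a b σ (by omega)⟩

theorem seq {p q : Prog} {σ σ' τ : Store} {w w' : List Bool} {s s' : ℕ}
    (hp : Runs A B W p σ w s σ') (hq : Runs A B W q σ' w' s' τ) :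
    Runs A B W (.seq p q) σ (w ++ w') (s + s') τ := by
  obtain ⟨t, ht, h⟩ := hp
  obtain ⟨t', ht', h'⟩ := hq
  exact ⟨t + t', by rw [add_mul]; omega, Exec.seq _ _ _ _ _ _ _ _ _ h h'⟩

theorem mono {p : Prog} {σ τ : Store} {w : List Bool} {s s' : ℕ} (h : Runs A B W p σ w s τ)
    (hs : s ≤ s') : Runs A B W p σ w s' τ := by
  obtain ⟨t, ht, h⟩ := h
  exact ⟨t, ht.trans (Nat.mul_le_mul_right _ hs), h⟩

theorem cost_test {e : Expr} {p : Prog} {σ : Store} (hB : 1 ≤ B) (h : Bounded A B σ)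
    (hW : (Prog.loop e p).weight ≤ W) : e.cost σ + 1 ≤ W * B := by
  calc e.cost σ + 1 ≤ e.weight * B + 1 * B := by
        have := e.cost_le hB h.size
        omega
    _ = (e.weight + 1) * B := by ring
    _ ≤ W * B := Nat.mul_le_mul_right _ (by unfold Prog.weight at hW; omega)

theorem loop_done {e : Expr} {p : Prog} {σ : Store} (hB : 1 ≤ B) (h : Bounded A B σ)
    (hW : (Prog.loop e p).weight ≤ W) (he : e.eval σ = 0) :
    Runs A B W (.loop e p) σ [] 1 σ := by
  have := cost_test hB h hW
  have := h.space_le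
  exact ⟨_, by omega, Exec.loop_done e p σ he (by omega)⟩

theorem loop_step {e : Expr} {p : Prog} {σ σ' τ : Store} {w w' : List Bool} {s s' : ℕ}
    (hB : 1 ≤ B) (h : Bounded A B σ) (hW : (Prog.loop e p).weight ≤ W) (he : e.eval σ ≠ 0)
    (hp : Runs A B W p σ w s σ') (hl : Runs A B W (.loop e p) σ' w' s' τ) :
    Runs A B W (.loop e p) σ (w ++ w') (1 + s + s') τ := by
  have := cost_test hB h hW
  have := h.space_le
  obtain ⟨t, ht, h⟩ := hp
  obtain ⟨t', ht', hloop⟩ := hl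
  exact ⟨_, by rw [add_mul, add_mul]; omega,
    Exec.loop_step e p _ _ _ _ _ _ _ he (by omega) h hloop⟩

theorem loop {e : Expr} {p : Prog} (hB : 1 ≤ B) (hW : (Prog.loop e p).weight ≤ W)
    (Inv : ℕ → Store → Prop) (T s : ℕ) (w : ℕ → List Bool)
    (hbdd : ∀ j σ, Inv j σ → Bounded A B σ)
    (htest : ∀ j σ, Inv j σ → j < T → e.eval σ ≠ 0)
    (hend : ∀ σ, Inv T σ → e.eval σ = 0)
    (hbody : ∀ j σ, Inv j σ → j < T → ∃ τ, Runs A B W p σ (w j) s τ ∧ Inv (j + 1) τ)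
    {σ : Store} (h0 : Inv 0 σ) :
    ∃ τ, Runs A B W (.loop e p) σ ((List.range T).flatMap w) (T * (s + 1) + 1) τ ∧ Inv T τ := by
  suffices remaining : ∀ m j σ, j + m = T → Inv j σ →
      ∃ τ, Runs A B W (.loop e p) σ ((List.range' j m).flatMap w) (m * (s + 1) + 1) τ ∧
        Inv T τ by
    rw [List.range_eq_range']
    exact remaining T 0 σ (Nat.zero_add T) h0
  intro m
  induction m with
  | zero =>
    rintro j σ rfl hσ
    exact ⟨σ, by simpa using loop_done hB (hbdd _ _ hσ) hW (hend _ hσ), hσ⟩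
  | succ m ih =>
    intro j σ hj hσ
    obtain ⟨σ', hrun, hσ'⟩ := hbody j σ hσ (by omega)
    obtain ⟨τ, hrun', hτ⟩ := ih (j + 1) σ' (by omega) hσ'
    refine ⟨τ, ?_, hτ⟩
    rw [List.range'_succ, List.flatMap_cons]
    refine (loop_step hB (hbdd _ _ hσ) hW (htest _ _ hσ (by omega)) hrun hrun').mono ?_
    rw [add_mul]
    omega

end Runs

namespace Expr

/-- The number in cell `0` of an array. -/
def var (a : ℕ) : Expr := .read a (.const 0)

/-- The remainder of an integer division. -/
def mod (e₁ e₂ : Expr) : Expr := .sub e₁ (.mul (.div e₁ e₂) e₂)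

/-- The sign of a number: `0` for zero and `1` for other numbers. -/
def sign (e : Expr) : Expr := .sub (.const 1) (.sub (.const 1) e)

/-- The equality test, with value `1` if the two numbers agree and `0` otherwise. -/
def eq (e₁ e₂ : Expr) : Expr := .sub (.const 1) (.add (.sub e₁ e₂) (.sub e₂ e₁))

/-- The implication, with value `1` if the second number is nonzero or the first one is zero, and
`0` otherwise. -/
def imp (e₁ e₂ : Expr) : Expr := sign (.add (.sub (.const 1) e₁) e₂)

/-- The sum of the first `d` expressions of a sequence. -/
def sum (d : ℕ) (f : ℕ → Expr) : Expr :=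
  match d with
  | 0 => .const 0
  | d + 1 => .add (sum d f) (f d)

/-- The entry `φ x y` of a table, `x` and `y` being the values of two expressions; the table is
written out in the program, so it has to be finite: `x` and `y` must be less than `d`. -/
def table (d : ℕ) (φ : ℕ → ℕ → ℕ) (e₁ e₂ : Expr) : Expr :=
  sum d fun x => sum d fun y => .mul (.mul (eq e₁ (.const x)) (eq e₂ (.const y))) (.const (φ x y))

variable (σ : Store)

@[simp] theorem eval_var (a : ℕ) : (var a).eval σ = σ (a, 0) := rfl

@[simp] theorem eval_mod (e₁ e₂ : Expr) : (mod e₁ e₂).eval σ = e₁.eval σ % e₂.eval σ := by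
  change e₁.eval σ - e₁.eval σ / e₂.eval σ * e₂.eval σ = _
  have := Nat.mod_add_div' (e₁.eval σ) (e₂.eval σ)
  omega

@[simp] theorem eval_sign (e : Expr) :
    (sign e).eval σ = if e.eval σ = 0 then 0 else 1 := by
  change 1 - (1 - e.eval σ) = _
  split_ifs <;> omega

@[simp] theorem eval_eq (e₁ e₂ : Expr) :
    (eq e₁ e₂).eval σ = if e₁.eval σ = e₂.eval σ then 1 else 0 := by
  change 1 - (e₁.eval σ - e₂.eval σ + (e₂.eval σ - e₁.eval σ)) = _
  split_ifs <;> omega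

@[simp] theorem eval_imp (e₁ e₂ : Expr) :
    (imp e₁ e₂).eval σ = if e₁.eval σ ≠ 0 → e₂.eval σ ≠ 0 then 1 else 0 := by
  have : 1 - e₁.eval σ + e₂.eval σ = 0 ↔ ¬(e₁.eval σ ≠ 0 → e₂.eval σ ≠ 0) := by omega
  rw [imp, eval_sign]
  exact (if_congr this rfl rfl).trans (ite_not _ _ _)

@[simp] theorem eval_sum (d : ℕ) (f : ℕ → Expr) :
    (sum d f).eval σ = ∑ x ∈ Finset.range d, (f x).eval σ := by
  induction d with
  | zero => rfl
  | succ d ih => rw [Finset.sum_range_succ, ← ih]; rfl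

theorem eval_table {d : ℕ} (φ : ℕ → ℕ → ℕ) {e₁ e₂ : Expr} (h₁ : e₁.eval σ < d)
    (h₂ : e₂.eval σ < d) : (table d φ e₁ e₂).eval σ = φ (e₁.eval σ) (e₂.eval σ) := by
  simp only [table, eval_sum, eval, eval_eq]
  rw [Finset.sum_eq_single (e₁.eval σ)]
  · rw [Finset.sum_eq_single (e₂.eval σ)]
    · simp
    · intro y _ hy
      simp [hy.symm]
    · intro h
      exact absurd (Finset.mem_range.2 h₂) h
  · intro x _ hx
    simp [hx.symm]
  · intro h
    exact absurd (Finset.mem_range.2 h₁) h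

end Expr

theorem Store.update_apply (σ : Store) (a i v a' i' : ℕ) :
    (σ.update (a, i) v) (a', i') = if a' = a ∧ i' = i then v else σ (a', i') := by
  classical
  rw [Finsupp.coe_update, Function.update_apply]
  exact if_congr Prod.mk_inj rfl rfl

/-- The memory `τ` agrees with `σ` outside the given arrays, those that a program may modify. -/
def AgreeOff (mods : List ℕ) (σ τ : Store) : Prop := ∀ a i, a ∉ mods → τ (a, i) = σ (a, i)

theorem AgreeOff.refl (mods : List ℕ) (σ : Store) : AgreeOff mods σ σ := fun _ _ _ => rfl

theorem AgreeOff.trans {mods : List ℕ} {σ τ υ : Store} (h : AgreeOff mods σ τ)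
    (h' : AgreeOff mods τ υ) : AgreeOff mods σ υ :=
  fun a i ha => (h' a i ha).trans (h a i ha)

theorem AgreeOff.mono {mods mods' : List ℕ} {σ τ : Store} (h : AgreeOff mods σ τ)
    (hm : mods ⊆ mods') : AgreeOff mods' σ τ :=
  fun a i ha => h a i fun h' => ha (hm h')

theorem AgreeOff.update {mods : List ℕ} {σ τ : Store} (h : AgreeOff mods σ τ) {a : ℕ}
    (ha : a ∈ mods) (i v : ℕ) : AgreeOff mods σ (τ.update (a, i) v) := by
  intro b j hb
  rw [Store.update_apply, if_neg (fun e : b = a ∧ j = i => hb (e.1 ▸ ha)), h b j hb]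

/-- A loop whose counter, in array `3`, runs through the numbers below the value of `bound`. -/
def Prog.forLoop (bound : Expr) (body : Prog) : Prog :=
  .seq (.write 3 (.const 0) (.const 0))
    (.loop (.sub bound (.var 3)) (.seq body (.write 3 (.const 0) (.add (.var 3) (.const 1)))))

theorem Runs.forLoop {A B W : ℕ} {bound : Expr} {body : Prog} (hA : 0 < A) (hB : 1 ≤ B)
    (hW : (Prog.forLoop bound body).weight ≤ W) {mods : List ℕ} (h3 : 3 ∈ mods) {σ : Store}
    (hσ : Bounded A B σ) (Inv : ℕ → Store → Prop) (T s : ℕ) (w : ℕ → List Bool) (hT : T ≤ B)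
    (hbound : ∀ τ, AgreeOff mods σ τ → bound.eval τ = T)
    (hInv : ∀ j τ v, Inv j τ → Inv j (τ.update (3, 0) v))
    (hbody : ∀ j τ, j < T → Bounded A B τ → τ (3, 0) = j → AgreeOff mods σ τ → Inv j τ →
      ∃ τ', Runs A B W body τ (w j) s τ' ∧ Bounded A B τ' ∧ τ' (3, 0) = j ∧
        AgreeOff mods σ τ' ∧ Inv (j + 1) τ')
    (h0 : Inv 0 σ) :
    ∃ τ, Runs A B W (.forLoop bound body) σ ((List.range T).flatMap w) (T * (s + 2) + 2) τ ∧
      Bounded A B τ ∧ AgreeOff mods σ τ ∧ Inv T τ := by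
  simp only [Prog.forLoop, Prog.weight] at hW
  have set_counter (e : Expr) (he : (Prog.write 3 (.const 0) e).weight ≤ W) (j v : ℕ) (τ : Store)
      (hv : e.eval τ = v) (hvT : v ≤ T) (hb : Bounded A B τ) (ha : AgreeOff mods σ τ)
      (hi : Inv j τ) :
      Runs A B W (.write 3 (.const 0) e) τ [] 1 (τ.update (3, 0) v) ∧
        Bounded A B (τ.update (3, 0) v) ∧ (τ.update (3, 0) v) (3, 0) = v ∧
        AgreeOff mods σ (τ.update (3, 0) v) ∧ Inv j (τ.update (3, 0) v) :=
    ⟨.write hB hb he rfl hv, hb.update (by norm_num) hA ((size_le_self _).trans (hvT.trans hT)),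
      by rw [Store.update_apply, if_pos ⟨rfl, rfl⟩], ha.update h3 _ _, hInv _ _ _ hi⟩
  have hloop : (Prog.loop (.sub bound (.var 3))
      (.seq body (.write 3 (.const 0) (.add (.var 3) (.const 1))))).weight ≤ W := by
    simp only [Prog.weight]
    omega
  obtain ⟨hstart, hσ'⟩ := set_counter (.const 0) (by simp only [Prog.weight]; omega) 0 0 σ rfl
    T.zero_le hσ (.refl _ _) h0
  have htest (j : ℕ) (τ : Store) (hj : τ (3, 0) = j) (ha : AgreeOff mods σ τ) :
      (Expr.sub bound (.var 3)).eval τ = T - j := by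
    rw [Expr.eval, Expr.eval_var, hbound τ ha, hj]
  obtain ⟨τ, hrun, hb, -, ha, hi⟩ := Runs.loop hB hloop
    (fun j τ => Bounded A B τ ∧ τ (3, 0) = j ∧ AgreeOff mods σ τ ∧ Inv j τ) T (s + 1) w
    (fun j τ h => h.1)
    (fun j τ h hj => (htest j τ h.2.1 h.2.2.1).trans_ne (Nat.sub_ne_zero_of_lt hj))
    (fun τ h => (htest T τ h.2.1 h.2.2.1).trans T.sub_self)
    (fun j τ ⟨hb, hj, ha, hi⟩ hjT => by
      obtain ⟨τ', hr, hb', hj', ha', hi'⟩ := hbody j τ hjT hb hj ha hi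
      obtain ⟨hw, h⟩ := set_counter (.add (.var 3) (.const 1)) (by simp only [Prog.weight]; omega)
        (j + 1) (j + 1) τ' (congrArg (· + 1) hj') hjT hb' ha' hi'
      exact ⟨_, by simpa using hr.seq hw, h⟩) hσ'
  exact ⟨τ, (hstart.seq hrun).mono (by rw [add_assoc s]; omega), hb, ha, hi⟩

end RAM

/-! ### Path consistency by repeated sweeps -/

theorem exists_succ_eq_of_antitone {α : Type*} {Y : ℕ → Finset α} (hY : Antitone Y) :
    ∃ i ≤ (Y 0).card, Y (i + 1) = Y i := by
  by_contra! hne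
  have hcard : ∀ i ≤ (Y 0).card + 1, (Y i).card + i ≤ (Y 0).card := by
    intro i
    induction i with
    | zero => exact fun _ => le_rfl
    | succ i ih =>
      intro hi
      have := ih (by omega)
      have := Finset.card_lt_card ((hY (Nat.le_add_right i 1)).ssubset_of_ne (hne i (by omega)))
      omega
  have := hcard _ le_rfl
  omega

theorem fixed_of_sweeps {α : Type*} {X : ℕ → Finset α} {F : ℕ → Finset α → Finset α} {ρ : ℕ}
    (hX : ∀ j, X (j + 1) = F (j % ρ) (X j)) (hF : ∀ i s, F i s ⊆ s) {T : ℕ}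
    (hT : ((X 0).card + 1) * ρ ≤ T) {r : ℕ} (hr : r < ρ) : F r (X T) = X T := by
  have anti : Antitone X := antitone_nat_of_succ_le fun j => by rw [hX]; exact hF _ _
  obtain ⟨i, hi, hrepeat⟩ := exists_succ_eq_of_antitone (Y := fun i => X (i * ρ))
    fun _ _ h => anti (Nat.mul_le_mul_right ρ h)
  rw [zero_mul] at hi
  have hsweep : ∀ r ≤ ρ, X (i * ρ + r) = X (i * ρ) := fun r hr =>
    le_antisymm (anti (by omega)) (hrepeat.symm.trans_le (anti (by rw [add_mul]; omega)))
  have hfix : ∀ r < ρ, F r (X (i * ρ)) = X (i * ρ) := fun r hr => by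
    have := hX (i * ρ + r)
    rw [add_assoc, hsweep (r + 1) hr, hsweep r hr.le, Nat.mul_add_mod', Nat.mod_eq_of_lt hr] at this
    exact this.symm
  have hconst : ∀ j, X (i * ρ + j) = X (i * ρ) := fun j => by
    induction j with
    | zero => rfl
    | succ j ih => rw [← add_assoc, hX, ih, hfix _ (Nat.mod_lt _ (by omega))]
  have hle : i * ρ ≤ T := (Nat.mul_le_mul_right _ (by omega)).trans hT
  rw [← Nat.add_sub_of_le hle, hconst, hfix r hr]

namespace OddCycle

section code

/-- The number of quadruples `(u, v, a, b)` with `u, v < n` and `a, b < d`. -/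
def pairCount (n d : ℕ) : ℕ := d * (d * (n * n))

/-- The code, below `pairCount n d`, of the pair of the values `a, b < d` for the pair of the
variables `u, v < n`. -/
def pairIdx (n d u v a b : ℕ) : ℕ := a + d * (b + d * (u + n * v))

/-- The first value of a coded pair. -/
def fstVal (d q : ℕ) : ℕ := q % d

/-- The second value of a coded pair. -/
def sndVal (d q : ℕ) : ℕ := q / d % d

/-- The first variable of a coded pair. -/
def fstVar (n d q : ℕ) : ℕ := q / d / d % n

/-- The second variable of a coded pair. -/
def sndVar (n d q : ℕ) : ℕ := q / d / d / n

variable {n d u v a b q : ℕ}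

theorem add_mul_lt {x m y l : ℕ} (hx : x < m) (hy : y < l) : x + m * y < m * l :=
  calc x + m * y < m * (y + 1) := by rw [mul_add]; omega
    _ ≤ m * l := Nat.mul_le_mul_left _ hy

theorem pairIdx_lt (hu : u < n) (hv : v < n) (ha : a < d) (hb : b < d) :
    pairIdx n d u v a b < pairCount n d :=
  add_mul_lt ha (add_mul_lt hb (add_mul_lt hu hv))

theorem fstVal_pairIdx (ha : a < d) : fstVal d (pairIdx n d u v a b) = a := by
  rw [fstVal, pairIdx, Nat.add_mul_mod_self_left, Nat.mod_eq_of_lt ha]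

theorem pairIdx_div (ha : a < d) : pairIdx n d u v a b / d = b + d * (u + n * v) := by
  rw [pairIdx, Nat.add_mul_div_left _ _ (by omega), Nat.div_eq_of_lt ha, zero_add]

theorem sndVal_pairIdx (ha : a < d) (hb : b < d) : sndVal d (pairIdx n d u v a b) = b := by
  rw [sndVal, pairIdx_div ha, Nat.add_mul_mod_self_left, Nat.mod_eq_of_lt hb]

theorem pairIdx_div_div (ha : a < d) (hb : b < d) : pairIdx n d u v a b / d / d = u + n * v := by
  rw [pairIdx_div ha, Nat.add_mul_div_left _ _ (by omega), Nat.div_eq_of_lt hb, zero_add]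

theorem fstVar_pairIdx (hu : u < n) (ha : a < d) (hb : b < d) :
    fstVar n d (pairIdx n d u v a b) = u := by
  rw [fstVar, pairIdx_div_div ha hb, Nat.add_mul_mod_self_left, Nat.mod_eq_of_lt hu]

theorem sndVar_pairIdx (hu : u < n) (ha : a < d) (hb : b < d) :
    sndVar n d (pairIdx n d u v a b) = v := by
  rw [sndVar, pairIdx_div_div ha hb, Nat.add_mul_div_left _ _ (by omega), Nat.div_eq_of_lt hu,
    zero_add]

theorem fstVal_lt (hd : 0 < d) : fstVal d q < d := Nat.mod_lt _ hd

theorem sndVal_lt (hd : 0 < d) : sndVal d q < d := Nat.mod_lt _ hd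

theorem fstVar_lt (hn : 0 < n) : fstVar n d q < n := Nat.mod_lt _ hn

theorem sndVar_lt (hq : q < pairCount n d) : sndVar n d q < n := by
  rw [sndVar, Nat.div_div_eq_div_mul, Nat.div_div_eq_div_mul]
  refine Nat.div_lt_of_lt_mul (hq.trans_eq ?_)
  unfold pairCount
  ring

end code

section sweep

variable {n d : ℕ} {X : Finset ℕ}

/-- The pair of values coded by `q` extends to the variable `w`, within the set `X` of codes. -/
def Supported (n d : ℕ) (X : Finset ℕ) (q w : ℕ) : Prop :=
  ∃ c < d, pairIdx n d (fstVar n d q) w (fstVal d q) c ∈ X ∧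
    pairIdx n d (sndVar n d q) w (sndVal d q) c ∈ X

open Classical in
/-- Step `j` of the path consistency procedure: one code, determined by `j`, is removed if it does
not extend to one variable, likewise determined by `j`. -/
def pcStep (n d j : ℕ) (X : Finset ℕ) : Finset ℕ :=
  X.filter fun q => q = j % pairCount n d → Supported n d X q (j / pairCount n d % n)

/-- The set of codes left after `j` steps of the path consistency procedure. -/
def pcSeq (n d : ℕ) (X : Finset ℕ) : ℕ → Finset ℕ
  | 0 => X
  | j + 1 => pcStep n d j (pcSeq n d X j)

/-- A number of steps that ensures path consistency: a sweep over all codes and variables takes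
`pairCount n d * n` steps, and every sweep but the last removes at least one code. -/
def pcTime (n d : ℕ) : ℕ := (pairCount n d + 1) * (pairCount n d * n)

theorem pcStep_subset (n d j : ℕ) (X : Finset ℕ) : pcStep n d j X ⊆ X := by
  classical
  exact Finset.filter_subset _ _

theorem mem_pcStep_iff {j q : ℕ} : q ∈ pcStep n d j X ↔
    q ∈ X ∧ (q = j % pairCount n d → Supported n d X q (j / pairCount n d % n)) := by
  classical
  exact Finset.mem_filter

theorem pcStep_mod (n d j : ℕ) (X : Finset ℕ) :
    pcStep n d (j % (pairCount n d * n)) X = pcStep n d j X := by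
  unfold pcStep
  rw [Nat.mod_mul_right_mod, Nat.mod_mul_right_div_self, Nat.mod_mod]

theorem pcSeq_subset (n d : ℕ) (X : Finset ℕ) (j : ℕ) : pcSeq n d X j ⊆ X := by
  induction j with
  | zero => exact subset_rfl
  | succ j ih => exact (pcStep_subset _ _ _ _).trans ih

theorem supported_pcSeq (hX : X ⊆ Finset.range (pairCount n d)) {q w : ℕ}
    (hq : q ∈ pcSeq n d X (pcTime n d)) (hw : w < n) :
    Supported n d (pcSeq n d X (pcTime n d)) q w := by
  have hqX := Finset.mem_range.1 (hX (pcSeq_subset _ _ _ _ hq))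
  have hr : q + pairCount n d * w < pairCount n d * n := add_mul_lt hqX hw
  have hcard : X.card ≤ pairCount n d := (Finset.card_le_card hX).trans_eq (Finset.card_range _)
  have hfix := fixed_of_sweeps (X := pcSeq n d X) (F := pcStep n d)
    (fun j => (pcStep_mod n d j _).symm) (pcStep_subset n d) (T := pcTime n d)
    (Nat.mul_le_mul_right _ (Nat.succ_le_succ hcard)) hr
  rw [← hfix] at hq
  have hsupp := (mem_pcStep_iff.1 hq).2
  rw [Nat.add_mul_mod_self_left, Nat.mod_eq_of_lt hqX, Nat.add_mul_div_left _ _ (by omega),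
    Nat.div_eq_of_lt hqX, zero_add, Nat.mod_eq_of_lt hw] at hsupp
  exact hsupp rfl

end sweep

/-- The list chosen by a random residue modulo `2 * k + 1`: each of the two rare lists corresponds
to one residue. -/
def listOfResidue (x : ℕ) : Fin 3 := if x = 0 then 1 else if x = 1 then 2 else 0

/-- The condition for a pair of values to be allowed initially: both values are in the lists given
by the residues `res`, they agree if the variables do, and they are adjacent on the cycle if the
adjacency matrix `adj` has a nonzero entry for the two variables. -/
def InitAllowed (k n : ℕ) (adj res : ℕ → ℕ) (q : ℕ) : Prop :=
  NatList (listOfResidue (res (fstVar n (2 * k + 1) q))) (fstVal (2 * k + 1) q) ∧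
  NatList (listOfResidue (res (sndVar n (2 * k + 1) q))) (sndVal (2 * k + 1) q) ∧
  (fstVar n (2 * k + 1) q = sndVar n (2 * k + 1) q →
    fstVal (2 * k + 1) q = sndVal (2 * k + 1) q) ∧
  (adj (fstVar n (2 * k + 1) q * n + sndVar n (2 * k + 1) q) ≠ 0 →
    NatAdj k (fstVal (2 * k + 1) q) (sndVal (2 * k + 1) q))

open Classical in
/-- The codes of the pairs of values that are allowed initially. -/
def initPairs (k n : ℕ) (adj res : ℕ → ℕ) : Finset ℕ :=
  (Finset.range (pairCount n (2 * k + 1))).filter (InitAllowed k n adj res)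

theorem initPairs_subset (k n : ℕ) (adj res : ℕ → ℕ) :
    initPairs k n adj res ⊆ Finset.range (pairCount n (2 * k + 1)) := by
  classical
  exact Finset.filter_subset _ _

section correctness

variable {k n : ℕ} {G : SimpleGraph (Fin n)} {adj res : ℕ → ℕ}

theorem mem_initPairs {q : ℕ} : q ∈ initPairs k n adj res ↔
    q < pairCount n (2 * k + 1) ∧ InitAllowed k n adj res q := by
  classical
  rw [initPairs, Finset.mem_filter, Finset.mem_range]

theorem pairIdx_mem_initPairs (hk : 1 ≤ k) (hadj : ∀ u v : Fin n, adj (u * n + v) ≠ 0 ↔ G.Adj u v)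
    (u v : Fin n) (a b : Fin (2 * k + 1)) :
    pairIdx n (2 * k + 1) u v a b ∈ initPairs k n adj res ↔
      Allowed k G (fun v => listOfResidue (res v)) u v a b ∧ (u = v → a = b) := by
  have := pairIdx_lt u.2 v.2 a.2 b.2
  rw [mem_initPairs, InitAllowed, fstVal_pairIdx a.2, sndVal_pairIdx a.2 b.2,
    fstVar_pairIdx u.2 a.2 b.2, sndVar_pairIdx u.2 a.2 b.2, hadj, Allowed, mem_listSet_iff,
    mem_listSet_iff, cycle_adj_iff hk, Fin.val_inj, Fin.val_inj]
  tauto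

theorem pathConsistent_pcSeq (hk : 1 ≤ k)
    (hadj : ∀ u v : Fin n, adj (u * n + v) ≠ 0 ↔ G.Adj u v) :
    PathConsistent fun (u v : Fin n) (a b : Fin (2 * k + 1)) =>
      pairIdx n (2 * k + 1) u v a b ∈
        pcSeq n (2 * k + 1) (initPairs k n adj res) (pcTime n (2 * k + 1)) where
  diag u a b h := ((pairIdx_mem_initPairs hk hadj u u a b).1 (pcSeq_subset _ _ _ _ h)).2 rfl
  extend u v a b h w := by
    obtain ⟨c, hc, h₁, h₂⟩ := supported_pcSeq (initPairs_subset _ _ _ _) h w.2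
    rw [fstVal_pairIdx a.2, fstVar_pairIdx u.2 a.2 b.2] at h₁
    rw [sndVal_pairIdx a.2 b.2, sndVar_pairIdx u.2 a.2 b.2] at h₂
    exact ⟨⟨c, hc⟩, h₁, h₂⟩

theorem pairIdx_mem_pcSeq (hk : 1 ≤ k) (hadj : ∀ u v : Fin n, adj (u * n + v) ≠ 0 ↔ G.Adj u v)
    (g : G →g cycle k) (hg : ∀ v : Fin n, g v ∈ listSet k (listOfResidue (res v))) (j : ℕ)
    (u v : Fin n) :
    pairIdx n (2 * k + 1) u v (g u) (g v) ∈ pcSeq n (2 * k + 1) (initPairs k n adj res) j := by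
  induction j generalizing u v with
  | zero =>
    exact (pairIdx_mem_initPairs hk hadj u v (g u) (g v)).2
      ⟨⟨hg u, hg v, fun h => g.map_adj h⟩, fun h => h ▸ rfl⟩
  | succ j ih =>
    refine mem_pcStep_iff.2 ⟨ih u v, fun _ => ?_⟩
    have hw : j / pairCount n (2 * k + 1) % n < n := Nat.mod_lt _ (by have := u.2; omega)
    refine ⟨g ⟨_, hw⟩, (g ⟨_, hw⟩).2, ?_, ?_⟩
    · rw [fstVal_pairIdx (g u).2, fstVar_pairIdx u.2 (g u).2 (g v).2]
      exact ih u ⟨_, hw⟩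
    · rw [sndVal_pairIdx (g u).2 (g v).2, sndVar_pairIdx u.2 (g u).2 (g v).2]
      exact ih v ⟨_, hw⟩

theorem exists_pairIdx_mem_pcSeq_iff (hk : 1 ≤ k)
    (hadj : ∀ u v : Fin n, adj (u * n + v) ≠ 0 ↔ G.Adj u v) :
    (n = 0 ∨ ∃ a < 2 * k + 1, pairIdx n (2 * k + 1) 0 0 a a ∈
      pcSeq n (2 * k + 1) (initPairs k n adj res) (pcTime n (2 * k + 1))) ↔
    HasListHom k G (fun v => listOfResidue (res v)) := by
  rcases Nat.eq_zero_or_pos n with rfl | hn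
  · simp only [true_or, true_iff]
    exact ⟨⟨fun v => v.elim0, fun {u} => u.elim0⟩, fun v => v.elim0⟩
  · simp only [hn.ne', false_or]
    constructor
    · rintro ⟨a, ha, h⟩
      have hP := pathConsistent_pcSeq (res := res) hk hadj
      refine hasListHom_of_pathConsistent hk hP (fun v => ?_)
        (fun u v a b h => ((pairIdx_mem_initPairs hk hadj u v a b).1 (pcSeq_subset _ _ _ _ h)).1)
      obtain ⟨c, h₁, -⟩ := hP.extend ⟨0, hn⟩ ⟨0, hn⟩ ⟨a, ha⟩ ⟨a, ha⟩ h v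
      exact ⟨c, hP.self_right h₁⟩
    · rintro ⟨g, hg⟩
      exact ⟨g ⟨0, hn⟩, (g ⟨0, hn⟩).2, pairIdx_mem_pcSeq hk hadj g hg _ ⟨0, hn⟩ ⟨0, hn⟩⟩

end correctness

end OddCycle

/-! ### The program -/

namespace OddCycle

open RAM

/-- The number of coin flips for the list of one vertex. -/
def flipCount (k n : ℕ) : ℕ := n + (2 * k + 2)

/-- The residue modulo `d` of the binary number formed by the first `b` bits. -/
def residue (d : ℕ) (bits : ℕ → Bool) : ℕ → ℕ
  | 0 => 0
  | b + 1 => (2 * residue d bits b + (bits b).toNat) % d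

theorem residue_lt {d : ℕ} (hd : 0 < d) (bits : ℕ → Bool) (b : ℕ) : residue d bits b < d := by
  cases b with
  | zero => exact hd
  | succ b => exact Nat.mod_lt _ hd

/-- Conditions under which addresses below `A` and bit lengths up to `B` suffice for one trial. -/
structure Fits (k n A B : ℕ) : Prop where
  pos : 0 < A
  vertex : n ≤ A
  pair : pairCount n (2 * k + 1) ≤ A
  one_le : 1 ≤ B
  base : 2 * k + 1 ≤ B
  flips : n * flipCount k n ≤ B
  pair' : pairCount n (2 * k + 1) ≤ B
  time : pcTime n (2 * k + 1) ≤ B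

/-
Use of the arrays: cell `0` of the arrays `0, 2, 3, 4, 7` holds the number of vertices, the answer,
the loop counter, the number of remaining trials, and the last coin flip; cell `0` of the arrays `5`
and `6` holds the powers from which the number of trials is computed. Array `1` is the adjacency
matrix, array `8` holds the residues that determine the lists, and array `9` is the indicator
function of a set of codes of pairs.
-/

section sample

variable {k n A B W r j : ℕ} {bits : ℕ → Bool}

/-- The number of coin flips for the list of one vertex, as an expression. -/
def flipE (k : ℕ) : Expr := .add (.var 0) (.const (2 * k + 2))

/-- The residue of the current vertex after the latest coin flip. -/
def drawE (k : ℕ) : Expr :=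
  .mod (.add (.mul (.mul (.const 2) (.read 8 (.div (.var 3) (flipE k))))
    (.sign (.mod (.var 3) (flipE k)))) (.var 7)) (.const (2 * k + 1))

/-- The random choice of the lists. -/
def sampleProg (k : ℕ) : Prog :=
  .forLoop (.mul (.var 0) (flipE k))
    (.seq (.flip 7) (.write 8 (.div (.var 3) (flipE k)) (drawE k)))

/-- The residues in array `8` after `j` coin flips, if there are `r` of them for each vertex. -/
structure Sampled (d r : ℕ) (bits : ℕ → Bool) (j : ℕ) (σ : Store) : Prop where
  done : ∀ v < j / r, σ (8, v) = residue d (fun b => bits (v * r + b)) r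
  current : j % r ≠ 0 → σ (8, j / r) = residue d (fun b => bits (j / r * r + b)) (j % r)

theorem eval_flipE (σ : Store) : (flipE k).eval σ = flipCount k (σ (0, 0)) := rfl

theorem eval_drawE {σ : Store} (hn : σ (0, 0) = n)
    (h : Sampled (2 * k + 1) (flipCount k n) bits (σ (3, 0)) σ)
    (h7 : σ (7, 0) = (bits (σ (3, 0))).toNat) :
    (drawE k).eval σ = residue (2 * k + 1)
      (fun b => bits (σ (3, 0) / flipCount k n * flipCount k n + b))
      (σ (3, 0) % flipCount k n + 1) := by
  simp only [drawE, Expr.eval_mod, Expr.eval, Expr.eval_var, Expr.eval_sign, eval_flipE, hn, h7,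
    residue, Nat.div_add_mod']
  split_ifs with h0
  · simp [h0, residue]
  · rw [mul_one, h.current h0]

theorem Sampled.succ {d : ℕ} {σ τ : Store} (hr : 0 < r) (h : Sampled d r bits j σ)
    (hcur : τ (8, j / r) = residue d (fun b => bits (j / r * r + b)) (j % r + 1))
    (hne : ∀ v ≠ j / r, τ (8, v) = σ (8, v)) : Sampled d r bits (j + 1) τ := by
  have hlt : j % r < r := Nat.mod_lt _ hr
  have hj : j + 1 = j % r + 1 + j / r * r := by rw [add_right_comm, Nat.mod_add_div']
  rcases (show j % r + 1 ≤ r from hlt).eq_or_lt with hlast | hnot_last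
  · have hdiv : (j + 1) / r = j / r + 1 := by
      rw [hj, hlast, Nat.add_mul_div_right _ _ hr, Nat.div_self hr, add_comm]
    refine ⟨fun v hv => ?_, fun hmod => absurd ?_ hmod⟩
    · rcases eq_or_ne v (j / r) with rfl | hvj
      · rw [hcur, hlast]
      · rw [hne v hvj, h.done v (by omega)]
    · rw [hj, hlast, Nat.add_mul_mod_self_right, Nat.mod_self]
  · have hdiv : (j + 1) / r = j / r := by
      rw [hj, Nat.add_mul_div_right _ _ hr, Nat.div_eq_of_lt hnot_last, zero_add]
    have hmod : (j + 1) % r = j % r + 1 := by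
      rw [hj, Nat.add_mul_mod_self_right, Nat.mod_eq_of_lt hnot_last]
    refine ⟨fun v hv => ?_, fun _ => ?_⟩
    · rw [hdiv] at hv
      rw [hne v hv.ne, h.done v hv]
    · rw [hdiv, hmod, hcur]

theorem runs_sample_step (hf : Fits k n A B)
    (hW : (Prog.seq (.flip 7) (.write 8 (.div (.var 3) (flipE k)) (drawE k))).weight ≤ W)
    {τ : Store} (hτ : Bounded A B τ) (hn : τ (0, 0) = n) (h3 : τ (3, 0) = j)
    (hj : j < n * flipCount k n) (h : Sampled (2 * k + 1) (flipCount k n) bits j τ) :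
    ∃ τ', Runs A B W (.seq (.flip 7) (.write 8 (.div (.var 3) (flipE k)) (drawE k))) τ [bits j] 2
        τ' ∧ Bounded A B τ' ∧ AgreeOff [7, 8] τ τ' ∧
      Sampled (2 * k + 1) (flipCount k n) bits (j + 1) τ' := by
  simp only [Prog.weight] at hW
  have hr : 0 < flipCount k n := by unfold flipCount; omega
  set τ₁ := τ.update (7, 0) (bits j).toNat with hτ₁
  have hb₁ : Bounded A B τ₁ := hτ.update (by norm_num) hf.pos
    ((size_le_self _).trans ((Bool.toNat_le _).trans hf.one_le))
  have hn₁ : τ₁ (0, 0) = n := by simp [hτ₁, Store.update_apply, hn]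
  have h3₁ : τ₁ (3, 0) = j := by simp [hτ₁, Store.update_apply, h3]
  have h7₁ : τ₁ (7, 0) = (bits j).toNat := by simp [hτ₁, Store.update_apply]
  have h8₁ (v : ℕ) : τ₁ (8, v) = τ (8, v) := by simp [hτ₁, Store.update_apply]
  have hS₁ : Sampled (2 * k + 1) (flipCount k n) bits j τ₁ :=
    ⟨fun v hv => (h8₁ v).trans (h.done v hv), fun hj => (h8₁ _).trans (h.current hj)⟩
  have haddr : (Expr.div (.var 3) (flipE k)).eval τ₁ = j / flipCount k n := by
    rw [Expr.eval, Expr.eval_var, eval_flipE, hn₁, h3₁]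
  have hdraw := eval_drawE hn₁ (h3₁.symm ▸ hS₁) (h3₁.symm ▸ h7₁)
  rw [h3₁] at hdraw
  refine ⟨_, (Runs.flip (bits j) hf.one_le hτ (by simp only [Prog.weight]; omega)).seq
    (Runs.write hf.one_le hb₁ (by simp only [Prog.weight]; omega) haddr hdraw), ?_,
    ((AgreeOff.refl _ _).update (by simp) _ _).update (by simp) _ _,
    h.succ hr (by simp [Store.update_apply]) fun v hv => ?_⟩
  · exact hb₁.update (by norm_num) ((Nat.div_lt_of_lt_mul (by rwa [mul_comm])).trans_le hf.vertex)
      ((size_le_self _).trans ((residue_lt (by omega) _ _).le.trans hf.base))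
  · simp [Store.update_apply, hv]

theorem runs_sampleProg (hf : Fits k n A B) (hW : (sampleProg k).weight ≤ W) {σ : Store}
    (hσ : Bounded A B σ) (hn : σ (0, 0) = n) (bits : ℕ → Bool) :
    ∃ τ, Runs A B W (sampleProg k) σ ((List.range (n * flipCount k n)).map bits)
        (n * flipCount k n * 4 + 2) τ ∧ Bounded A B τ ∧ AgreeOff [3, 7, 8] σ τ ∧
      ∀ v < n, τ (8, v) = residue (2 * k + 1) (fun b => bits (v * flipCount k n + b))
        (flipCount k n) := by
  have hr : 0 < flipCount k n := by unfold flipCount; omega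
  have hW' := hW
  simp only [sampleProg, Prog.forLoop, Prog.weight] at hW'
  obtain ⟨τ, hrun, hb, ha, hS⟩ := Runs.forLoop hf.pos hf.one_le hW (mods := [3, 7, 8]) (by simp) hσ
    (Sampled (2 * k + 1) (flipCount k n) bits) (n * flipCount k n) 2 (fun j => [bits j]) hf.flips
    (fun τ hτ => by
      rw [Expr.eval, Expr.eval_var, eval_flipE, hτ 0 0 (by simp), hn])
    (fun j τ v h => ⟨fun u hu => by simpa [Store.update_apply] using h.done u hu,
      fun hj => by simpa [Store.update_apply] using h.current hj⟩)
    (fun j τ hj hb h3 ha hS => by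
      obtain ⟨τ', hrun, hb', ha', hS'⟩ := runs_sample_step (W := W) hf
        (by simp only [Prog.weight]; omega) hb ((ha 0 0 (by simp)).trans hn) h3 hj hS
      exact ⟨τ', hrun, hb', (ha' 3 0 (by simp)).trans h3, ha.trans (ha'.mono (by simp)), hS'⟩)
    ⟨by simp, by simp⟩
  rw [← List.map_eq_flatMap] at hrun
  exact ⟨τ, hrun, hb, ha, fun v hv => hS.done v (by rwa [Nat.mul_div_cancel _ hr])⟩

end sample

section code

variable {k n A B W : ℕ} {σ : Store} {X : Finset ℕ}

/-- The first value of the pair of values coded by `x`. -/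
def fstValE (k : ℕ) (x : Expr) : Expr := .mod x (.const (2 * k + 1))

/-- The second value of the pair of values coded by `x`. -/
def sndValE (k : ℕ) (x : Expr) : Expr := .mod (.div x (.const (2 * k + 1))) (.const (2 * k + 1))

/-- The first variable of the pair of values coded by `x`. -/
def fstVarE (k : ℕ) (x : Expr) : Expr :=
  .mod (.div (.div x (.const (2 * k + 1))) (.const (2 * k + 1))) (.var 0)

/-- The second variable of the pair of values coded by `x`. -/
def sndVarE (k : ℕ) (x : Expr) : Expr :=
  .div (.div (.div x (.const (2 * k + 1))) (.const (2 * k + 1))) (.var 0)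

/-- The number of codes of pairs. -/
def countE (k : ℕ) : Expr :=
  .mul (.const (2 * k + 1)) (.mul (.const (2 * k + 1)) (.mul (.var 0) (.var 0)))

/-- The code of a pair of values. -/
def idxE (k : ℕ) (u v a b : Expr) : Expr :=
  .add a (.mul (.const (2 * k + 1)) (.add b (.mul (.const (2 * k + 1)) (.add u (.mul (.var 0) v)))))

theorem eval_fstValE (x : Expr) : (fstValE k x).eval σ = fstVal (2 * k + 1) (x.eval σ) :=
  Expr.eval_mod _ _ _

theorem eval_sndValE (x : Expr) : (sndValE k x).eval σ = sndVal (2 * k + 1) (x.eval σ) :=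
  Expr.eval_mod _ _ _

theorem eval_fstVarE (x : Expr) :
    (fstVarE k x).eval σ = fstVar (σ (0, 0)) (2 * k + 1) (x.eval σ) :=
  Expr.eval_mod _ _ _

theorem eval_sndVarE (x : Expr) :
    (sndVarE k x).eval σ = sndVar (σ (0, 0)) (2 * k + 1) (x.eval σ) := rfl

theorem eval_countE : (countE k).eval σ = pairCount (σ (0, 0)) (2 * k + 1) := rfl

theorem eval_idxE (u v a b : Expr) : (idxE k u v a b).eval σ =
    pairIdx (σ (0, 0)) (2 * k + 1) (u.eval σ) (v.eval σ) (a.eval σ) (b.eval σ) := rfl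

theorem pos_of_lt_pairCount {d q : ℕ} (hq : q < pairCount n d) : 0 < n :=
  Nat.pos_of_ne_zero fun h => by simp [pairCount, h] at hq

/-- Array `9` is the indicator function of the set `X` of codes. -/
def StoresPairs (k n : ℕ) (X : Finset ℕ) (σ : Store) : Prop :=
  ∀ q < pairCount n (2 * k + 1), σ (9, q) = if q ∈ X then 1 else 0

section initialPairs

open Classical in
/-- Membership in the list of a residue as a table. -/
def memTable (x a : ℕ) : ℕ := if NatList (listOfResidue x) a then 1 else 0

open Classical in
/-- Adjacency as a table. -/
def adjTable (k a b : ℕ) : ℕ := if NatAdj k a b then 1 else 0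

/-- The initial value of the entry whose number is the loop counter. -/
def initE (k : ℕ) : Expr :=
  let u := fstVarE k (.var 3)
  let v := sndVarE k (.var 3)
  let a := fstValE k (.var 3)
  let b := sndValE k (.var 3)
  .mul (.mul (.table (2 * k + 1) memTable (.read 8 u) a)
      (.table (2 * k + 1) memTable (.read 8 v) b))
    (.mul (.imp (.eq u v) (.eq a b))
      (.imp (.read 1 (.add (.mul u (.var 0)) v)) (.table (2 * k + 1) (adjTable k) a b)))

/-- The initialization of the pairs of values. -/
def initProg (k : ℕ) : Prog := .forLoop (countE k) (.write 9 (.var 3) (initE k))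

open Classical in
theorem eval_initE (hn : σ (0, 0) = n) (hq : σ (3, 0) < pairCount n (2 * k + 1))
    (hres : ∀ v < n, σ (8, v) < 2 * k + 1) :
    (initE k).eval σ =
      if InitAllowed k n (fun x => σ (1, x)) (fun v => σ (8, v)) (σ (3, 0)) then 1 else 0 := by
  have hn0 := pos_of_lt_pairCount hq
  have hd : 0 < 2 * k + 1 := by omega
  have ha : (fstValE k (.var 3)).eval σ < 2 * k + 1 :=
    (eval_fstValE _).trans_lt (fstVal_lt hd)
  have hb : (sndValE k (.var 3)).eval σ < 2 * k + 1 :=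
    (eval_sndValE _).trans_lt (sndVal_lt hd)
  have hu : (Expr.read 8 (fstVarE k (.var 3))).eval σ < 2 * k + 1 := by
    rw [Expr.eval, eval_fstVarE, hn]
    exact hres _ (fstVar_lt hn0)
  have hv : (Expr.read 8 (sndVarE k (.var 3))).eval σ < 2 * k + 1 := by
    rw [Expr.eval, eval_sndVarE, hn]
    exact hres _ (sndVar_lt hq)
  simp only [initE, Expr.eval, Expr.eval_table _ _ hu ha, Expr.eval_table _ _ hv hb,
    Expr.eval_table _ _ ha hb, Expr.eval_imp, Expr.eval_eq, eval_fstVarE, eval_sndVarE,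
    eval_fstValE, eval_sndValE, Expr.eval_var, hn, memTable, adjTable, InitAllowed]
  simp only [ne_eq, ite_eq_right_iff, one_ne_zero, imp_false, not_not]
  split_ifs <;> simp_all

theorem runs_initProg (hf : Fits k n A B) (hW : (initProg k).weight ≤ W)
    (hσ : Bounded A B σ) (hn : σ (0, 0) = n) (hres : ∀ v < n, σ (8, v) < 2 * k + 1) :
    ∃ τ, Runs A B W (initProg k) σ [] (pairCount n (2 * k + 1) * 3 + 2) τ ∧ Bounded A B τ ∧
      AgreeOff [3, 9] σ τ ∧
      StoresPairs k n (initPairs k n (fun x => σ (1, x)) fun v => σ (8, v)) τ := by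
  classical
  have hW' := hW
  simp only [initProg, Prog.forLoop, Prog.weight] at hW'
  obtain ⟨τ, hrun, hb, ha, hτ⟩ := Runs.forLoop hf.pos hf.one_le hW (mods := [3, 9]) (by simp) hσ
    (fun j τ => ∀ q < j, τ (9, q) =
      if InitAllowed k n (fun x => σ (1, x)) (fun v => σ (8, v)) q then 1 else 0)
    (pairCount n (2 * k + 1)) 1 (fun _ => []) hf.pair'
    (fun τ hτ => by rw [eval_countE, hτ 0 0 (by simp), hn])
    (fun j τ v h q => by simpa [Store.update_apply] using h q)
    (fun j τ hj hb h3 ha hτ => by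
      have h1 (x : ℕ) : τ (1, x) = σ (1, x) := ha 1 x (by simp)
      have h8 (v : ℕ) : τ (8, v) = σ (8, v) := ha 8 v (by simp)
      have heval := eval_initE ((ha 0 0 (by simp)).trans hn) (h3.trans_lt hj)
        fun v hv => (h8 v).trans_lt (hres v hv)
      simp only [h1, h8, h3] at heval
      refine ⟨_, .write hf.one_le hb (by simp only [Prog.weight]; omega) h3 heval,
        hb.update (by norm_num) (hj.trans_le hf.pair) ((size_le_self _).trans ?_),
        by simpa [Store.update_apply] using h3, ha.update (by simp) _ _, fun q hq => ?_⟩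
      · exact le_trans (by split_ifs <;> simp) hf.one_le
      · rw [Store.update_apply]
        rcases Nat.lt_succ_iff_lt_or_eq.1 hq with hq | rfl
        · rw [if_neg (by omega), hτ q hq]
        · rw [if_pos ⟨rfl, rfl⟩])
    (fun q hq => absurd hq q.not_lt_zero)
  rw [List.flatMap_eq_nil_iff.2 fun _ _ => rfl] at hrun
  refine ⟨τ, hrun, hb, ha, fun q hq => ?_⟩
  simp only [hτ q hq, mem_initPairs, hq, true_and]

end initialPairs

section sweeps

/-- The code of the pair treated in the current step of the path consistency procedure. -/
def curE (k : ℕ) : Expr := .mod (.var 3) (countE k)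

/-- The third variable in the current step of the path consistency procedure. -/
def thirdE (k : ℕ) : Expr := .mod (.div (.var 3) (countE k)) (.var 0)

/-- The number of values of the third variable to which the current pair extends. -/
def supportE (k : ℕ) : Expr :=
  .sum (2 * k + 1) fun c =>
    .mul (.read 9 (idxE k (fstVarE k (curE k)) (thirdE k) (fstValE k (curE k)) (.const c)))
      (.read 9 (idxE k (sndVarE k (curE k)) (thirdE k) (sndValE k (curE k)) (.const c)))

/-- The new value of the current entry. -/
def pcE (k : ℕ) : Expr := .mul (.read 9 (curE k)) (.sign (supportE k))

/-- The path consistency procedure. -/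
def pcProg (k : ℕ) : Prog :=
  .forLoop (.mul (.add (countE k) (.const 1)) (.mul (countE k) (.var 0)))
    (.write 9 (curE k) (pcE k))

theorem eval_curE (hn : σ (0, 0) = n) : (curE k).eval σ = σ (3, 0) % pairCount n (2 * k + 1) := by
  rw [curE, Expr.eval_mod, eval_countE, Expr.eval_var, hn]

theorem eval_thirdE (hn : σ (0, 0) = n) :
    (thirdE k).eval σ = σ (3, 0) / pairCount n (2 * k + 1) % n := by
  rw [thirdE, Expr.eval_mod, Expr.eval, eval_countE, Expr.eval_var, Expr.eval_var, hn]

theorem eval_supportE_eq_zero_iff (hn : σ (0, 0) = n) (hX : StoresPairs k n X σ)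
    (hQ : 0 < pairCount n (2 * k + 1)) :
    (supportE k).eval σ = 0 ↔
      ¬ Supported n (2 * k + 1) X (σ (3, 0) % pairCount n (2 * k + 1))
        (σ (3, 0) / pairCount n (2 * k + 1) % n) := by
  have hn0 := pos_of_lt_pairCount hQ
  have hd : 0 < 2 * k + 1 := by omega
  have hw : σ (3, 0) / pairCount n (2 * k + 1) % n < n := Nat.mod_lt _ hn0
  simp only [supportE, Expr.eval_sum, Expr.eval, eval_idxE, eval_fstVarE, eval_sndVarE,
    eval_fstValE, eval_sndValE, eval_curE hn, eval_thirdE hn, hn, Finset.sum_eq_zero_iff,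
    Finset.mem_range, Supported, not_exists, not_and, mul_eq_zero]
  refine forall₂_congr fun c hc => ?_
  rw [hX _ (pairIdx_lt (fstVar_lt hn0) hw (fstVal_lt hd) hc),
    hX _ (pairIdx_lt (sndVar_lt (Nat.mod_lt _ hQ)) hw (sndVal_lt hd) hc)]
  simp only [ite_eq_right_iff, one_ne_zero, imp_false, imp_iff_not_or]

theorem eval_pcE (hn : σ (0, 0) = n) (hX : StoresPairs k n X σ)
    (hQ : 0 < pairCount n (2 * k + 1)) :
    (pcE k).eval σ =
      if σ (3, 0) % pairCount n (2 * k + 1) ∈ pcStep n (2 * k + 1) (σ (3, 0)) X then 1 else 0 := by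
  classical
  rw [pcE, Expr.eval, Expr.eval, Expr.eval_sign, eval_curE hn, hX _ (Nat.mod_lt _ hQ),
    if_congr (eval_supportE_eq_zero_iff hn hX hQ) rfl rfl, if_congr mem_pcStep_iff rfl rfl]
  split_ifs <;> simp_all

theorem StoresPairs.write_pcStep {j : ℕ} (hX : StoresPairs k n X σ) :
    StoresPairs k n (pcStep n (2 * k + 1) j X) (σ.update (9, j % pairCount n (2 * k + 1))
      (if j % pairCount n (2 * k + 1) ∈ pcStep n (2 * k + 1) j X then 1 else 0)) := by
  intro q hq
  rw [Store.update_apply]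
  rcases eq_or_ne q (j % pairCount n (2 * k + 1)) with rfl | hne
  · rw [if_pos ⟨rfl, rfl⟩]
  · rw [if_neg fun h => hne h.2, hX q hq]
    simp only [mem_pcStep_iff, hne, false_imp_iff, and_true]

theorem runs_pcProg (hf : Fits k n A B) (hW : (pcProg k).weight ≤ W)
    (hσ : Bounded A B σ) (hn : σ (0, 0) = n) (hX : StoresPairs k n X σ) :
    ∃ τ, Runs A B W (pcProg k) σ [] (pcTime n (2 * k + 1) * 3 + 2) τ ∧ Bounded A B τ ∧
      AgreeOff [3, 9] σ τ ∧
      StoresPairs k n (pcSeq n (2 * k + 1) X (pcTime n (2 * k + 1))) τ := by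
  have hW' := hW
  simp only [pcProg, Prog.forLoop, Prog.weight] at hW'
  obtain ⟨τ, hrun, h⟩ := Runs.forLoop hf.pos hf.one_le hW (mods := [3, 9]) (by simp) hσ
    (fun j => StoresPairs k n (pcSeq n (2 * k + 1) X j))
    (pcTime n (2 * k + 1)) 1 (fun _ => []) hf.time
    (fun τ hτ => by
      simp only [Expr.eval, eval_countE, Expr.eval_var, (hτ 0 0 (by simp)).trans hn, pcTime])
    (fun j τ v h q => by simpa [Store.update_apply] using h q)
    (fun j τ hj hb h3 ha hτ => by
      have h0 : τ (0, 0) = n := (ha 0 0 (by simp)).trans hn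
      have hQ : 0 < pairCount n (2 * k + 1) :=
        Nat.pos_of_ne_zero fun h => by simp [pcTime, h] at hj
      have hcur := eval_curE (k := k) h0
      have heval := eval_pcE h0 hτ hQ
      rw [h3] at hcur heval
      exact ⟨_, .write hf.one_le hb (by simp only [Prog.weight]; omega) hcur heval,
        hb.update (by norm_num) ((Nat.mod_lt _ hQ).trans_le hf.pair)
          ((size_le_self _).trans (le_trans (by split_ifs <;> simp) hf.one_le)),
        by simpa [Store.update_apply] using h3, ha.update (by simp) _ _, hτ.write_pcStep⟩)
    hX
  rw [List.flatMap_eq_nil_iff.2 fun _ _ => rfl] at hrun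
  exact ⟨τ, hrun, h⟩

end sweeps

/-- The new value of the answer: `1` if it was nonzero, if there are no vertices, or if some pair of
equal values for vertex `0` is left. -/
def answerE (k : ℕ) : Expr :=
  .sign (.add (.add (.var 2) (.sub (.const 1) (.var 0)))
    (.sum (2 * k + 1) fun a =>
      .read 9 (idxE k (.const 0) (.const 0) (.const a) (.const a))))

theorem eval_answerE (hn : σ (0, 0) = n) (hX : StoresPairs k n X σ) :
    (answerE k).eval σ = if σ (2, 0) ≠ 0 ∨
      (n = 0 ∨ ∃ a < 2 * k + 1, pairIdx n (2 * k + 1) 0 0 a a ∈ X) then 1 else 0 := by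
  have hsum : 0 < n → ((∑ a ∈ Finset.range (2 * k + 1), σ (9, pairIdx n (2 * k + 1) 0 0 a a)) = 0 ↔
      ¬ ∃ a < 2 * k + 1, pairIdx n (2 * k + 1) 0 0 a a ∈ X) := fun hn0 => by
    simp only [Finset.sum_eq_zero_iff, Finset.mem_range, not_exists, not_and]
    refine forall₂_congr fun a ha => ?_
    simp only [hX _ (pairIdx_lt hn0 hn0 ha ha), ite_eq_right_iff, one_ne_zero, imp_false]
  simp only [answerE, Expr.eval_sign, Expr.eval, Expr.eval_sum, Expr.eval_var, eval_idxE, hn,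
    Nat.add_eq_zero_iff]
  rcases Nat.eq_zero_or_pos n with rfl | hn0
  · simp
  · have hsub : 1 - n = 0 := by omega
    rw [← ite_not]
    refine if_congr ?_ rfl rfl
    rw [hsum hn0, not_and_or, not_and_or, not_not]
    simp [hsub, hn0.ne']

end code

section trials

variable {k n A B W : ℕ} {G : SimpleGraph (Fin n)} {σ : Store}

/-- The solution of the list homomorphism problem: the answer becomes `1` if there is a list
homomorphism. -/
def searchProg (k : ℕ) : Prog :=
  .seq (initProg k) (.seq (pcProg k) (.write 2 (.const 0) (answerE k)))

/-- One trial: lists are drawn, and the list homomorphism problem is solved. -/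
def trialProg (k : ℕ) : Prog :=
  .seq (.write 4 (.const 0) (.sub (.var 4) (.const 1))) (.seq (sampleProg k) (searchProg k))

/-- All trials. -/
def trialsProg (k : ℕ) : Prog := .loop (.var 4) (trialProg k)

/-- The number of steps of a trial. -/
def trialSteps (k n : ℕ) : ℕ :=
  n * flipCount k n * 4 + pairCount n (2 * k + 1) * 3 + pcTime n (2 * k + 1) * 3 + 8

/-- The lists drawn in a trial. -/
def drawnList (k n : ℕ) (bits : ℕ → Bool) (v : ℕ) : Fin 3 :=
  listOfResidue (residue (2 * k + 1) (fun b => bits (v * flipCount k n + b)) (flipCount k n))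

open Classical in
theorem runs_searchProg (hk : 1 ≤ k) (hf : Fits k n A B) (hW : (searchProg k).weight ≤ W)
    (hσ : Bounded A B σ) (hn : σ (0, 0) = n) (hres : ∀ v < n, σ (8, v) < 2 * k + 1)
    (hadj : ∀ u v : Fin n, σ (1, u * n + v) ≠ 0 ↔ G.Adj u v) :
    ∃ τ, Runs A B W (searchProg k) σ []
        (pairCount n (2 * k + 1) * 3 + pcTime n (2 * k + 1) * 3 + 5) τ ∧
      Bounded A B τ ∧ AgreeOff [2, 3, 9] σ τ ∧
      τ (2, 0) = if σ (2, 0) ≠ 0 ∨ HasListHom k G (fun v => listOfResidue (σ (8, v)))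
        then 1 else 0 := by
  simp only [searchProg, Prog.weight] at hW
  obtain ⟨σ₁, hr₁, hb₁, ha₁, hX₁⟩ := runs_initProg (W := W) hf (by omega) hσ hn hres
  have hn₁ : σ₁ (0, 0) = n := (ha₁ 0 0 (by simp)).trans hn
  obtain ⟨σ₂, hr₂, hb₂, ha₂, hX₂⟩ := runs_pcProg (W := W) hf (by omega) hb₁ hn₁ hX₁
  have hn₂ : σ₂ (0, 0) = n := (ha₂ 0 0 (by simp)).trans hn₁
  have ha : AgreeOff [3, 9] σ σ₂ := ha₁.trans ha₂
  have hans := (eval_answerE hn₂ hX₂).trans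
    (if_congr (or_congr (by rw [ha 2 0 (by simp)]) (exists_pairIdx_mem_pcSeq_iff hk hadj)) rfl rfl)
  refine ⟨_, ((hr₁.seq (hr₂.seq (.write hf.one_le hb₂ (by simp only [Prog.weight]; omega) rfl
    hans))).mono (by omega)), hb₂.update (by norm_num) hf.pos ((size_le_self _).trans ?_),
    (ha.mono (by simp)).update (by simp) _ _, ?_⟩
  · exact le_trans (by split_ifs <;> simp) hf.one_le
  · simp [Expr.eval, Store.update_apply]

open Classical in
theorem runs_trialProg (hk : 1 ≤ k) (hf : Fits k n A B) (hW : (trialProg k).weight ≤ W)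
    (hσ : Bounded A B σ) (hn : σ (0, 0) = n)
    (hadj : ∀ u v : Fin n, σ (1, u * n + v) ≠ 0 ↔ G.Adj u v) (bits : ℕ → Bool) :
    ∃ τ, Runs A B W (trialProg k) σ ((List.range (n * flipCount k n)).map bits)
        (trialSteps k n) τ ∧ Bounded A B τ ∧ AgreeOff [2, 3, 4, 7, 8, 9] σ τ ∧
      τ (4, 0) = σ (4, 0) - 1 ∧
      τ (2, 0) = if σ (2, 0) ≠ 0 ∨ HasListHom k G (fun v => drawnList k n bits v)
        then 1 else 0 := by
  simp only [trialProg, Prog.weight] at hW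
  have hr₀ := Runs.write (W := W) (a := 4) (i := .const 0) (e := .sub (.var 4) (.const 1))
    hf.one_le hσ (by simp only [Prog.weight]; omega) rfl rfl
  have hb₀ : Bounded A B (σ.update (4, 0) (σ (4, 0) - 1)) :=
    hσ.update (by norm_num) hf.pos ((Nat.size_le_size (Nat.sub_le _ _)).trans (hσ.size _))
  have ha₀ : AgreeOff [4] σ (σ.update (4, 0) (σ (4, 0) - 1)) :=
    (AgreeOff.refl _ _).update (by simp) _ _
  obtain ⟨σ₁, hr₁, hb₁, ha₁, hL⟩ := runs_sampleProg (W := W) hf (by omega) hb₀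
    ((ha₀ 0 0 (by simp)).trans hn) bits
  have ha₀₁ : AgreeOff [3, 4, 7, 8] σ σ₁ := (ha₀.mono (by simp)).trans (ha₁.mono (by simp))
  obtain ⟨τ, hr₂, hb₂, ha₂, hans⟩ := runs_searchProg (W := W) (G := G) hk hf (by omega) hb₁
    ((ha₀₁ 0 0 (by simp)).trans hn) (fun v hv => (hL v hv).trans_lt (residue_lt (by omega) _ _))
    fun u v => by rw [ha₀₁ 1 _ (by simp), hadj]
  have hlists : (fun v : Fin n => listOfResidue (σ₁ (8, v))) =
      fun v : Fin n => drawnList k n bits v :=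
    funext fun v => congrArg listOfResidue (hL v v.2)
  rw [hlists, ha₀₁ 2 0 (by simp)] at hans
  refine ⟨τ, ?_, hb₂, (ha₀₁.mono (by simp)).trans (ha₂.mono (by simp)), ?_, hans⟩
  · have hrun := (hr₀.seq (hr₁.seq hr₂)).mono (s' := trialSteps k n) (by unfold trialSteps; omega)
    rwa [List.nil_append, List.append_nil] at hrun
  · rw [ha₂ 4 0 (by simp), ha₁ 4 0 (by simp)]
    simp [Store.update_apply]

theorem range_flatMap_map (N m : ℕ) (ω : ℕ → Bool) :
    ((List.range N).flatMap fun i => (List.range m).map fun j => ω (i * m + j)) =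
      (List.range (N * m)).map ω := by
  induction N with
  | zero => simp
  | succ N ih =>
    rw [List.range_succ, List.flatMap_append, ih, add_mul, one_mul, List.range_add, List.map_append]
    simp [Function.comp_def]

/-- Trial number `i` finds a list homomorphism, the coin flips being `ω`. -/
def TrialSucceeds (k : ℕ) (G : SimpleGraph (Fin n)) (ω : ℕ → Bool) (i : ℕ) : Prop :=
  HasListHom k G fun v => drawnList k n (fun j => ω (i * (n * flipCount k n) + j)) v

open Classical in
theorem runs_trialsProg (hk : 1 ≤ k) (hf : Fits k n A B) (hW : (trialsProg k).weight ≤ W)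
    (hσ : Bounded A B σ) (hn : σ (0, 0) = n)
    (hadj : ∀ u v : Fin n, σ (1, u * n + v) ≠ 0 ↔ G.Adj u v) (h2 : σ (2, 0) = 0) {N : ℕ}
    (h4 : σ (4, 0) = N) (ω : ℕ → Bool) :
    ∃ τ, Runs A B W (trialsProg k) σ ((List.range (N * (n * flipCount k n))).map ω)
        (N * (trialSteps k n + 1) + 1) τ ∧
      τ (2, 0) = if ∃ i < N, TrialSucceeds k G ω i then 1 else 0 := by
  have hW' := hW
  simp only [trialsProg, Prog.weight] at hW'
  obtain ⟨τ, hrun, -, -, -, h⟩ := Runs.loop hf.one_le hW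
    (fun i τ => Bounded A B τ ∧ AgreeOff [2, 3, 4, 7, 8, 9] σ τ ∧ τ (4, 0) = N - i ∧
      τ (2, 0) = if ∃ i' < i, TrialSucceeds k G ω i' then 1 else 0)
    N (trialSteps k n)
    (fun i => (List.range (n * flipCount k n)).map fun j => ω (i * (n * flipCount k n) + j))
    (fun i τ h => h.1)
    (fun i τ ⟨_, _, h4, _⟩ hi => h4.trans_ne (Nat.sub_ne_zero_of_lt hi))
    (fun τ ⟨_, _, h4, _⟩ => h4.trans N.sub_self)
    (fun i τ ⟨hb, ha, h4, h2⟩ _ => by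
      obtain ⟨τ', hr, hb', ha', h4', h2'⟩ := runs_trialProg (W := W) (G := G) hk hf (by omega) hb
        ((ha 0 0 (by simp)).trans hn) (fun u v => by rw [ha 1 _ (by simp), hadj])
        fun j => ω (i * (n * flipCount k n) + j)
      refine ⟨τ', hr, hb', ha.trans ha', h4'.trans (by rw [h4, Nat.sub_sub]),
        h2'.trans (if_congr ?_ rfl rfl)⟩
      rw [h2, Nat.exists_lt_succ_right]
      exact or_congr_left (by split_ifs with h <;> simp [h]))
    ⟨hσ, .refl _ _, h4, by simp [h2]⟩
  rw [range_flatMap_map] at hrun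
  exact ⟨τ, hrun, h⟩

end trials

section setup

variable {k n A B W : ℕ} {σ : Store}

/-- The numerator of `alpha k ^ (2 * k + 1)`. -/
def rateNum (k : ℕ) : ℕ := (2 * k + 1) ^ (2 * k + 1)

/-- The denominator of `alpha k ^ (2 * k + 1)`. -/
def rateDen (k : ℕ) : ℕ := 2 * (2 * k) ^ (2 * k)

/-- The number of trials: a multiple of `alpha k ^ n`, with the exponent rounded up to a multiple of
`2 * k + 1` so that it can be computed by integer arithmetic. -/
def trialCount (k n : ℕ) : ℕ :=
  4 * (rateNum k ^ (n / (2 * k + 1) + 1) / rateDen k ^ (n / (2 * k + 1) + 1) + 1)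

/-- The computation of powers of `rateNum k` and `rateDen k`. -/
def powersProg (k : ℕ) : Prog :=
  .forLoop (.add (.div (.var 0) (.const (2 * k + 1))) (.const 1))
    (.seq (.write 5 (.const 0) (.mul (.var 5) (.const (rateNum k))))
      (.write 6 (.const 0) (.mul (.var 6) (.const (rateDen k)))))

/-- The computation of the number of trials. -/
def setupProg (k : ℕ) : Prog :=
  .seq (.write 5 (.const 0) (.const 1)) (.seq (.write 6 (.const 0) (.const 1))
    (.seq (powersProg k)
      (.write 4 (.const 0) (.mul (.const 4) (.add (.div (.var 5) (.var 6)) (.const 1))))))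

/-- The bit length `B` suffices for the computation of the number of trials. -/
structure FitsTrialCount (k n B : ℕ) : Prop where
  steps : n / (2 * k + 1) + 1 ≤ B
  num : ∀ j ≤ n / (2 * k + 1) + 1, Nat.size (rateNum k ^ j) ≤ B
  den : ∀ j ≤ n / (2 * k + 1) + 1, Nat.size (rateDen k ^ j) ≤ B
  count : Nat.size (trialCount k n) ≤ B

theorem runs_powersProg (hf : Fits k n A B) (hc : FitsTrialCount k n B)
    (hW : (powersProg k).weight ≤ W) (hσ : Bounded A B σ) (hn : σ (0, 0) = n) (h5 : σ (5, 0) = 1)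
    (h6 : σ (6, 0) = 1) :
    ∃ τ, Runs A B W (powersProg k) σ [] ((n / (2 * k + 1) + 1) * 4 + 2) τ ∧ Bounded A B τ ∧
      AgreeOff [3, 5, 6] σ τ ∧ τ (5, 0) = rateNum k ^ (n / (2 * k + 1) + 1) ∧
      τ (6, 0) = rateDen k ^ (n / (2 * k + 1) + 1) := by
  have hW' := hW
  simp only [powersProg, Prog.forLoop, Prog.weight] at hW'
  obtain ⟨τ, hrun, h⟩ := Runs.forLoop hf.pos hf.one_le hW (mods := [3, 5, 6]) (by simp) hσ
    (fun j τ => τ (5, 0) = rateNum k ^ j ∧ τ (6, 0) = rateDen k ^ j)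
    (n / (2 * k + 1) + 1) 2 (fun _ => []) hc.steps
    (fun τ hτ => by simp only [Expr.eval, Expr.eval_var, (hτ 0 0 (by simp)).trans hn])
    (fun j τ v h => by simpa [Store.update_apply] using h)
    (fun j τ hj hb h3 ha ⟨h5, h6⟩ => by
      have hb₁ : Bounded A B (τ.update (5, 0) (rateNum k ^ (j + 1))) :=
        hb.update (by norm_num) hf.pos (hc.num _ hj)
      refine ⟨_, .seq (w := []) (w' := []) (s := 1) (s' := 1)
        (.write hf.one_le hb (by simp only [Prog.weight]; omega) rfl ?_)
        (.write hf.one_le hb₁ (by simp only [Prog.weight]; omega) rfl ?_),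
        hb₁.update (by norm_num) hf.pos (hc.den _ hj), ?_,
        (ha.update (by simp) _ _).update (by simp) _ _, ?_⟩
      · rw [Expr.eval, Expr.eval, Expr.eval_var, h5, pow_succ]
      · simp [Expr.eval, Store.update_apply, h6, pow_succ]
      · simpa [Expr.eval, Store.update_apply] using h3
      · simp [Expr.eval, Store.update_apply])
    ⟨h5, h6⟩
  rw [List.flatMap_eq_nil_iff.2 fun _ _ => rfl] at hrun
  exact ⟨τ, hrun, h⟩

theorem runs_setupProg (hf : Fits k n A B) (hc : FitsTrialCount k n B)
    (hW : (setupProg k).weight ≤ W) (hσ : Bounded A B σ) (hn : σ (0, 0) = n) :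
    ∃ τ, Runs A B W (setupProg k) σ [] ((n / (2 * k + 1) + 1) * 4 + 5) τ ∧ Bounded A B τ ∧
      AgreeOff [3, 4, 5, 6] σ τ ∧ τ (4, 0) = trialCount k n := by
  simp only [setupProg, Prog.weight] at hW
  have hs : Nat.size 1 ≤ B := (size_le_self 1).trans hf.one_le
  have hr₁ := Runs.write (W := W) (a := 5) (i := .const 0) (e := .const 1)
    hf.one_le hσ (by simp only [Prog.weight]; omega) rfl rfl
  have hb₁ : Bounded A B (σ.update (5, 0) 1) := hσ.update (by norm_num) hf.pos hs
  have hr₂ := Runs.write (W := W) (a := 6) (i := .const 0) (e := .const 1)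
    hf.one_le hb₁ (by simp only [Prog.weight]; omega) rfl rfl
  have hb₂ : Bounded A B ((σ.update (5, 0) 1).update (6, 0) 1) := hb₁.update (by norm_num) hf.pos hs
  have ha₂ : AgreeOff [5, 6] σ ((σ.update (5, 0) 1).update (6, 0) 1) :=
    ((AgreeOff.refl _ _).update (by simp) _ _).update (by simp) _ _
  obtain ⟨σ₃, hr₃, hb₃, ha₃, h5, h6⟩ := runs_powersProg (W := W) hf hc (by omega) hb₂
    ((ha₂ 0 0 (by simp)).trans hn) (by simp [Store.update_apply]) (by simp [Store.update_apply])
  have hcount : (Expr.mul (.const 4) (.add (.div (.var 5) (.var 6)) (.const 1))).eval σ₃ =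
      trialCount k n := by
    simp only [Expr.eval, Expr.eval_var, h5, h6, trialCount]
  refine ⟨_, (hr₁.seq (hr₂.seq (hr₃.seq (.write hf.one_le hb₃
      (by simp only [Prog.weight]; omega) rfl hcount)))).mono (by omega),
    hb₃.update (by norm_num) hf.pos hc.count,
    ((ha₂.mono (by simp)).trans (ha₃.mono (by simp))).update (by simp) _ _, ?_⟩
  simp [Expr.eval, Store.update_apply]

end setup

end OddCycle

/-! ### The success probability of a trial -/

namespace OddCycle

section bits

variable {d r : ℕ}

theorem residue_congr {bits bits' : ℕ → Bool} (h : ∀ b < r, bits b = bits' b) :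
    residue d bits r = residue d bits' r := by
  induction r with
  | zero => rfl
  | succ r ih =>
    rw [residue, residue, ih fun b hb => h b (hb.trans r.lt_succ_self), h r r.lt_succ_self]

/-- The binary digits of `y`, padded to length `r`, the most significant one first. -/
def bitsOf (r y b : ℕ) : Bool := y.testBit (r - 1 - b)

theorem residue_bitsOf {y : ℕ} (hy : y < 2 ^ r) : residue d (bitsOf r y) r = y % d := by
  have residue_prefix : ∀ b ≤ r, residue d (bitsOf r y) b = y / 2 ^ (r - b) % d := by
    intro b hb
    induction b with
    | zero => rw [residue, Nat.sub_zero, Nat.div_eq_of_lt hy, Nat.zero_mod]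
    | succ b ih =>
      rw [residue, ih (b.le_succ.trans hb), bitsOf, Nat.toNat_testBit,
        show r - b = (r - 1 - b) + 1 by omega, show r - (b + 1) = r - 1 - b by omega, pow_succ,
        ← Nat.div_div_eq_div_mul, Nat.add_mod, Nat.mul_mod, Nat.mod_mod, ← Nat.mul_mod,
        ← Nat.add_mod, Nat.div_add_mod]
  simpa using residue_prefix r le_rfl

theorem bitsOf_injOn : Set.InjOn (fun y (b : Fin r) => bitsOf r y b) (Set.Iio (2 ^ r)) := by
  refine fun y hy y' hy' h => Nat.eq_of_testBit_eq fun i => ?_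
  rcases lt_or_ge i r with hi | hi
  · have := congrFun h ⟨r - 1 - i, by omega⟩
    simpa [bitsOf, show r - 1 - (r - 1 - i) = i by omega] using this
  · have hri : 2 ^ r ≤ 2 ^ i := Nat.pow_le_pow_right two_pos hi
    rw [Nat.testBit_lt_two_pow (lt_of_lt_of_le hy hri),
      Nat.testBit_lt_two_pow (lt_of_lt_of_le hy' hri)]

/-- The continuation of a finite bit sequence by zeros. -/
def extendBits (β : Fin r → Bool) : ℕ → Bool := Function.extend Fin.val β fun _ => false

theorem extendBits_apply (β : Fin r → Bool) (b : Fin r) : extendBits β b = β b :=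
  Fin.val_injective.extend_apply _ _ _

theorem residue_extendBits {β : Fin r → Bool} {bits : ℕ → Bool} (h : ∀ b : Fin r, bits b = β b) :
    residue d (extendBits β) r = residue d bits r :=
  residue_congr fun b hb => (extendBits_apply β ⟨b, hb⟩).trans (h ⟨b, hb⟩).symm

theorem card_mul_div_le_card_mod_mem {S : Finset ℕ} (hS : ∀ x ∈ S, x < d) (N : ℕ) :
    S.card * (N / d) ≤ ((Finset.range N).filter fun y => y % d ∈ S).card := by
  have hmaps : Set.MapsTo (· % d) ((Finset.range N).filter fun y => y % d ∈ S) S :=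
    fun y hy => (Finset.mem_filter.1 hy).2
  rw [Finset.card_eq_sum_card_fiberwise hmaps]
  refine Finset.card_nsmul_le_sum _ _ _ fun x hx => ?_
  have hfiber : (Finset.range N).filter (· ≡ x [MOD d]) ⊆
      ((Finset.range N).filter fun y => y % d ∈ S).filter fun y => y % d = x := by
    intro y hy
    obtain ⟨hyN, hyx⟩ := Finset.mem_filter.1 hy
    have hyx' : y % d = x := Eq.trans hyx (Nat.mod_eq_of_lt (hS x hx))
    exact Finset.mem_filter.2 ⟨Finset.mem_filter.2 ⟨hyN, hyx'.symm ▸ hx⟩, hyx'⟩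
  calc N / d ≤ N.count (· ≡ x [MOD d]) := by
        rw [Nat.count_modEq_card N (Nat.zero_lt_of_lt (hS x hx))]
        exact Nat.le_add_right _ _
    _ ≤ _ := (Nat.count_eq_card_filter_range _ N).trans_le (Finset.card_le_card hfiber)

theorem card_mul_div_le_card_residue_mem {S : Finset ℕ} (hS : ∀ x ∈ S, x < d) (r : ℕ) :
    S.card * (2 ^ r / d) ≤
      (Finset.univ.filter fun β : Fin r → Bool => residue d (extendBits β) r ∈ S).card := by
  refine (card_mul_div_le_card_mod_mem hS _).trans
    (Finset.card_le_card_of_injOn (fun y (b : Fin r) => bitsOf r y b) (fun y hy => ?_)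
      (bitsOf_injOn.mono fun y hy => Finset.mem_range.1 (Finset.mem_filter.1 hy).1))
  obtain ⟨hy, hyS⟩ := Finset.mem_filter.1 hy
  refine Finset.mem_filter.2 ⟨Finset.mem_univ _, ?_⟩
  rwa [residue_extendBits fun _ => rfl, residue_bitsOf (Finset.mem_range.1 hy)]

end bits

section value

variable {k : ℕ}

open Classical in
/-- The residues whose list contains `a`. -/
def valueResidues (k : ℕ) (a : Fin (2 * k + 1)) : Finset ℕ :=
  (Finset.range (2 * k + 1)).filter fun x => a ∈ listSet k (listOfResidue x)

theorem mem_valueResidues {a : Fin (2 * k + 1)} {x : ℕ} :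
    x ∈ valueResidues k a ↔ x < 2 * k + 1 ∧ NatList (listOfResidue x) a := by
  simp only [valueResidues, Finset.mem_filter, Finset.mem_range, mem_listSet_iff]

theorem two_le_card_valueResidues_zero (hk : 1 ≤ k) : 2 ≤ (valueResidues k 0).card := by
  have hsub : ({0, 1} : Finset ℕ) ⊆ valueResidues k 0 := by
    intro x hx
    rw [Finset.mem_insert, Finset.mem_singleton] at hx
    rcases hx with rfl | rfl
    · exact mem_valueResidues.2 ⟨by omega, rfl⟩
    · exact mem_valueResidues.2 ⟨by omega, .inr rfl⟩
  exact Finset.card_le_card hsub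

theorem two_mul_le_card_valueResidues (hk : 1 ≤ k) {a : Fin (2 * k + 1)} (ha : a ≠ 0) :
    2 * k ≤ (valueResidues k a).card := by
  have hsub : insert ((a : ℕ) % 2) (Finset.Ico 2 (2 * k + 1)) ⊆ valueResidues k a := by
    intro x hx
    rw [Finset.mem_insert, Finset.mem_Ico] at hx
    refine mem_valueResidues.2 ⟨by omega, ?_⟩
    rcases hx with rfl | hx
    · rcases Nat.mod_two_eq_zero_or_one a with h | h
      · rw [h]
        exact h
      · rw [h]
        exact .inl h
    · rw [listOfResidue, if_neg (by omega), if_neg (by omega)]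
      exact Fin.val_ne_zero_iff.2 ha
  refine le_trans ?_ (Finset.card_le_card hsub)
  rw [Finset.card_insert_of_notMem (by simp; omega), Nat.card_Ico]
  omega

theorem mul_valueProb_le_card_valueResidues (hk : 1 ≤ k) (a : Fin (2 * k + 1)) :
    (2 * k + 1) * valueProb k a ≤ (valueResidues k a).card := by
  unfold valueProb
  split_ifs with ha
  · subst ha
    rw [mul_div_cancel₀ _ (by positivity)]
    exact_mod_cast two_le_card_valueResidues_zero hk
  · rw [mul_div_cancel₀ _ (by positivity)]
    exact_mod_cast two_mul_le_card_valueResidues hk ha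

/-- The bit sequences of length `r` that determine a list containing `a`. -/
def valueBits (k r : ℕ) (a : Fin (2 * k + 1)) : Finset (Fin r → Bool) :=
  Finset.univ.filter fun β => residue (2 * k + 1) (extendBits β) r ∈ valueResidues k a

theorem two_pow_mul_valueProb_le_card_valueBits (hk : 1 ≤ k) (r : ℕ) (a : Fin (2 * k + 1)) :
    2 ^ r * valueProb k a * (1 - (2 * k + 1) / 2 ^ r) ≤ ((valueBits k r a).card : ℝ) := by
  have hdiv : (2 : ℝ) ^ r / (2 * k + 1) - 1 ≤ ((2 ^ r / (2 * k + 1) : ℕ) : ℝ) := by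
    have hlt : (2 : ℝ) ^ r < (2 * k + 1) * (((2 ^ r / (2 * k + 1) : ℕ) : ℝ) + 1) := by
      exact_mod_cast Nat.lt_mul_div_succ (2 ^ r) (2 * k).succ_pos
    rw [tsub_le_iff_right, div_le_iff₀ (by positivity)]
    linarith
  calc (2 : ℝ) ^ r * valueProb k a * (1 - (2 * k + 1) / 2 ^ r)
      = (2 * k + 1 : ℝ) * valueProb k a * ((2 : ℝ) ^ r / (2 * k + 1) - 1) := by field_simp
    _ ≤ (2 * k + 1 : ℝ) * valueProb k a * ((2 ^ r / (2 * k + 1) : ℕ) : ℝ) :=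
        mul_le_mul_of_nonneg_left hdiv (mul_nonneg (by positivity) (valueProb_nonneg k a))
    _ ≤ (valueResidues k a).card * ((2 ^ r / (2 * k + 1) : ℕ) : ℝ) :=
        mul_le_mul_of_nonneg_right (mul_valueProb_le_card_valueResidues hk a) (Nat.cast_nonneg _)
    _ ≤ (valueBits k r a).card := by
        exact_mod_cast card_mul_div_le_card_residue_mem (fun x hx => (mem_valueResidues.1 hx).1) r

end value

section trial

variable {k n : ℕ}

theorem mul_div_two_pow_flipCount_le (k n : ℕ) :
    (n : ℝ) * ((2 * k + 1) / 2 ^ flipCount k n) ≤ 1 / 2 := by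
  have hnat : 2 * (n * (2 * k + 1)) ≤ 2 ^ flipCount k n := by
    calc 2 * (n * (2 * k + 1)) ≤ 2 * (2 ^ n * 2 ^ (2 * k + 1)) := by
          gcongr <;> exact Nat.lt_two_pow_self.le
      _ = 2 ^ flipCount k n := by unfold flipCount; ring
  have hreal : (2 : ℝ) * (n * (2 * k + 1)) ≤ 2 ^ flipCount k n := by exact_mod_cast hnat
  rw [← mul_div_assoc, div_le_iff₀ (by positivity)]
  linarith

theorem half_le_one_sub_pow {δ : ℝ} (hδ : n * δ ≤ 1 / 2) : 1 / 2 ≤ (1 - δ) ^ n := by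
  rcases n.eq_zero_or_pos with rfl | hn
  · norm_num
  · have hn' : (1 : ℝ) ≤ n := by exact_mod_cast hn
    have hbern := one_add_mul_le_pow (show (-2 : ℝ) ≤ -δ by nlinarith) n
    rw [← sub_eq_add_neg] at hbern
    linarith

/-- The outcomes of the coin flips of one trial, arranged by vertices. -/
abbrev Block (n r : ℕ) : Type := Fin n → Fin r → Bool

/-- The lists determined by the coin flips of one trial. -/
def blockLists {r : ℕ} (k : ℕ) (Φ : Block n r) (v : Fin n) : Fin 3 :=
  listOfResidue (residue (2 * k + 1) (extendBits (Φ v)) r)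

open Classical in
/-- The outcomes of the coin flips of one trial for which there is a list homomorphism. -/
def goodBlocks (k : ℕ) (G : SimpleGraph (Fin n)) : Finset (Block n (flipCount k n)) :=
  Finset.univ.filter fun Φ => HasListHom k G (blockLists k Φ)

theorem mem_goodBlocks {G : SimpleGraph (Fin n)} {Φ : Block n (flipCount k n)} :
    Φ ∈ goodBlocks k G ↔ HasListHom k G (blockLists k Φ) := by
  simp only [goodBlocks, Finset.mem_filter_univ]

theorem card_block (n r : ℕ) : Fintype.card (Block n r) = (2 ^ r) ^ n := by
  simp only [Block, Fintype.card_pi_const, Fintype.card_bool]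

theorem piFinset_valueBits_subset_goodBlocks {G : SimpleGraph (Fin n)} (h : G →g cycle k) :
    Fintype.piFinset (fun v => valueBits k (flipCount k n) (h v)) ⊆ goodBlocks k G := by
  intro Φ hΦ
  rw [mem_goodBlocks]
  refine ⟨h, fun v => (mem_listSet_iff _ _).2 ?_⟩
  exact (mem_valueResidues.1 (Finset.mem_filter.1 (Fintype.mem_piFinset.1 hΦ v)).2).2

theorem le_card_goodBlocks (hk : 1 ≤ k) {G : SimpleGraph (Fin n)}
    (hG : Nonempty (G →g cycle k)) :
    (alpha k ^ n)⁻¹ / 2 * Fintype.card (Block n (flipCount k n)) ≤ (goodBlocks k G).card := by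
  obtain ⟨h, hh⟩ := exists_hom_valueProb hk hG
  set r := flipCount k n
  set δ : ℝ := (2 * k + 1) / 2 ^ r
  have hnδ : n * δ ≤ 1 / 2 := mul_div_two_pow_flipCount_le k n
  have hnonneg (v : Fin n) : 0 ≤ valueProb k (h v) * (1 - δ) := by
    have hn : (1 : ℝ) ≤ n := by exact_mod_cast Fin.pos v
    exact mul_nonneg (valueProb_nonneg k _) (by nlinarith [show 0 ≤ δ by positivity])
  calc (alpha k ^ n)⁻¹ / 2 * (Fintype.card (Block n r) : ℝ)
      = (2 ^ r) ^ n * ((alpha k ^ n)⁻¹ * (1 / 2)) := by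
        rw [card_block]
        push_cast
        ring
    _ ≤ (2 ^ r) ^ n * ((∏ v, valueProb k (h v)) * (1 - δ) ^ n) := by
        refine mul_le_mul_of_nonneg_left ?_ (by positivity)
        exact mul_le_mul hh (half_le_one_sub_pow hnδ) (by norm_num)
          (Finset.prod_nonneg fun v _ => valueProb_nonneg _ _)
    _ = ∏ v : Fin n, (2 ^ r * valueProb k (h v) * (1 - δ)) := by
        rw [Finset.prod_mul_distrib, Finset.prod_mul_distrib, Finset.prod_const,
          Finset.prod_const, Finset.card_univ, Fintype.card_fin, mul_assoc]
    _ ≤ ∏ v : Fin n, ((valueBits k r (h v)).card : ℝ) :=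
        Finset.prod_le_prod
          (fun v _ => by rw [mul_assoc]; exact mul_nonneg (by positivity) (hnonneg v))
          fun v _ => two_pow_mul_valueProb_le_card_valueBits hk r (h v)
    _ ≤ (goodBlocks k G).card := by
        rw [← Nat.cast_prod, ← Fintype.card_piFinset]
        exact_mod_cast Finset.card_le_card (piFinset_valueBits_subset_goodBlocks h)

end trial

/-! ### The number of trials -/

section trialCount

variable {k : ℕ}

theorem le_card_exists_mem {Ω : Type*} [Fintype Ω] [DecidableEq Ω] {s : Finset Ω} {p : ℝ}
    (hs : p * Fintype.card Ω ≤ s.card) (N : ℕ) :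
    (1 - (1 - p) ^ N) * Fintype.card (Fin N → Ω) ≤
      (Finset.univ.filter fun F : Fin N → Ω => ∃ i, F i ∈ s).card := by
  have hcompl : (Finset.univ.filter fun F : Fin N → Ω => ∃ i, F i ∈ s) =
      (Fintype.piFinset fun _ => sᶜ)ᶜ := by
    ext F
    simp [Fintype.mem_piFinset]
  have hbad : ((sᶜ.card : ℕ) : ℝ) ^ N ≤ (1 - p) ^ N * Fintype.card (Fin N → Ω) := by
    rw [Fintype.card_pi_const, Nat.cast_pow, ← mul_pow]
    refine pow_le_pow_left₀ (Nat.cast_nonneg _) ?_ N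
    rw [Finset.card_compl, Nat.cast_sub (Finset.card_le_univ s)]
    linarith
  rw [hcompl, Finset.card_compl, Nat.cast_sub (Finset.card_le_univ _), Fintype.card_piFinset_const,
    Nat.cast_pow]
  linarith

theorem rateDen_pos (hk : 1 ≤ k) : 0 < rateDen k := by
  unfold rateDen
  positivity

theorem rateNum_div_rateDen (hk : 1 ≤ k) :
    (rateNum k : ℝ) / rateDen k = alpha k ^ (2 * k + 1) := by
  rw [alpha_pow_eq hk, rateNum, rateDen, div_pow, pow_succ]
  push_cast
  field_simp

theorem four_mul_alpha_pow_le_trialCount (hk : 1 ≤ k) (n : ℕ) :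
    4 * alpha k ^ n ≤ (trialCount k n : ℝ) := by
  unfold trialCount
  set m := n / (2 * k + 1) + 1
  have hden : 0 < rateDen k ^ m := pow_pos (rateDen_pos hk) m
  have hpow : alpha k ^ n ≤ (rateNum k : ℝ) ^ m / (rateDen k : ℝ) ^ m := by
    rw [← div_pow, rateNum_div_rateDen hk, ← pow_mul]
    exact pow_le_pow_right₀ (one_le_alpha hk) (Nat.lt_mul_div_succ n (2 * k).succ_pos).le
  have hfloor : (rateNum k : ℝ) ^ m / (rateDen k : ℝ) ^ m ≤
      ((rateNum k ^ m / rateDen k ^ m : ℕ) : ℝ) + 1 := by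
    rw [div_le_iff₀ (by exact_mod_cast hden), mul_comm]
    exact_mod_cast (Nat.lt_mul_div_succ (rateNum k ^ m) hden).le
  push_cast at hfloor ⊢
  linarith

theorem trialCount_le (hk : 1 ≤ k) (n : ℕ) :
    (trialCount k n : ℝ) ≤ 4 * (rateNum k + 1) * alpha k ^ n := by
  set m := n / (2 * k + 1)
  have hα := one_le_alpha hk
  have hαn : 1 ≤ alpha k ^ n := one_le_pow₀ hα
  have hfloor : ((rateNum k ^ (m + 1) / rateDen k ^ (m + 1) : ℕ) : ℝ) ≤
      rateNum k * alpha k ^ n := by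
    calc ((rateNum k ^ (m + 1) / rateDen k ^ (m + 1) : ℕ) : ℝ)
        ≤ (rateNum k : ℝ) ^ (m + 1) / (rateDen k : ℝ) ^ (m + 1) := by
          exact_mod_cast Nat.cast_div_le
      _ = (rateNum k / rateDen k) * alpha k ^ ((2 * k + 1) * m) := by
          rw [← div_pow, pow_succ', rateNum_div_rateDen hk, ← pow_mul]
      _ ≤ rateNum k * alpha k ^ n := by
          refine mul_le_mul (div_le_self (Nat.cast_nonneg _) ?_)
            (pow_le_pow_right₀ hα (Nat.mul_div_le _ _)) (by positivity) (Nat.cast_nonneg _)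
          exact_mod_cast rateDen_pos hk
  unfold trialCount
  push_cast at hfloor ⊢
  linarith

theorem one_sub_pow_trialCount_le (hk : 1 ≤ k) (n : ℕ) :
    (1 - (alpha k ^ n)⁻¹ / 2) ^ trialCount k n ≤ 1 / 3 := by
  have hα : 1 ≤ alpha k ^ n := one_le_pow₀ (one_le_alpha hk)
  have hinv : (alpha k ^ n)⁻¹ ≤ 1 := inv_le_one_of_one_le₀ hα
  calc (1 - (alpha k ^ n)⁻¹ / 2) ^ trialCount k n
      ≤ Real.exp (-((alpha k ^ n)⁻¹ / 2)) ^ trialCount k n :=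
        pow_le_pow_left₀ (by linarith) (Real.one_sub_le_exp_neg _) _
    _ = Real.exp (-((alpha k ^ n)⁻¹ / 2 * trialCount k n)) := by
        rw [← Real.exp_nat_mul, mul_neg, mul_comm]
    _ ≤ Real.exp (-2) := by
        refine Real.exp_le_exp.2 (neg_le_neg ?_)
        calc (2 : ℝ) = (alpha k ^ n)⁻¹ / 2 * (4 * alpha k ^ n) := by field_simp; norm_num
          _ ≤ _ := mul_le_mul_of_nonneg_left (four_mul_alpha_pow_le_trialCount hk n)
            (by positivity)
    _ ≤ 1 / 3 := by
        rw [Real.exp_neg, ← one_div]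
        refine one_div_le_one_div_of_le three_pos ?_
        linarith [Real.add_one_le_exp (2 : ℝ)]

end trialCount

end OddCycle

/-! ### Probability of acceptance -/

namespace RAM

theorem exists_map_range_append {l m : ℕ} (h : l ≤ m) (ω : ℕ → Bool) :
    ∃ u, (List.range l).map ω ++ u = (List.range m).map ω := by
  obtain ⟨b, rfl⟩ := Nat.exists_eq_add_of_le h
  exact ⟨_, by rw [List.range_add, List.map_append]⟩

theorem acceptProb_eq_zero {p : Prog} {σ : Store}
    (h : ∀ ω : ℕ → Bool, ∃ (S m t : ℕ) (τ : Store),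
      Exec S p σ ((List.range m).map ω) t τ ∧ τ (2, 0) ≠ 1) :
    acceptProb p σ = 0 := by
  refine ENNReal.tsum_eq_zero.2 ?_
  rintro ⟨w, S, t, τ, hw, hτ⟩
  set ω : ℕ → Bool := fun i => w.getD i false with hω
  have hwω : w = (List.range w.length).map ω :=
    List.ext_getElem (by simp) fun i hi _ => by simp [hω, hi]
  obtain ⟨S', m, t', τ', h', hτ'⟩ := h ω
  obtain ⟨u, hu⟩ := exists_map_range_append (le_max_left w.length m) ω
  obtain ⟨u', hu'⟩ := exists_map_range_append (le_max_right w.length m) ω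
  rw [hwω] at hw
  obtain ⟨-, rfl⟩ := hw.deterministic h' (hu.trans hu'.symm)
  exact absurd hτ hτ'

theorem card_mul_inv_two_pow_le_acceptProb {p : Prog} {σ : Store} {ι : Type*} {s : Finset ι}
    {w : ι → List Bool} {m : ℕ} (hlen : ∀ i ∈ s, (w i).length = m) (hw : Set.InjOn w s)
    (hacc : ∀ i ∈ s, Accepts p σ (w i)) : s.card * (2⁻¹ : ℝ≥0∞) ^ m ≤ acceptProb p σ := by
  have hinj : Function.Injective fun i : s =>
      (⟨w i, hacc i i.2⟩ : {w : List Bool // Accepts p σ w}) :=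
    fun i j h => Subtype.ext (hw i.2 j.2 (Subtype.ext_iff.1 h))
  calc s.card * (2⁻¹ : ℝ≥0∞) ^ m = ∑ i ∈ s, (2⁻¹ : ℝ≥0∞) ^ (w i).length := by
        rw [Finset.sum_congr rfl fun i hi => by rw [hlen i hi], Finset.sum_const, nsmul_eq_mul]
    _ = ∑' i : s, (2⁻¹ : ℝ≥0∞) ^ (w i).length := (Finset.tsum_subtype s _).symm
    _ ≤ acceptProb p σ :=
        ENNReal.tsum_comp_le_tsum_of_injective hinj fun w => (2⁻¹ : ℝ≥0∞) ^ w.1.length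

/-! ### The input -/

section input

variable {n : ℕ} (G : SimpleGraph (Fin n))

open Classical in
theorem graphInput_apply (c : ℕ × ℕ) :
    graphInput G c = (if (0, 0) = c then n else 0) +
      ∑ u : Fin n, ∑ v : Fin n, if G.Adj u v ∧ (1, (u : ℕ) * n + v) = c then 1 else 0 := by
  rw [graphInput, Finsupp.add_apply, Finsupp.single_apply, Finsupp.finsetSum_apply]
  congr 1
  refine Finset.sum_congr rfl fun u _ => ?_
  rw [Finsupp.finsetSum_apply]
  refine Finset.sum_congr rfl fun v _ => ?_
  by_cases h : G.Adj u v <;> simp [h, Finsupp.single_apply]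

theorem graphInput_zero : graphInput G (0, 0) = n := by
  simp [graphInput_apply]

theorem graphInput_answer : graphInput G (2, 0) = 0 := by
  simp [graphInput_apply]

theorem mul_add_inj {u v u' v' : Fin n} :
    (u : ℕ) * n + v = u' * n + v' ↔ u = u' ∧ v = v' := by
  have h := finProdFinEquiv.injective.eq_iff (a := (u, v)) (b := (u', v'))
  rwa [Fin.ext_iff, Prod.mk_inj, finProdFinEquiv_apply_val, finProdFinEquiv_apply_val,
    add_comm, mul_comm, add_comm (v' : ℕ), mul_comm n] at h

theorem graphInput_adj (u v : Fin n) : graphInput G (1, u * n + v) ≠ 0 ↔ G.Adj u v := by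
  simp only [graphInput_apply, Prod.mk.injEq, zero_ne_one, false_and, if_false, zero_add, true_and,
    mul_add_inj, ne_eq, Finset.sum_eq_zero_iff, Finset.mem_univ, true_implies,
    ite_eq_right_iff, one_ne_zero, imp_false, not_forall, not_not]
  exact ⟨fun ⟨_, _, h, hu, hv⟩ => hu ▸ hv ▸ h, fun h => ⟨u, v, h, rfl, rfl⟩⟩

theorem graphInput_le (c : ℕ × ℕ) : graphInput G c ≤ n + n * n := by
  classical
  rw [graphInput_apply]
  refine add_le_add (by split_ifs <;> omega) ?_
  calc ∑ u : Fin n, ∑ v : Fin n, (if G.Adj u v ∧ (1, (u : ℕ) * n + v) = c then 1 else 0)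
      ≤ ∑ _u : Fin n, ∑ _v : Fin n, 1 :=
        Finset.sum_le_sum fun u _ => Finset.sum_le_sum fun v _ => by split_ifs <;> omega
    _ = n * n := by simp

theorem eq_zero_or_exists_of_graphInput_ne_zero {c : ℕ × ℕ} (h : graphInput G c ≠ 0) :
    c = (0, 0) ∨ ∃ u v : Fin n, c = (1, (u : ℕ) * n + v) := by
  contrapose! h
  rw [graphInput_apply, if_neg h.1.symm, zero_add]
  exact Finset.sum_eq_zero fun u _ => Finset.sum_eq_zero fun v _ =>
    if_neg fun huv => h.2 u v huv.2.symm

theorem bounded_graphInput {A B : ℕ} (hA : 0 < A) (hA' : n * n ≤ A) (hB : n + n * n ≤ B) :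
    Bounded A B (graphInput G) where
  address a i h := by
    obtain h | ⟨u, v, h⟩ := eq_zero_or_exists_of_graphInput_ne_zero G h
    · obtain ⟨rfl, rfl⟩ := Prod.mk_inj.1 h
      exact ⟨by norm_num, hA⟩
    · obtain ⟨rfl, rfl⟩ := Prod.mk_inj.1 h
      refine ⟨by norm_num, lt_of_lt_of_le ?_ hA'⟩
      rw [mul_comm, add_comm]
      exact OddCycle.add_mul_lt v.2 u.2
  size c := (size_le_self _).trans ((graphInput_le G c).trans hB)

end input

end RAM

/-! ### The main program -/

namespace OddCycle

open RAM

section main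

variable {k n : ℕ}

/-- The randomized algorithm: lists are drawn independently `trialCount k n` times, and each time
the list homomorphism problem is solved by path consistency. -/
def mainProg (k : ℕ) : Prog := .seq (setupProg k) (trialsProg k)

/-- The number of steps of the algorithm. -/
def mainSteps (k n : ℕ) : ℕ :=
  (n / (2 * k + 1) + 1) * 4 + 5 + (trialCount k n * (trialSteps k n + 1) + 1)

/-- A bound for the addresses used by the algorithm. -/
def addrBound (k n : ℕ) : ℕ := pairCount n (2 * k + 1) + n + 1

/-- A bound for the bit lengths of the numbers used by the algorithm. -/
def bitBound (k n : ℕ) : ℕ :=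
  pcTime n (2 * k + 1) + n * flipCount k n + pairCount n (2 * k + 1) + (n + n * n) + (2 * k + 1) +
    (rateNum k + rateDen k) * (n + 1) + 10

theorem size_pow_le (p j : ℕ) : Nat.size (p ^ j) ≤ p * j + 1 := by
  rw [Nat.size_le]
  calc p ^ j ≤ (2 ^ p) ^ j := Nat.pow_le_pow_left Nat.lt_two_pow_self.le _
    _ = 2 ^ (p * j) := (pow_mul _ _ _).symm
    _ < 2 ^ (p * j + 1) := Nat.pow_lt_pow_right one_lt_two (Nat.lt_succ_self _)

theorem size_pow_add_le_bitBound {j p : ℕ} (hp : p ≤ rateNum k + rateDen k)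
    (hj : j ≤ n / (2 * k + 1) + 1) : Nat.size (p ^ j) + 9 ≤ bitBound k n := by
  have hsize := size_pow_le p j
  have hmul : p * j ≤ (rateNum k + rateDen k) * (n + 1) :=
    Nat.mul_le_mul hp (hj.trans (Nat.succ_le_succ (Nat.div_le_self n (2 * k + 1))))
  unfold bitBound
  omega

theorem size_trialCount_le_bitBound (k n : ℕ) : Nat.size (trialCount k n) ≤ bitBound k n := by
  unfold trialCount
  set m := n / (2 * k + 1) + 1
  have hpow : Nat.size (rateNum k ^ m) + 9 ≤ bitBound k n :=
    size_pow_add_le_bitBound (Nat.le_add_right _ _) le_rfl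
  have hquot := Nat.size_le_size (Nat.div_le_self (rateNum k ^ m) (rateDen k ^ m))
  have hsucc := size_add_le (rateNum k ^ m / rateDen k ^ m) 1
  have hmul := size_mul_le 4 (rateNum k ^ m / rateDen k ^ m + 1)
  have hfour := size_le_self 4
  have hone := size_le_self 1
  omega

theorem fits (k n : ℕ) : Fits k n (addrBound k n) (bitBound k n) := by
  constructor <;> simp only [addrBound, bitBound] <;> omega

theorem fitsTrialCount (k n : ℕ) : FitsTrialCount k n (bitBound k n) where
  steps := by
    have := Nat.div_le_self n (2 * k + 1)
    unfold bitBound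
    omega
  num j hj := le_of_add_le_left (size_pow_add_le_bitBound (Nat.le_add_right _ _) hj)
  den j hj := le_of_add_le_left (size_pow_add_le_bitBound (Nat.le_add_left _ _) hj)
  count := size_trialCount_le_bitBound k n

theorem bounded_graphInput (k : ℕ) (G : SimpleGraph (Fin n)) :
    Bounded (addrBound k n) (bitBound k n) (graphInput G) := by
  refine RAM.bounded_graphInput G (fits k n).pos ?_ (by unfold bitBound; omega)
  have hsq : n * n ≤ pairCount n (2 * k + 1) :=
    (Nat.le_mul_of_pos_left _ (2 * k).succ_pos).trans (Nat.le_mul_of_pos_left _ (2 * k).succ_pos)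
  unfold addrBound
  omega

open Classical in
theorem runs_mainProg (hk : 1 ≤ k) (G : SimpleGraph (Fin n)) (ω : ℕ → Bool) :
    ∃ τ, Runs (addrBound k n) (bitBound k n) (mainProg k).weight (mainProg k) (graphInput G)
        ((List.range (trialCount k n * (n * flipCount k n))).map ω) (mainSteps k n) τ ∧
      τ (2, 0) = if ∃ i < trialCount k n, TrialSucceeds k G ω i then 1 else 0 := by
  obtain ⟨σ, hr, hb, ha, h4⟩ := runs_setupProg (W := (mainProg k).weight) (fits k n)
    (fitsTrialCount k n) (Nat.le_add_right _ _) (bounded_graphInput k G) (graphInput_zero G)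
  obtain ⟨τ, hr', h2⟩ := runs_trialsProg (W := (mainProg k).weight) hk (fits k n)
    (Nat.le_add_left _ _) (G := G) hb ((ha 0 0 (by simp)).trans (graphInput_zero G))
    (fun u v => by rw [ha 1 _ (by simp)]; exact graphInput_adj G u v)
    ((ha 2 0 (by simp)).trans (graphInput_answer G)) h4 ω
  exact ⟨τ, hr.seq hr', h2⟩

theorem acceptProb_mainProg_eq_zero (hk : 1 ≤ k) {G : SimpleGraph (Fin n)}
    (hG : ¬ Nonempty (G →g cycle k)) : acceptProb (mainProg k) (graphInput G) = 0 := by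
  refine acceptProb_eq_zero fun ω => ?_
  obtain ⟨τ, ⟨t, -, h⟩, hτ⟩ := runs_mainProg hk G ω
  refine ⟨_, _, t, τ, h, ?_⟩
  rw [hτ, if_neg fun ⟨_, _, g, _⟩ => hG ⟨g⟩]
  exact zero_ne_one

/-- The sequence of coin flips consisting of the blocks of all trials. -/
def flipSeq {N r : ℕ} (F : Fin N → Block n r) : ℕ → Bool :=
  extendBits fun t : Fin (N * (n * r)) =>
    F (finProdFinEquiv.symm t).1 (finProdFinEquiv.symm (finProdFinEquiv.symm t).2).1
      (finProdFinEquiv.symm (finProdFinEquiv.symm t).2).2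

theorem flipSeq_apply {N r : ℕ} (F : Fin N → Block n r) (i : Fin N) (v : Fin n) (b : Fin r) :
    flipSeq F (i * (n * r) + (v * r + b)) = F i v b := by
  have hindex : (i : ℕ) * (n * r) + (v * r + b) =
      finProdFinEquiv (i, finProdFinEquiv (v, b)) := by
    rw [finProdFinEquiv_apply_val, finProdFinEquiv_apply_val]
    ring
  rw [hindex, flipSeq, extendBits_apply]
  simp only [Equiv.symm_apply_apply]

theorem map_flipSeq_injective {N r : ℕ} :
    Function.Injective fun F : Fin N → Block n r =>
      (List.range (N * (n * r))).map (flipSeq F) := by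
  intro F F' h
  funext i v b
  rw [← flipSeq_apply F i v b, ← flipSeq_apply F' i v b]
  refine List.map_inj_left.1 h _ (List.mem_range.2 ?_)
  calc (i : ℕ) * (n * r) + (v * r + b) = b + r * v + r * n * i := by ring
    _ < r * n * N := add_mul_lt (add_mul_lt b.2 v.2) i.2
    _ = N * (n * r) := by ring

theorem trialSucceeds_flipSeq_iff {N : ℕ} {G : SimpleGraph (Fin n)}
    (F : Fin N → Block n (flipCount k n)) (i : Fin N) :
    TrialSucceeds k G (flipSeq F) i ↔ F i ∈ goodBlocks k G := by
  have hlists : (fun v : Fin n =>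
      drawnList k n (fun j => flipSeq F (i * (n * flipCount k n) + j)) v) = blockLists k (F i) :=
    funext fun v => congrArg listOfResidue
      (residue_extendBits fun b => flipSeq_apply F i v b).symm
  rw [TrialSucceeds, hlists, mem_goodBlocks]

theorem accepts_mainProg (hk : 1 ≤ k) {G : SimpleGraph (Fin n)}
    {F : Fin (trialCount k n) → Block n (flipCount k n)} (hF : ∃ i, F i ∈ goodBlocks k G) :
    Accepts (mainProg k) (graphInput G)
      ((List.range (trialCount k n * (n * flipCount k n))).map (flipSeq F)) := by
  obtain ⟨i, hi⟩ := hF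
  obtain ⟨τ, ⟨t, -, h⟩, hτ⟩ := runs_mainProg hk G (flipSeq F)
  exact ⟨_, t, τ, h, by rw [hτ, if_pos ⟨i, i.2, (trialSucceeds_flipSeq_iff F i).2 hi⟩]⟩

theorem two_thirds_mul_two_pow_le_card (hk : 1 ≤ k) {G : SimpleGraph (Fin n)}
    (hG : Nonempty (G →g cycle k)) :
    2 / 3 * 2 ^ (trialCount k n * (n * flipCount k n)) ≤
      ((Finset.univ.filter fun F : Fin (trialCount k n) → Block n (flipCount k n) =>
        ∃ i, F i ∈ goodBlocks k G).card : ℝ) := by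
  have hcard : (Fintype.card (Fin (trialCount k n) → Block n (flipCount k n)) : ℝ) =
      2 ^ (trialCount k n * (n * flipCount k n)) := by
    rw [Fintype.card_pi_const, card_block]
    push_cast
    rw [← pow_mul, ← pow_mul]
    ring_nf
  refine le_trans ?_ (le_card_exists_mem (le_card_goodBlocks hk hG) (trialCount k n))
  rw [hcard]
  exact mul_le_mul_of_nonneg_right (by linarith [one_sub_pow_trialCount_le hk n]) (by positivity)

theorem two_thirds_le_acceptProb_mainProg (hk : 1 ≤ k) {G : SimpleGraph (Fin n)}
    (hG : Nonempty (G →g cycle k)) : 2 / 3 ≤ acceptProb (mainProg k) (graphInput G) := by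
  set m := trialCount k n * (n * flipCount k n)
  set good := Finset.univ.filter fun F : Fin (trialCount k n) → Block n (flipCount k n) =>
    ∃ i, F i ∈ goodBlocks k G
  have hcard : (2 / 3 : ℝ≥0∞) * 2 ^ m ≤ good.card := by
    have hreal := ENNReal.ofReal_le_ofReal (two_thirds_mul_two_pow_le_card hk hG)
    rwa [ENNReal.ofReal_natCast, ENNReal.ofReal_mul (by norm_num),
      ENNReal.ofReal_div_of_pos (by norm_num), ENNReal.ofReal_pow (by norm_num),
      ENNReal.ofReal_ofNat, ENNReal.ofReal_ofNat] at hreal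
  calc (2 / 3 : ℝ≥0∞) ≤ good.card * (2⁻¹ : ℝ≥0∞) ^ m := by
        rwa [← ENNReal.inv_pow, ← div_eq_mul_inv,
          ENNReal.le_div_iff_mul_le (by simp) (by simp)]
    _ ≤ acceptProb (mainProg k) (graphInput G) :=
        card_mul_inv_two_pow_le_acceptProb (fun F _ => by rw [List.length_map, List.length_range])
          map_flipSeq_injective.injOn
          fun F hF => accepts_mainProg hk (Finset.mem_filter.1 hF).2

end main

end OddCycle

/-! ### Time and space -/

/-- Functions bounded by a polynomial. A single constant serves as the coefficient and as the
degree. -/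
def PolyBounded (f : ℕ → ℕ) : Prop := ∃ c, ∀ n, f n ≤ c * (n + 1) ^ c

namespace PolyBounded

theorem mul_pow_mono {c c' : ℕ} (h : c ≤ c') (n : ℕ) : c * (n + 1) ^ c ≤ c' * (n + 1) ^ c' :=
  Nat.mul_le_mul h (Nat.pow_le_pow_right n.succ_pos h)

theorem const (a : ℕ) : PolyBounded fun _ => a :=
  ⟨a, fun n => Nat.le_mul_of_pos_right _ (pow_pos n.succ_pos a)⟩

theorem id : PolyBounded fun n => n := ⟨1, fun n => by simp⟩

theorem add {f g : ℕ → ℕ} (hf : PolyBounded f) (hg : PolyBounded g) :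
    PolyBounded fun n => f n + g n := by
  obtain ⟨c, hc⟩ := hf
  obtain ⟨e, he⟩ := hg
  refine ⟨c + e, fun n => ?_⟩
  calc f n + g n ≤ c * (n + 1) ^ c + e * (n + 1) ^ e := add_le_add (hc n) (he n)
    _ ≤ c * (n + 1) ^ (c + e) + e * (n + 1) ^ (c + e) := by
        gcongr <;> omega
    _ = (c + e) * (n + 1) ^ (c + e) := (add_mul _ _ _).symm

theorem mul {f g : ℕ → ℕ} (hf : PolyBounded f) (hg : PolyBounded g) :
    PolyBounded fun n => f n * g n := by
  obtain ⟨c, hc⟩ := hf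
  obtain ⟨e, he⟩ := hg
  refine ⟨c * e + (c + e), fun n => ?_⟩
  calc f n * g n ≤ (c * (n + 1) ^ c) * (e * (n + 1) ^ e) := Nat.mul_le_mul (hc n) (he n)
    _ = (c * e) * (n + 1) ^ (c + e) := by ring
    _ ≤ (c * e + (c + e)) * (n + 1) ^ (c * e + (c + e)) :=
        Nat.mul_le_mul (Nat.le_add_right _ _)
          (Nat.pow_le_pow_right n.succ_pos (Nat.le_add_left _ _))

end PolyBounded

namespace OddCycle

open RAM

section resources

variable {k : ℕ}

theorem polyBounded_pairCount (d : ℕ) : PolyBounded fun n => pairCount n d :=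
  (PolyBounded.const _).mul ((PolyBounded.const _).mul (PolyBounded.id.mul .id))

theorem polyBounded_pcTime (d : ℕ) : PolyBounded fun n => pcTime n d :=
  ((polyBounded_pairCount d).add (.const 1)).mul ((polyBounded_pairCount d).mul .id)

theorem polyBounded_mul_flipCount (k : ℕ) : PolyBounded fun n => n * flipCount k n :=
  PolyBounded.id.mul (PolyBounded.id.add (.const _))

theorem polyBounded_addrBound (k : ℕ) : PolyBounded (addrBound k) :=
  ((polyBounded_pairCount _).add .id).add (.const 1)

theorem polyBounded_bitBound (k : ℕ) : PolyBounded (bitBound k) :=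
  ((((((polyBounded_pcTime _).add (polyBounded_mul_flipCount k)).add (polyBounded_pairCount _)).add
    (PolyBounded.id.add (PolyBounded.id.mul .id))).add (.const _)).add
    ((PolyBounded.const _).mul (PolyBounded.id.add (.const 1)))).add (.const _)

theorem polyBounded_trialSteps (k : ℕ) : PolyBounded (trialSteps k) :=
  ((((polyBounded_mul_flipCount k).mul (.const 4)).add
    ((polyBounded_pairCount _).mul (.const 3))).add ((polyBounded_pcTime _).mul (.const 3))).add
    (.const 8)

/-- The polynomial factor of the running time. -/
def timeFactor (k n : ℕ) : ℕ :=
  ((n + 1) * 4 + 6 + 4 * (rateNum k + 1) * (trialSteps k n + 1)) *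
    ((mainProg k).weight * bitBound k n)

theorem polyBounded_timeFactor (k : ℕ) : PolyBounded (timeFactor k) :=
  ((((PolyBounded.id.add (.const 1)).mul (.const 4)).add (.const 6)).add
    ((PolyBounded.const _).mul ((polyBounded_trialSteps k).add (.const 1)))).mul
    ((PolyBounded.const _).mul (polyBounded_bitBound k))

theorem polyBounded_space (k : ℕ) : PolyBounded fun n =>
    spaceBound (addrBound k n) (bitBound k n) + (mainProg k).weight * bitBound k n :=
  (((PolyBounded.const 10).mul (polyBounded_addrBound k)).mul
    (((PolyBounded.const 1).add (polyBounded_addrBound k)).add (polyBounded_bitBound k))).add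
    ((PolyBounded.const _).mul (polyBounded_bitBound k))

theorem mainSteps_mul_le (hk : 1 ≤ k) (n : ℕ) :
    ((mainSteps k n * ((mainProg k).weight * bitBound k n) : ℕ) : ℝ) ≤
      alpha k ^ n * timeFactor k n := by
  have hα : 1 ≤ alpha k ^ n := one_le_pow₀ (one_le_alpha hk)
  unfold mainSteps timeFactor
  push_cast
  rw [← mul_assoc (alpha k ^ n)]
  refine mul_le_mul_of_nonneg_right ?_ (by positivity)
  have hdiv : ((n / (2 * k + 1) : ℕ) : ℝ) ≤ n := by exact_mod_cast Nat.div_le_self _ _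
  have htrials : (trialCount k n : ℝ) * (trialSteps k n + 1) ≤
      4 * (rateNum k + 1) * alpha k ^ n * (trialSteps k n + 1) :=
    mul_le_mul_of_nonneg_right (trialCount_le hk n) (by positivity)
  have hsetup : ((n : ℝ) + 1) * 4 + 6 ≤ alpha k ^ n * ((n + 1) * 4 + 6) :=
    le_mul_of_one_le_left (by positivity) hα
  linarith

theorem haltsWithin_mainProg (hk : 1 ≤ k) : ∃ c : ℕ, ∀ (n : ℕ) (G : SimpleGraph (Fin n)),
    HaltsWithin (mainProg k) (graphInput G) ((c : ℝ) * alpha k ^ n * ((n : ℝ) + 1) ^ c)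
      (c * (n + 1) ^ c) := by
  obtain ⟨c₁, h₁⟩ := polyBounded_timeFactor k
  obtain ⟨c₂, h₂⟩ := polyBounded_space k
  refine ⟨max c₁ c₂, fun n G ω => ?_⟩
  obtain ⟨τ, ⟨t, ht, hexec⟩, -⟩ := runs_mainProg hk G ω
  have hspace := (h₂ n).trans (PolyBounded.mul_pow_mono (le_max_right c₁ c₂) n)
  refine ⟨_, t, τ, hexec.mono hspace, ?_⟩
  have hfactor : (timeFactor k n : ℝ) ≤ (max c₁ c₂ : ℕ) * ((n : ℝ) + 1) ^ max c₁ c₂ := by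
    exact_mod_cast (h₁ n).trans (PolyBounded.mul_pow_mono (le_max_left c₁ c₂) n)
  calc (t : ℝ) ≤ (mainSteps k n * ((mainProg k).weight * bitBound k n) : ℕ) := Nat.cast_le.2 ht
    _ ≤ alpha k ^ n * timeFactor k n := mainSteps_mul_le hk n
    _ ≤ alpha k ^ n * ((max c₁ c₂ : ℕ) * ((n : ℝ) + 1) ^ max c₁ c₂) :=
        mul_le_mul_of_nonneg_left hfactor (pow_pos (alpha_pos hk) n).le
    _ = (max c₁ c₂ : ℕ) * alpha k ^ n * ((n : ℝ) + 1) ^ max c₁ c₂ := by ring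

end resources

end OddCycle

end

theorem theorem2 (k : ℕ) (hk : 1 ≤ k) :
    -- a randomized algorithm with one-sided error, its running time and its space
    (∃ (P : RAM.Prog) (c : ℕ), ∀ (n : ℕ) (G : SimpleGraph (Fin n)),
      RAM.HaltsWithin P (RAM.graphInput G)
        ((c : ℝ) * OddCycle.alpha k ^ n * ((n : ℝ) + 1) ^ c) (c * (n + 1) ^ c) ∧
      (Nonempty (G →g OddCycle.cycle k) → 2 / 3 ≤ RAM.acceptProb P (RAM.graphInput G)) ∧
      (¬ Nonempty (G →g OddCycle.cycle k) → RAM.acceptProb P (RAM.graphInput G) = 0)) ∧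
    -- lists drawn from the three sets: a majority polymorphism
    (∃ f : Fin (2 * k + 1) → Fin (2 * k + 1) → Fin (2 * k + 1) → Fin (2 * k + 1),
      IsMajority f ∧ ∀ a b : Fin 3,
        IsPolymorphism f (OddCycle.edgeRel k (OddCycle.listSet k a) (OddCycle.listSet k b))) ∧
    -- the linear program solves every instance with such lists
    (∀ (n : ℕ) (G : SimpleGraph (Fin n)) (c : Fin n → Fin 3),
      (OddCycle.listHomVCSP k G fun v => OddCycle.listSet k (c v)).saOpt 2 3 =
        (OddCycle.listHomVCSP k G fun v => OddCycle.listSet k (c v)).opt ∧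
      ((OddCycle.listHomVCSP k G fun v => OddCycle.listSet k (c v)).saOpt 2 3 = 0 ↔
        ∃ g : G →g OddCycle.cycle k, ∀ v, g v ∈ OddCycle.listSet k (c v))) ∧
    -- a sample succeeds with probability at least `α_k ^ (-n)` if there is a homomorphism
    (∀ (n : ℕ) (G : SimpleGraph (Fin n)), Nonempty (G →g OddCycle.cycle k) →
      (OddCycle.alpha k ^ n)⁻¹ ≤ OddCycle.sampleSuccess k G) := by
  obtain ⟨c, hc⟩ := OddCycle.haltsWithin_mainProg hk
  exact ⟨⟨OddCycle.mainProg k, c, fun n G => ⟨hc n G,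
      OddCycle.two_thirds_le_acceptProb_mainProg hk, OddCycle.acceptProb_mainProg_eq_zero hk⟩⟩,
    ⟨OddCycle.majority k, OddCycle.isMajority_majority k, OddCycle.isPolymorphism_majority hk⟩,
    fun n G c => ⟨OddCycle.saOpt_eq_opt hk G c, OddCycle.saOpt_eq_zero_iff hk G c⟩,
    fun n G => OddCycle.inv_alpha_pow_le_sampleSuccess hk⟩
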